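/- Let $(a_n)_{n\ge 0}$ be an exponentially bounded sequence of complex numbers ($|a_n|\le C R^n$ for some $C,R>0$) with generating function $G(z)=\sum_{n\ge0}a_nz^n$. Let $r,\varepsilon>0$ and let $L$ be a finite nonempty set of complex numbers of modulus $r$. Suppose that: (1) $G$ extends analytically to the disk $|z|<r$, and further to the disk $|z|<r+\varepsilon$ with the radial slits $\{tp: t\ge 1\}$, $p\in L$, removed; (2) each $p\in L$ is a singularity of $G$: the function $G$ on $|z|<r$ does not continue analytically to a neighbourhood of $p$; (3) $G$ has quasi-unipotent local monodromy (of regular singular type) at each $p\in L$: near $p$, $G$ continues to a multivalued analytic function on a punctured disk centred at $p$, whose branches span a finite-dimensional complex vector space and have moderate growth at $p$ (on each sector of finite opening in the universal cover of the punctured disk they are bounded by $C|z-p|^{-N}$ for some $C,N$), and every eigenvalue of the monodromy operator on the space spanned by the branches is a root of unity. Then $(a_n)$ is of Nilsson type. That is, there are a finite set $S\subset\mathbb Q$, a number $d\in\mathbb N$, a finite set $\Lambda$ of complex numbers of equal magnitude $\rho>0$, and complex numbers $c_{\omega,\lambda}$ for $\omega\in\Omega=(S+\mathbb N)\times\{0,\dots,d\}$,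 $\lambda\in\Lambda$, not all zero, such that, with $h_{(\alpha,\beta)}(n)=(\log n)^\beta/n^\alpha$ and $\Omega$ ordered by $(\alpha,\beta)<(\alpha',\beta')$ if and only if $\alpha<\alpha'$, or $\alpha=\alpha'$ and $\beta'<\beta$, for every $\omega\in\Omega$ $$\Bigl(a_n\rho^{-n}-\sum_{\omega'\le\omega}h_{\omega'}(n)\sum_{\lambda\in\Lambda}c_{\omega',\lambda}(\lambda\rho^{-1})^n\Bigr)\frac1{h_\omega(n)}\to 0\qquad(n\to\infty).$$ -/

import Mathlib

open Filter Topology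

/-- `(a_n)` is exponentially bounded: `|a_n| ≤ C R^n` for all `n`. -/
def ExponentiallyBounded (a : ℕ → ℂ) : Prop :=
  ∃ C R : ℝ, 0 < C ∧ 0 < R ∧ ∀ n, ‖a n‖ ≤ C * R ^ n

/-! ### Sequences of Nilsson type -/

/-- The index set `Ω = (S + ℕ) × {0, …, d}`, as a set of pairs `(α, β)`. -/
def nilssonIndex (S : Finset ℚ) (d : ℕ) : Set (ℚ × ℕ) :=
  {ω | (∃ s ∈ S, ∃ k : ℕ, ω.1 = s + k) ∧ ω.2 ≤ d}

/-- The order `(α', β') ≤ (α, β)` on `Ω`: either `α' < α`, or `α' = α` and `β ≤ β'`. -/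
def nilssonLE (ω' ω : ℚ × ℕ) : Prop :=
  ω'.1 < ω.1 ∨ (ω'.1 = ω.1 ∧ ω.2 ≤ ω'.2)

/-- Every element of `Ω` has only finitely many elements of `Ω` below it. -/
theorem nilssonSegment_finite (S : Finset ℚ) (d : ℕ) (ω : ℚ × ℕ) :
    {ω' | ω' ∈ nilssonIndex S d ∧ nilssonLE ω' ω}.Finite := by
  have h : (⋃ s ∈ S, (fun k : ℕ => s + (k : ℚ)) '' Set.Iic ⌈ω.1 - s⌉₊).Finite :=
    S.finite_toSet.biUnion fun s _ => (Set.finite_Iic _).image _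
  refine (h.prod (Set.finite_Iic d)).subset ?_
  rintro ⟨α, β⟩ ⟨⟨⟨s, hs, k, hk⟩, hβ⟩, hle⟩
  refine ⟨?_, hβ⟩
  simp only [Set.mem_iUnion]
  refine ⟨s, hs, k, ?_, hk.symm⟩
  have hα : α ≤ ω.1 := by
    rcases hle with h | ⟨h, _⟩
    · exact h.le
    · exact h.le
  have h2 : (k : ℚ) ≤ ω.1 - s := by
    simp only at hk
    linarith
  have h3 : (k : ℚ) ≤ (⌈ω.1 - s⌉₊ : ℚ) := h2.trans (Nat.le_ceil _)
  exact_mod_cast h3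

/-- The finite initial segment `{ω' ∈ Ω : ω' ≤ ω}`. -/
noncomputable def nilssonSegment (S : Finset ℚ) (d : ℕ) (ω : ℚ × ℕ) : Finset (ℚ × ℕ) :=
  (nilssonSegment_finite S d ω).toFinset

/-- The Nilsson monomial `h_ω(n) = (log n)^β / n^α` for `ω = (α, β)`. -/
noncomputable def nilssonMonomial (ω : ℚ × ℕ) (n : ℕ) : ℝ :=
  Real.log n ^ ω.2 / (n : ℝ) ^ (ω.1 : ℝ)

/-- The expression `a_n ∼ ∑_{ω ∈ Ω} h_ω(n) ∑_{l ∈ L} c_{ω,l} l^n`, where `Ω` is given by `S`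
and `d`, and the elements of the finite set `L` have magnitude `ρ`. -/
def HasNilssonExpansion (a : ℕ → ℂ) (S : Finset ℚ) (d : ℕ) (ρ : ℝ) (L : Finset ℂ)
    (c : ℚ × ℕ → ℂ → ℂ) : Prop :=
  (∀ ω ∈ nilssonIndex S d,
    Tendsto
      (fun n : ℕ =>
        (a n / (ρ : ℂ) ^ n -
          ∑ ω' ∈ nilssonSegment S d ω,
            (nilssonMonomial ω' n : ℂ) * ∑ l ∈ L, c ω' l * (l / (ρ : ℂ)) ^ n) /
          (nilssonMonomial ω n : ℂ))
      atTop (𝓝 0)) ∧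
  ∃ ω ∈ nilssonIndex S d, ∃ l ∈ L, c ω l ≠ 0

/-- `(a_n)` is a sequence of Nilsson type. -/
def IsNilssonType (a : ℕ → ℂ) : Prop :=
  ∃ (S : Finset ℚ) (d : ℕ) (ρ : ℝ) (L : Finset ℂ) (c : ℚ × ℕ → ℂ → ℂ),
    0 < ρ ∧ (∀ l ∈ L, ‖l‖ = ρ) ∧ HasNilssonExpansion a S d ρ L c

/-! ### The domain of the generating function and its singularities -/

/-- The open disk of radius `r + ε` about `0`, with the radial slits that emanate outwards from
the points of `L` removed. When all points of `L` have modulus `r`, it contains the open disk of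
radius `r`. -/
def slitDisk (r ε : ℝ) (L : Finset ℂ) : Set ℂ :=
  {z | ‖z‖ < r + ε ∧ ∀ l ∈ L, ∀ t : ℝ, 1 ≤ t → z ≠ (t : ℂ) * l}

/-- The boundary point `p` of the open disk of radius `r` is a singularity of `G`: the function
`G` on that disk has no analytic continuation to a neighbourhood of `p`. -/
def IsSingularBoundaryPoint (G : ℂ → ℂ) (r : ℝ) (p : ℂ) : Prop :=
  ¬ ∃ g : ℂ → ℂ, AnalyticAt ℂ g p ∧ ∀ᶠ z in 𝓝[Metric.ball 0 r] p, G z = g z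

/-! ### Local monodromy

For `p ≠ 0`, the punctured disk `0 < |z - p| < δ |p|` has the universal covering
`w ↦ p (1 - e^w)` with total space `logDisk δ`. A multivalued analytic function on the punctured
disk is an analytic function on `logDisk δ`. The radial slit going outwards from `p` lies below the
lines `Im w ∈ π + 2 π ℤ`, so that the slit punctured disk lifts to the strip `|Im w| < π`.
-/

/-- The universal cover of a punctured disk of (relative) radius `δ`. -/
def logDisk (δ : ℝ) : Set ℂ :=
  {w | ‖Complex.exp w‖ < δ}

/-- Translates by `2 π i k` preserve the universal cover. -/
theorem add_mem_logDisk {δ : ℝ} (k : ℤ) {w : ℂ} (hw : w ∈ logDisk δ) :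
    w + k * (2 * Real.pi * Complex.I) ∈ logDisk δ := by
  have h := Complex.exp_periodic.int_mul k w
  simp only [logDisk, Set.mem_ofPred_eq] at hw ⊢
  rw [h]
  exact hw

/-- The deck transformation `w ↦ w + 2 π i k`: going `k` times around the puncture. -/
noncomputable def deckShift (δ : ℝ) (k : ℤ) (w : logDisk δ) : logDisk δ :=
  ⟨w + k * (2 * Real.pi * Complex.I), add_mem_logDisk k w.2⟩

/-- The monodromy operator `(T f)(w) = f(w + 2 π i)` on functions on the universal cover. -/
noncomputable def monodromy (δ : ℝ) : Module.End ℂ (logDisk δ → ℂ) :=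
  LinearMap.funLeft ℂ ℂ (deckShift δ 1)

/-- The space spanned by all branches `w ↦ f(w + 2 π i k)`, `k ∈ ℤ`, of a multivalued function. -/
noncomputable def branchSpace (δ : ℝ) (f : logDisk δ → ℂ) : Submodule ℂ (logDisk δ → ℂ) :=
  Submodule.span ℂ (Set.range fun k : ℤ => f ∘ deckShift δ k)

/-- Moderate growth at the puncture: in every sector, that is, on every horizontal strip of
finite width of the universal cover, `f` is bounded by a power of `1 / |e^w|`. -/
def HasModerateGrowth (δ : ℝ) (f : ℂ → ℂ) : Prop :=
  ∀ M : ℝ, ∃ (C : ℝ) (N : ℕ), ∀ w ∈ logDisk δ, |w.im| ≤ M →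
    ‖f w‖ ≤ C * (‖Complex.exp w‖⁻¹) ^ N

/-- The function `G`, defined near `p ≠ 0` off the radial slit that goes outwards from `p`, has
quasi-unipotent local monodromy at `p`: it continues to a multivalued analytic function `f` on a
punctured disk about `p`, which is of finite determination (its branches span a
finite-dimensional space) and of moderate growth, and all eigenvalues of the monodromy on the
space spanned by the branches are roots of unity. -/
def HasQuasiUnipotentMonodromyAt (G : ℂ → ℂ) (p : ℂ) : Prop :=
  ∃ δ : ℝ, 0 < δ ∧ ∃ f : ℂ → ℂ,
    DifferentiableOn ℂ f (logDisk δ) ∧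
    (∀ w ∈ logDisk δ, |w.im| < Real.pi → f w = G (p * (1 - Complex.exp w))) ∧
    HasModerateGrowth δ f ∧
    FiniteDimensional ℂ (branchSpace δ ((logDisk δ).domRestrict f)) ∧
    ∀ (μ : ℂ) (v : logDisk δ → ℂ), v ∈ branchSpace δ ((logDisk δ).domRestrict f) →
      (monodromy δ).HasEigenvector μ v → ∃ m : ℕ, 0 < m ∧ μ ^ m = 1

/-! Near p ∈ L use the coordinate w = log (1 - z/p). The multivalued continuation of G becomes one
holomorphic function f of w on a left half-plane, and the monodromy T becomes the shift by 2πi. All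
eigenvalues of T on the space of branches are roots of unity, so (T^m - 1)^ν = 0 for some m and ν:
an iterated difference of f with step 2πim vanishes (`exists_iterate_fwdDiff_eq_zero`). Such an f is
a polynomial in w with periodic coefficients, and moderate growth makes these coefficients
meromorphic in e^(w/m) (`exists_binomial_structure`, `exists_logPuiseuxForm`). Thus G is near p a
sum of terms (1 - z/p)^((k - N)/m) log(1 - z/p)^β with k ≥ 0 and finitely many β.

Subtract from G long truncations of these series for all p ∈ L. Near each p the difference is an
analytic function plus O(|z - p|^J) off the slit, so its J-th derivative is bounded on |z| < r, and
by Cauchy its coefficients are O(n^(-J) r^(-n)) (`isBigO_coeff_of_local_bounds`).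

The subtracted terms are treated exactly. The coefficients of (1 - z)^α log(1 - z)^β are the β-th
derivatives at t = α of the coefficients Γ(n - t)/(n! Γ(-t)) of (1 - z)^t. Watson's lemma for a beta
integral expands this ratio in powers of 1/n, uniformly for complex t near α. Uniformity permits
differentiation in t, and differentiating the factor n^(-t-1) creates the powers of log n
(`exists_expansion_iteratedDeriv_binomCoeff`).

Some coefficient of the expansion is nonzero. Otherwise a_n r^n would decrease faster than every
power of n, and G would have a Taylor expansion to all orders along the radius to p
(`exists_radial_expansion`). Comparison with the log-Puiseux form removes logarithms, fractional
powers and poles (`HasLogPuiseuxForm.exists_analyticAt`), so G would continue analytically to p,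
which is excluded. -/

/-! ### Coefficients of (1 - z)^t log(1 - z)^β -/

/-- The coefficient of `z ^ n` in the binomial series of `(1 - z) ^ t`. -/
noncomputable def binomCoeff (n : ℕ) (t : ℂ) : ℂ :=
  ∏ i ∈ Finset.range n, ((i : ℂ) - t) / (i + 1)

theorem binomCoeff_succ (n : ℕ) (t : ℂ) :
    binomCoeff (n + 1) t = binomCoeff n t * (((n : ℂ) - t) / (n + 1)) := by
  rw [binomCoeff, Finset.prod_range_succ, binomCoeff]

theorem differentiable_binomCoeff (n : ℕ) : Differentiable ℂ (binomCoeff n) := by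
  unfold binomCoeff
  fun_prop

theorem binomCoeff_eq_choose (n : ℕ) (t : ℂ) :
    binomCoeff n t = (-1) ^ n * Ring.choose t n := by
  have hp : (descPochhammer ℤ n).smeval t = (-1) ^ n * n.factorial * binomCoeff n t := by
    induction n with
    | zero => simp [binomCoeff]
    | succ n ih =>
      have h2 : (n : ℂ) + 1 ≠ 0 := Nat.cast_add_one_ne_zero n
      rw [descPochhammer_succ_right, Polynomial.smeval_mul, ih, binomCoeff_succ,
        Nat.factorial_succ]
      simp only [Polynomial.smeval_sub, Polynomial.smeval_X, Polynomial.smeval_natCast]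
      push_cast
      field_simp
      simp
      ring
  have hfac : (n.factorial : ℂ) ≠ 0 := by exact_mod_cast n.factorial_ne_zero
  have h1 := Ring.descPochhammer_eq_factorial_smul_choose t n
  rw [hp, nsmul_eq_mul] at h1
  have h3 : ((-1 : ℂ) ^ n) * (-1) ^ n = 1 := by rw [← mul_pow]; simp
  apply mul_left_cancel₀ hfac
  linear_combination (-1) ^ n * h1 - n.factorial * binomCoeff n t * h3

theorem hasSum_binomCoeff (t : ℂ) {z : ℂ} (hz : ‖z‖ < 1) :
    HasSum (fun n : ℕ => binomCoeff n t * z ^ n) ((1 - z) ^ t) := by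
  have h := (Complex.one_add_cpow_hasFPowerSeriesOnBall_zero (a := t)).hasSum
    (y := -z) (by simpa [← ENNReal.ofReal_one, Metric.eball_ofReal] using hz)
  rw [zero_add, ← sub_eq_add_neg] at h
  have e : (fun n : ℕ => binomCoeff n t * z ^ n) = fun n => (binomialSeries ℂ t n) fun _ => -z := by
    funext n
    rw [binomCoeff_eq_choose, binomialSeries_apply, List.ofFn_const, List.prod_replicate,
      neg_pow z n, smul_eq_mul]
    ring
  rw [e]
  exact h

/-- Cauchy's estimate on unit circles in the variable t reduces all derivatives to a bound for
`binomCoeff n` itself, by products whose successive ratios tend to 1. This is what justifies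
differentiating the binomial series termwise in the exponent. -/
theorem exists_summable_bound_binomCoeff (β : ℕ) (R : ℝ) {z : ℂ} (hz : ‖z‖ < 1) :
    ∃ u : ℕ → ℝ, Summable u ∧
      ∀ (n : ℕ) (t : ℂ), ‖t‖ < R → ‖iteratedDeriv β (binomCoeff n) t * z ^ n‖ ≤ u n := by
  -- The ratio test used below needs nonzero terms.
  rcases eq_or_ne z 0 with rfl | hz0
  · obtain ⟨C, hC⟩ : ∃ C, ∀ t ∈ Metric.closedBall (0 : ℂ) R,
        ‖iteratedDeriv β (binomCoeff 0) t‖ ≤ C := by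
      refine (isCompact_closedBall _ _).exists_bound_of_continuousOn ?_
      have : ContDiff ℂ (β + 1 : ℕ) (binomCoeff 0) := (differentiable_binomCoeff 0).contDiff
      exact (this.continuous_iteratedDeriv β (by exact_mod_cast Nat.le_succ β)).continuousOn
    refine ⟨fun n => if n = 0 then C else 0, ?_, ?_⟩
    · exact summable_of_ne_finset_zero (s := {0}) (by intro b hb; simp at hb; simp [hb])
    · intro n t ht
      rcases Nat.eq_zero_or_pos n with rfl | hn
      · simpa using hC t (by simpa using ht.le)
      · simp [hn.ne']
  -- Unit circles about points of norm less than R stay in the disk of radius ρ.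
  set ρ : ℝ := |R| + 1 with hρ
  have hρ0 : 0 < ρ := by positivity
  set v : ℕ → ℝ := fun n => ∏ i ∈ Finset.range n, ((i : ℝ) + ρ) / (i + 1) with hv
  have hv0 : ∀ n, 0 < v n := fun n => Finset.prod_pos fun i _ => by positivity
  have hb : ∀ n (t : ℂ), ‖t‖ ≤ ρ → ‖binomCoeff n t‖ ≤ v n := by
    intro n t ht
    rw [binomCoeff, norm_prod]
    refine Finset.prod_le_prod (fun _ _ => norm_nonneg _) fun i _ => ?_
    rw [norm_div]
    have h1 : ‖(i : ℂ) + 1‖ = i + 1 := by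
      have := Complex.norm_natCast (i + 1); push_cast at this; exact this
    rw [h1]
    gcongr
    calc ‖(i : ℂ) - t‖ ≤ ‖(i : ℂ)‖ + ‖t‖ := norm_sub_le _ _
      _ ≤ i + ρ := by simpa using ht
  have hsum : Summable (fun n => v n * ‖z‖ ^ n) := by
    refine summable_of_ratio_test_tendsto_lt_one hz (Eventually.of_forall fun n => ?_) ?_
    · have := hv0 n; positivity
    · have : ∀ n : ℕ, ‖v (n + 1) * ‖z‖ ^ (n + 1)‖ / ‖v n * ‖z‖ ^ n‖ =
          (1 + (ρ - 1) * (1 / ((n : ℝ) + 1))) * ‖z‖ := by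
        intro n
        have h1 : v (n + 1) = v n * (((n : ℝ) + ρ) / (n + 1)) := by
          simp only [hv]; rw [Finset.prod_range_succ]
        have h2 := (hv0 n).ne'
        have h3 : ‖z‖ ≠ 0 := by simpa using hz0
        have h4 : 0 ≤ v (n + 1) * ‖z‖ ^ (n + 1) := by have := hv0 (n + 1); positivity
        have h5 : 0 ≤ v n * ‖z‖ ^ n := by have := hv0 n; positivity
        rw [Real.norm_of_nonneg h4, Real.norm_of_nonneg h5, h1, pow_succ]
        field_simp
        ring
      simp_rw [this]
      have := (tendsto_one_div_add_atTop_nhds_zero_nat (𝕜 := ℝ)).const_mul (ρ - 1)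
      simpa using (this.const_add 1).mul_const ‖z‖
  refine ⟨fun n => β.factorial * (v n * ‖z‖ ^ n), hsum.mul_left _, fun n t ht => ?_⟩
  have := Complex.norm_iteratedDeriv_le_of_forall_mem_sphere_norm_le (c := t) (C := v n) β
    one_pos (differentiable_binomCoeff n).diffContOnCl (fun s hs => hb n s ?_)
  · rw [norm_mul, norm_pow]
    beta_reduce
    rw [← mul_assoc]
    gcongr
    simpa using this
  · have h1 : ‖s - t‖ = 1 := by simpa [dist_eq_norm] using hs
    calc ‖s‖ = ‖(s - t) + t‖ := by ring_nf
      _ ≤ ‖s - t‖ + ‖t‖ := norm_add_le _ _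
      _ ≤ ρ := by rw [h1, hρ]; linarith [le_abs_self R]

/-- Each derivative in the exponent t of the binomial series brings down one factor log (1 - z). -/
theorem hasSum_iteratedDeriv_binomCoeff (β : ℕ) {z : ℂ} (hz : ‖z‖ < 1) (t : ℂ) :
    HasSum (fun n : ℕ => iteratedDeriv β (binomCoeff n) t * z ^ n)
      ((1 - z) ^ t * Complex.log (1 - z) ^ β) := by
  have hz1 : 1 - z ≠ 0 := by
    intro h
    have : z = 1 := by linear_combination -h
    simp [this] at hz
  induction β generalizing t with
  | zero => simpa using hasSum_binomCoeff t hz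
  | succ β ih =>
    obtain ⟨u, hu, hbd⟩ := exists_summable_bound_binomCoeff β (‖t‖ + 1) hz
    have hd : ∀ n, Differentiable ℂ (iteratedDeriv β (binomCoeff n)) := fun n => by
      have : ContDiff ℂ (β + 1 : ℕ) (binomCoeff n) := (differentiable_binomCoeff n).contDiff
      exact this.differentiable_iteratedDeriv β (by exact_mod_cast Nat.lt_succ_self β)
    have h := Complex.hasSum_deriv_of_summable_norm (z := t) (U := Metric.ball 0 (‖t‖ + 1))
      (F := fun n s => iteratedDeriv β (binomCoeff n) s * z ^ n) hu
      (fun n => ((hd n).mul_const _).differentiableOn) Metric.isOpen_ball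
      (fun n s hs => hbd n s (by simpa using hs)) (by simp)
    have h1 : (fun w => ∑' n : ℕ, iteratedDeriv β (binomCoeff n) w * z ^ n) =
        fun w => (1 - z) ^ w * Complex.log (1 - z) ^ β := funext fun w => (ih w).tsum_eq
    rw [h1] at h
    have h2 : HasDerivAt (fun w => (1 - z) ^ w * Complex.log (1 - z) ^ β)
        ((1 - z) ^ t * Complex.log (1 - z) * Complex.log (1 - z) ^ β) t := by
      have := ((hasDerivAt_id t).const_cpow (c := 1 - z) (Or.inl hz1)).mul_const
        (Complex.log (1 - z) ^ β)
      simpa using this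
    rw [h2.deriv] at h
    have h3 : (fun n : ℕ => iteratedDeriv (β + 1) (binomCoeff n) t * z ^ n) =
        fun n => deriv (fun s => iteratedDeriv β (binomCoeff n) s * z ^ n) t := by
      funext n
      rw [deriv_mul_const (hd n t), iteratedDeriv_succ]
    rw [h3]
    have h4 : (1 - z) ^ t * Complex.log (1 - z) ^ (β + 1) =
        (1 - z) ^ t * Complex.log (1 - z) * Complex.log (1 - z) ^ β := by ring
    rw [h4]
    exact h

/-! ### Gamma quotients as Laplace integrals -/

theorem binomCoeff_eq_Gamma {n : ℕ} {t : ℂ} (h : t.re < n) :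
    binomCoeff n t = Complex.Gamma (n - t) / n.factorial * (Complex.Gamma (-t))⁻¹ := by
  by_cases hG : ∃ m : ℕ, t = m
  · obtain ⟨m, rfl⟩ := hG
    have hm : m < n := by simpa using h
    -- At t = m ∈ ℕ the totalized values Γ(-m) = 0 and 0⁻¹ = 0 agree with the zero of the entire
    -- function 1/Γ; the product vanishes as well because m < n.
    rw [(Complex.Gamma_eq_zero_iff _).2 ⟨m, rfl⟩]
    simp only [inv_zero, mul_zero]
    exact Finset.prod_eq_zero (Finset.mem_range.2 hm) (by simp)
  push Not at hG
  have key : ∀ k : ℕ, binomCoeff k t * k.factorial * Complex.Gamma (-t) =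
      Complex.Gamma (k - t) := by
    intro k
    induction k with
    | zero => simp [binomCoeff]
    | succ k ih =>
      have hk : (k : ℂ) - t ≠ 0 := fun h => hG k (by linear_combination -h)
      have h1 : ((k + 1 : ℕ) : ℂ) - t = (k - t) + 1 := by push_cast; ring
      have h2 : (k : ℂ) + 1 ≠ 0 := Nat.cast_add_one_ne_zero k
      rw [h1, Complex.Gamma_add_one _ hk, ← ih, binomCoeff_succ, Nat.factorial_succ]
      push_cast
      field_simp
  have h0 : Complex.Gamma (-t) ≠ 0 := by
    rw [Ne, Complex.Gamma_eq_zero_iff]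
    rintro ⟨m, hm⟩
    exact hG m (by linear_combination -hm)
  have hf : (n.factorial : ℂ) ≠ 0 := by exact_mod_cast n.factorial_ne_zero
  rw [← key n]
  field_simp

/-- The beta integral B(n - t, t + 1) under the substitution x = e^(-s). In this form n occurs only
in the kernel e^(-ns), so Watson's lemma applies. -/
theorem Gamma_mul_Gamma_div_factorial_eq_integral {n : ℕ} {t : ℂ} (ht : -1 < t.re)
    (htn : t.re < n) :
    Complex.Gamma (n - t) * Complex.Gamma (t + 1) / n.factorial =
      ∫ s in Set.Ioi (0 : ℝ), Complex.exp (-(n * s)) * ((Real.exp s - 1 : ℝ) : ℂ) ^ t := by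
  have h1 := Complex.betaIntegral_eq_Gamma_mul_div (n - t) (t + 1)
    (by simpa using htn) (by simp; linarith)
  have h2 : (n : ℂ) - t + (t + 1) = n + 1 := by ring
  rw [h2, Complex.Gamma_nat_eq_factorial] at h1
  rw [← h1, Complex.betaIntegral, intervalIntegral.integral_of_le zero_le_one,
    MeasureTheory.integral_Ioc_eq_integral_Ioo]
  have himg : (fun s : ℝ => Real.exp (-s)) '' Set.Ioi 0 = Set.Ioo 0 1 := by
    ext x
    constructor
    · rintro ⟨s, hs, rfl⟩
      exact ⟨Real.exp_pos _, by simpa using hs⟩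
    · rintro ⟨h0, h1⟩
      exact ⟨-Real.log x, by simpa using Real.log_neg h0 h1, by simp [Real.exp_log h0]⟩
  rw [← himg, MeasureTheory.integral_image_eq_integral_abs_deriv_smul (f' := fun s => -Real.exp (-s))
    measurableSet_Ioi]
  · refine MeasureTheory.setIntegral_congr_fun measurableSet_Ioi fun s hs => ?_
    have hs : 0 < s := hs
    have e1 : ((Real.exp (-s) : ℝ) : ℂ) ^ ((n : ℂ) - t - 1) =
        Complex.exp (-s * ((n : ℂ) - t - 1)) := by
      rw [Complex.cpow_def_of_ne_zero (by exact_mod_cast (Real.exp_pos _).ne'),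
        ← Complex.ofReal_log (Real.exp_pos _).le, Real.log_exp]
      push_cast
      rfl
    have e2 : (1 - ((Real.exp (-s) : ℝ) : ℂ)) ^ (t + 1 - 1) =
        Complex.exp (-s * t) * ((Real.exp s - 1 : ℝ) : ℂ) ^ t := by
      have h3 : (1 - ((Real.exp (-s) : ℝ) : ℂ)) =
          ((Real.exp (-s) : ℝ) : ℂ) * ((Real.exp s - 1 : ℝ) : ℂ) := by
        have : 1 - Real.exp (-s) = Real.exp (-s) * (Real.exp s - 1) := by
          rw [mul_sub, ← Real.exp_add]; simp
        rw [← Complex.ofReal_mul, ← this]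
        push_cast
        rfl
      rw [h3, add_sub_cancel_right, Complex.mul_cpow_ofReal_nonneg (Real.exp_pos _).le
        (by linarith [Real.add_one_le_exp s])]
      congr 1
      rw [Complex.cpow_def_of_ne_zero (by exact_mod_cast (Real.exp_pos _).ne'),
        ← Complex.ofReal_log (Real.exp_pos _).le, Real.log_exp]
      push_cast
      rfl
    simp only [e1, e2]
    rw [abs_neg, abs_of_pos (Real.exp_pos _), Complex.real_smul, Complex.ofReal_exp, ← mul_assoc,
      ← mul_assoc, ← Complex.exp_add, ← Complex.exp_add]
    congr 2
    push_cast
    ring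
  · intro s _
    have := ((hasDerivAt_neg s).exp).hasDerivWithinAt (s := Set.Ioi 0)
    simpa using this
  · intro a _ b _ hab
    simpa using hab

/-! ### Expansion of ((e^s - 1)/s)^t with remainder bounds for all s > 0 -/

/-- The logarithm of `(e ^ s - 1) / s`. -/
noncomputable def logExpQuot (s : ℝ) : ℝ := Real.log (dslope Real.exp 0 s)

theorem dslope_exp_of_pos {s : ℝ} (hs : 0 < s) : dslope Real.exp 0 s = (Real.exp s - 1) / s := by
  rw [dslope_of_ne _ hs.ne', slope_def_field]
  simp

theorem exp_sub_one_eq {s : ℝ} (hs : 0 < s) : Real.exp s - 1 = s * Real.exp (logExpQuot s) := by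
  rw [logExpQuot, dslope_exp_of_pos hs, Real.exp_log]
  · field_simp
  · exact div_pos (by linarith [Real.add_one_le_exp s, Real.add_one_lt_exp hs.ne']) hs

theorem logExpQuot_nonneg {s : ℝ} (hs : 0 < s) : 0 ≤ logExpQuot s := by
  rw [logExpQuot, dslope_exp_of_pos hs]
  refine Real.log_nonneg ?_
  rw [le_div_iff₀ hs]
  linarith [Real.add_one_le_exp s]

theorem logExpQuot_le {s : ℝ} (hs : 0 < s) : logExpQuot s ≤ s := by
  have h1 : Real.exp (logExpQuot s) ≤ Real.exp s := by
    have h2 := exp_sub_one_eq hs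
    have h3 : 1 - s ≤ Real.exp (-s) := by linarith [Real.add_one_le_exp (-s)]
    have h4 : Real.exp s - 1 ≤ s * Real.exp s := by
      have h5 : Real.exp (-s) * Real.exp s = 1 := by rw [← Real.exp_add]; simp
      nlinarith [Real.exp_pos s]
    rw [h2] at h4
    exact le_of_mul_le_mul_left h4 hs
  exact Real.exp_le_exp.1 h1

theorem analyticAt_logExpQuot : AnalyticAt ℝ logExpQuot 0 := by
  refine AnalyticAt.log ?_ ?_
  · obtain ⟨p, hp⟩ := analyticAt_rexp (x := (0 : ℝ))
    exact ⟨_, hp.has_fpower_series_dslope_fslope⟩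
  · simp

theorem logExpQuot_zero : logExpQuot 0 = 0 := by simp [logExpQuot]

theorem exists_taylor_of_analyticAt {g : ℝ → ℝ} (hg : AnalyticAt ℝ g 0) :
    ∃ μ : ℕ → ℝ, ∀ K : ℕ,
      (fun s => g s - ∑ k ∈ Finset.range K, μ k * s ^ k) =O[𝓝 0] fun s => s ^ K := by
  obtain ⟨p, hp⟩ := hg
  refine ⟨fun k => p.coeff k, fun K => ?_⟩
  have h := hp.isBigO_sub_partialSum_pow K
  rw [← Asymptotics.isBigO_norm_right] at h ⊢
  simpa [FormalMultilinearSeries.partialSum, mul_comm] using h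

/-- The remainder will be integrated over the whole half-line, so a Taylor bound near 0 is not
enough. For large s the bounds 0 ≤ `logExpQuot s` ≤ s and s^k ≤ k! e^s suffice. The first i
coefficients vanish because `logExpQuot` vanishes at 0. -/
theorem exists_expansion_logExpQuot_pow (i : ℕ) :
    ∃ μ : ℕ → ℝ, (∀ k < i, μ k = 0) ∧ ∀ K : ℕ, ∃ C : ℝ, 0 ≤ C ∧ ∀ s : ℝ, 0 < s →
      |logExpQuot s ^ i - ∑ k ∈ Finset.range K, μ k * s ^ k| ≤ C * (s ^ K * Real.exp s) := by
  have han : AnalyticAt ℝ (fun s => dslope logExpQuot 0 s ^ i) 0 := by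
    obtain ⟨p, hp⟩ := analyticAt_logExpQuot
    exact AnalyticAt.pow ⟨_, hp.has_fpower_series_dslope_fslope⟩ i
  obtain ⟨ν, hν⟩ := exists_taylor_of_analyticAt han
  have hl : ∀ s : ℝ, logExpQuot s = s * dslope logExpQuot 0 s := by
    intro s
    have := sub_smul_dslope logExpQuot 0 s
    simpa [logExpQuot_zero] using this.symm
  set μ : ℕ → ℝ := fun k => if i ≤ k then ν (k - i) else 0 with hμ
  have hloc : ∀ K : ℕ, (fun s => logExpQuot s ^ i - ∑ k ∈ Finset.range K, μ k * s ^ k) =O[𝓝 0]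
      fun s => s ^ K := by
    intro K
    rcases le_or_gt i K with hK | hK
    · have h1 := (hν (K - i)).mul (Asymptotics.isBigO_refl (fun s : ℝ => s ^ i) (𝓝 0))
      have e1 : (fun s : ℝ => s ^ (K - i) * s ^ i) = fun s => s ^ K := by
        funext s; rw [← pow_add, Nat.sub_add_cancel hK]
      rw [e1] at h1
      refine h1.congr_left fun s => ?_
      rw [hl s, mul_pow, sub_mul, mul_comm (s ^ i), Finset.sum_mul]
      congr 1
      obtain ⟨j, rfl⟩ := Nat.exists_eq_add_of_le hK
      rw [Finset.sum_range_add]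
      simp only [Nat.add_sub_cancel_left]
      rw [Finset.sum_eq_zero (s := Finset.range i)]
      · rw [zero_add]
        refine Finset.sum_congr rfl fun k _ => ?_
        simp [hμ, pow_add]
        ring
      · intro k hk
        have : ¬ i ≤ k := by simpa using hk
        simp [hμ, this]
    · have h0 : ∀ s : ℝ, ∑ k ∈ Finset.range K, μ k * s ^ k = 0 := fun s => by
        refine Finset.sum_eq_zero fun k hk => ?_
        have : ¬ i ≤ k := by have := Finset.mem_range.1 hk; omega
        simp [hμ, this]
      simp only [h0, sub_zero]
      have h1 : (fun s : ℝ => dslope logExpQuot 0 s ^ i * s ^ (i - K)) =O[𝓝 0] fun _ => (1 : ℝ) :=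
        (han.continuousAt.mul (by fun_prop)).isBigO_one ℝ
      have h2 := h1.mul (Asymptotics.isBigO_refl (fun s : ℝ => s ^ K) (𝓝 0))
      simp only [one_mul] at h2
      refine h2.congr_left fun s => ?_
      rw [hl s, mul_pow, mul_assoc, ← pow_add, Nat.sub_add_cancel hK.le, mul_comm]
  refine ⟨μ, fun k hk => by simp [hμ, not_le.2 hk], fun K => ?_⟩
  obtain ⟨C₁, hC₁⟩ := (hloc K).bound
  obtain ⟨η, hη, hball⟩ := Metric.eventually_nhds_iff.1 hC₁
  have hfac : ∀ k (s : ℝ), 0 < s → s ^ k ≤ k.factorial * Real.exp s := fun k s hs => by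
    have := Real.pow_div_factorial_le_exp s hs.le k
    rwa [div_le_iff₀ (by positivity), mul_comm] at this
  -- The division by η^K is paid for by s^K ≥ η^K when s ≥ η.
  set C₂ : ℝ := ((i.factorial : ℝ) + ∑ k ∈ Finset.range K, |μ k| * k.factorial) / η ^ K with hC₂
  have hC₂0 : 0 ≤ C₂ := by positivity
  refine ⟨|C₁| + C₂, by positivity, fun s hs => ?_⟩
  have hexp : 1 ≤ Real.exp s := Real.one_le_exp hs.le
  rcases lt_or_ge s η with h | h
  · have := hball (y := s) (by simpa [abs_of_pos hs] using h)
    rw [Real.norm_eq_abs, Real.norm_eq_abs, abs_of_pos (pow_pos hs K)] at this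
    calc _ ≤ C₁ * s ^ K := this
      _ ≤ |C₁| * (s ^ K * Real.exp s) := by
        have := le_abs_self C₁
        have h0 : 0 < s ^ K := pow_pos hs K
        have h2 : s ^ K ≤ s ^ K * Real.exp s := le_mul_of_one_le_right h0.le hexp
        exact mul_le_mul this h2 h0.le (abs_nonneg _)
      _ ≤ _ := by
        have : 0 ≤ s ^ K * Real.exp s := by positivity
        nlinarith
  · have h1 : |logExpQuot s ^ i - ∑ k ∈ Finset.range K, μ k * s ^ k| ≤
        ((i.factorial : ℝ) + ∑ k ∈ Finset.range K, |μ k| * k.factorial) * Real.exp s := by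
      refine (abs_sub _ _).trans ?_
      rw [add_mul]
      refine add_le_add ?_ ?_
      · rw [abs_pow, abs_of_nonneg (logExpQuot_nonneg hs)]
        exact (pow_le_pow_left₀ (logExpQuot_nonneg hs) (logExpQuot_le hs) i).trans (hfac i s hs)
      · refine (Finset.abs_sum_le_sum_abs _ _).trans ?_
        rw [Finset.sum_mul]
        refine Finset.sum_le_sum fun k _ => ?_
        rw [abs_mul, abs_of_pos (pow_pos hs k), mul_assoc]
        exact mul_le_mul_of_nonneg_left (hfac k s hs) (abs_nonneg _)
    refine h1.trans ?_
    have h2 : η ^ K ≤ s ^ K := pow_le_pow_left₀ hη.le h K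
    have h3 : ((i.factorial : ℝ) + ∑ k ∈ Finset.range K, |μ k| * k.factorial) ≤ C₂ * s ^ K := by
      rw [hC₂, div_mul_eq_mul_div, le_div_iff₀ (by positivity)]
      gcongr
    calc _ ≤ (C₂ * s ^ K) * Real.exp s := by gcongr
      _ ≤ _ := by
        have : 0 ≤ s ^ K * Real.exp s := by positivity
        nlinarith [abs_nonneg C₁]

/-- Expand the exponential in powers of t · `logExpQuot s`. The i-th power starts at s^i, so only i
≤ k contributes to s^k, and the coefficients are polynomials in t; this gives uniformity for bounded
t. -/
theorem exists_expansion_exp_mul_logExpQuot :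
    ∃ p : ℕ → ℂ → ℂ, (∀ k, Differentiable ℂ (p k)) ∧ ∀ (R : ℝ) (K : ℕ), ∃ C : ℝ, 0 ≤ C ∧
      ∀ (t : ℂ) (s : ℝ), ‖t‖ ≤ R → 0 < s →
        ‖Complex.exp (t * logExpQuot s) - ∑ k ∈ Finset.range K, p k t * (s : ℂ) ^ k‖ ≤
          C * (s ^ K * Real.exp ((R + 1) * s)) := by
  choose μ hμ0 hμ using exists_expansion_logExpQuot_pow
  refine ⟨fun k t => ∑ i ∈ Finset.range (k + 1), t ^ i / i.factorial * (μ i k : ℂ),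
    fun k => by fun_prop, fun R K => ?_⟩
  choose D hD0 hD using fun i => hμ i K
  refine ⟨|R| ^ K + ∑ i ∈ Finset.range K, |R| ^ i / i.factorial * D i, ?_, fun t s ht hs => ?_⟩
  · have : ∀ i, 0 ≤ |R| ^ i / i.factorial * D i := fun i => by have := hD0 i; positivity
    have := Finset.sum_nonneg (s := Finset.range K) fun i _ => this i
    positivity
  have hR : 0 ≤ R := (norm_nonneg t).trans ht
  rw [abs_of_nonneg hR]
  have hswap : ∑ k ∈ Finset.range K, (∑ i ∈ Finset.range (k + 1),
      t ^ i / i.factorial * (μ i k : ℂ)) * (s : ℂ) ^ k =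
      ∑ i ∈ Finset.range K, t ^ i / i.factorial *
        ((∑ k ∈ Finset.range K, μ i k * s ^ k : ℝ) : ℂ) := by
    push_cast
    simp_rw [Finset.mul_sum]
    rw [Finset.sum_comm]
    refine Finset.sum_congr rfl fun k hk => ?_
    have hk := Finset.mem_range.1 hk
    rw [Finset.sum_mul]
    rw [← Finset.sum_subset (Finset.range_subset_range.2 (Nat.succ_le_of_lt hk))]
    · exact Finset.sum_congr rfl fun i _ => by ring
    · intro i _ hi
      have : k < i := by simpa using hi
      rw [hμ0 i k this]
      simp
  rw [hswap]
  have hsplit : Complex.exp (t * logExpQuot s) - ∑ i ∈ Finset.range K, t ^ i / i.factorial *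
        ((∑ k ∈ Finset.range K, μ i k * s ^ k : ℝ) : ℂ) =
      (Complex.exp (t * logExpQuot s) -
        ∑ i ∈ Finset.range K, (t * logExpQuot s) ^ i / i.factorial) +
      ∑ i ∈ Finset.range K, t ^ i / i.factorial *
        ((logExpQuot s ^ i - ∑ k ∈ Finset.range K, μ i k * s ^ k : ℝ) : ℂ) := by
    rw [sub_add, sub_right_inj, ← Finset.sum_sub_distrib]
    refine Finset.sum_congr rfl fun i _ => ?_
    push_cast
    ring
  rw [hsplit, add_mul]
  have hl0 := logExpQuot_nonneg hs
  have hl1 := logExpQuot_le hs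
  have hn : ‖t * (logExpQuot s : ℂ)‖ ≤ R * s := by
    rw [norm_mul, Complex.norm_real, Real.norm_of_nonneg hl0]
    gcongr
  refine (norm_add_le _ _).trans (add_le_add ?_ ?_)
  · refine (Complex.norm_exp_sub_sum_le_norm_mul_exp _ K).trans ?_
    rw [← mul_assoc, ← mul_pow]
    gcongr
    linarith
  · refine (norm_sum_le _ _).trans ?_
    rw [Finset.sum_mul]
    refine Finset.sum_le_sum fun i _ => ?_
    rw [norm_mul, norm_div, norm_pow, Complex.norm_natCast, Complex.norm_real, Real.norm_eq_abs,
      mul_assoc]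
    have h1 := hD i s hs
    have h2 : Real.exp s ≤ Real.exp ((R + 1) * s) := Real.exp_le_exp.2 (by nlinarith)
    have h3 := hD0 i
    calc _ ≤ R ^ i / i.factorial * (D i * (s ^ K * Real.exp s)) := by gcongr
      _ ≤ _ := by gcongr

/-! ### Watson's lemma, uniformly in the exponent -/

theorem integrableOn_rpow_mul_exp_neg_mul {a b : ℝ} (ha : -1 < a) (hb : 0 < b) :
    MeasureTheory.IntegrableOn (fun s : ℝ => s ^ a * Real.exp (-(b * s))) (Set.Ioi 0) := by
  have := integrableOn_rpow_mul_exp_neg_mul_rpow (p := 1) ha one_pos hb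
  simpa using this

theorem integrableOn_cpow_mul_exp_neg_mul {a : ℂ} {b : ℝ} (ha : -1 < a.re) (hb : 0 < b) :
    MeasureTheory.IntegrableOn (fun s : ℝ => (s : ℂ) ^ a * Complex.exp (-(b * s)))
      (Set.Ioi 0) := by
  refine (integrableOn_rpow_mul_exp_neg_mul ha hb).mono' ?_ ?_
  · refine ContinuousOn.aestronglyMeasurable (fun s hs => ContinuousAt.continuousWithinAt ?_)
      measurableSet_Ioi
    have hs : 0 < s := hs
    refine ContinuousAt.mul ?_ (by fun_prop)
    exact (Complex.continuous_ofReal.continuousAt).cpow continuousAt_const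
      (Or.inl (by simpa using hs))
  · refine (MeasureTheory.ae_restrict_iff' measurableSet_Ioi).2 (MeasureTheory.ae_of_all _ fun s hs => ?_)
    have hs : 0 < s := hs
    rw [norm_mul, Complex.norm_cpow_eq_rpow_re_of_pos hs, Complex.norm_exp]
    simp

/-- Watson's lemma: the expansion of the amplitude at s = 0 is integrated termwise against e^(-ns),
each power of s giving a Gamma value. -/
theorem exists_gammaRatio_integral_bound :
    ∃ p : ℕ → ℂ → ℂ, (∀ k, Differentiable ℂ (p k)) ∧ ∀ (R : ℝ) (K : ℕ), ∃ C : ℝ, 0 ≤ C ∧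
      ∀ (t : ℂ) (n : ℕ), ‖t‖ ≤ R → -1 < t.re → 2 * (R + 1) ≤ n → 
        ‖Complex.Gamma (n - t) * Complex.Gamma (t + 1) / n.factorial -
          ∑ k ∈ Finset.range K, p k t * ((1 / (n : ℂ)) ^ (t + 1 + k) * Complex.Gamma (t + 1 + k))‖ ≤
          C * ((1 / ((n : ℝ) / 2)) ^ (t.re + K + 1) * Real.Gamma (t.re + K + 1)) := by
  obtain ⟨p, hp, hb⟩ := exists_expansion_exp_mul_logExpQuot
  refine ⟨p, hp, fun R K => ?_⟩
  obtain ⟨C, hC0, hC⟩ := hb R K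
  refine ⟨C, hC0, fun t n ht hre hn => ?_⟩
  have hR : 0 ≤ R := (norm_nonneg t).trans ht
  have hn0 : (0 : ℝ) < n := by linarith
  have htR : t.re ≤ R := (Complex.re_le_norm t).trans ht
  have hterm : ∀ k : ℕ, MeasureTheory.IntegrableOn (fun s : ℝ => p k t *
      ((s : ℂ) ^ (t + 1 + k - 1) * Complex.exp (-((n : ℝ) * s)))) (Set.Ioi 0) := fun k =>
    (integrableOn_cpow_mul_exp_neg_mul (by simp; linarith [(Nat.cast_nonneg k : (0 : ℝ) ≤ k)])
      hn0).const_mul _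
  have hint : ∀ k : ℕ, ∫ s in Set.Ioi (0 : ℝ), p k t *
      ((s : ℂ) ^ (t + 1 + k - 1) * Complex.exp (-((n : ℝ) * s))) =
      p k t * ((1 / (n : ℂ)) ^ (t + 1 + k) * Complex.Gamma (t + 1 + k)) := fun k => by
    rw [MeasureTheory.integral_const_mul, Complex.integral_cpow_mul_exp_neg_mul_Ioi _ hn0]
    · simp
    · simp; linarith [(Nat.cast_nonneg k : (0 : ℝ) ≤ k)]
  rw [Gamma_mul_Gamma_div_factorial_eq_integral hre (by linarith)]
  simp_rw [← hint]
  rw [← MeasureTheory.integral_finsetSum _ fun k _ => hterm k]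
  set F : ℝ → ℂ := fun s => Complex.exp (-(n * s)) * ((Real.exp s - 1 : ℝ) : ℂ) ^ t with hF
  set T : ℝ → ℂ := fun s => ∑ k ∈ Finset.range K, p k t *
      ((s : ℂ) ^ (t + 1 + k - 1) * Complex.exp (-((n : ℝ) * s))) with hT
  have hTint : MeasureTheory.IntegrableOn T (Set.Ioi 0) :=
    MeasureTheory.integrable_finsetSum _ fun k _ => hterm k
  have hbnd : ∀ s ∈ Set.Ioi (0 : ℝ), ‖F s - T s‖ ≤
      C * (s ^ (t.re + K + 1 - 1) * Real.exp (-((n : ℝ) / 2 * s))) := by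
    intro s hs
    have hs : 0 < s := hs
    have hs' : (s : ℂ) ≠ 0 := by exact_mod_cast hs.ne'
    have e1 : F s = ((s : ℂ) ^ t * Complex.exp (-((n : ℝ) * s))) *
        Complex.exp (t * logExpQuot s) := by
      simp only [hF]
      rw [exp_sub_one_eq hs, Complex.ofReal_mul, Complex.mul_cpow_ofReal_nonneg hs.le
        (Real.exp_pos _).le, Complex.cpow_def_of_ne_zero (x := ((Real.exp _ : ℝ) : ℂ))
          (by exact_mod_cast (Real.exp_pos _).ne'), ← Complex.ofReal_log (Real.exp_pos _).le,
          Real.log_exp]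
      push_cast
      ring_nf
    have e2 : T s = ((s : ℂ) ^ t * Complex.exp (-((n : ℝ) * s))) *
        ∑ k ∈ Finset.range K, p k t * (s : ℂ) ^ k := by
      simp only [hT]
      rw [Finset.mul_sum]
      refine Finset.sum_congr rfl fun k _ => ?_
      rw [show t + 1 + (k : ℂ) - 1 = t + k by ring, Complex.cpow_add _ _ hs', Complex.cpow_natCast]
      ring
    rw [e1, e2, ← mul_sub, norm_mul, norm_mul, Complex.norm_cpow_eq_rpow_re_of_pos hs,
      Complex.norm_exp]
    have h1 := hC t s ht hs
    have h2 : s ^ (t.re + K + 1 - 1) = s ^ t.re * s ^ K := by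
      rw [add_sub_cancel_right, Real.rpow_add hs, Real.rpow_natCast]
    -- Since n ≥ 2(R + 1), half of the decay of e^(-ns) absorbs the growth of the remainder.
    have h3 : Real.exp (-((n : ℝ) * s)) * Real.exp ((R + 1) * s) ≤
        Real.exp (-((n : ℝ) / 2 * s)) := by
      rw [← Real.exp_add]
      refine Real.exp_le_exp.2 ?_
      nlinarith
    have h4 : ((-(((n : ℝ) : ℂ) * (s : ℂ)) : ℂ)).re = -((n : ℝ) * s) := by simp
    rw [h2, h4]
    calc _ ≤ s ^ t.re * Real.exp (-((n : ℝ) * s)) * (C * (s ^ K * Real.exp ((R + 1) * s))) := by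
          gcongr
      _ = C * (s ^ t.re * s ^ K * (Real.exp (-((n : ℝ) * s)) * Real.exp ((R + 1) * s))) := by ring
      _ ≤ _ := by gcongr
  have hBint : MeasureTheory.IntegrableOn (fun s : ℝ =>
      C * (s ^ (t.re + K + 1 - 1) * Real.exp (-((n : ℝ) / 2 * s)))) (Set.Ioi 0) :=
    (integrableOn_rpow_mul_exp_neg_mul (by linarith [(Nat.cast_nonneg K : (0 : ℝ) ≤ K)])
      (by positivity)).const_mul _
  have hae := (MeasureTheory.ae_restrict_iff' (μ := MeasureTheory.volume) measurableSet_Ioi).2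
    (MeasureTheory.ae_of_all _ hbnd)
  have hFm : MeasureTheory.AEStronglyMeasurable F
      (MeasureTheory.volume.restrict (Set.Ioi (0 : ℝ))) := by
    refine ContinuousOn.aestronglyMeasurable (fun s hs => ContinuousAt.continuousWithinAt ?_)
      measurableSet_Ioi
    have hs : 0 < s := hs
    refine ContinuousAt.mul (by fun_prop) (ContinuousAt.cpow (by fun_prop) continuousAt_const
      (Or.inl ?_))
    rw [Complex.ofReal_re]
    linarith [Real.add_one_lt_exp hs.ne']
  -- Integrability of `F` is deduced from that of `T` and of the bound for `F - T`.
  have hFT : MeasureTheory.IntegrableOn (fun s => F s - T s) (Set.Ioi 0) :=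
    hBint.mono' (hFm.sub hTint.1) hae
  have hFint : MeasureTheory.IntegrableOn F (Set.Ioi 0) := by
    have := hFT.add hTint
    refine this.congr (MeasureTheory.ae_of_all _ fun s => ?_)
    simp
  rw [← MeasureTheory.integral_sub hFint hTint]
  refine (MeasureTheory.norm_integral_le_of_norm_le hBint hae).trans (le_of_eq ?_)
  rw [MeasureTheory.integral_const_mul, Real.integral_rpow_mul_exp_neg_mul_Ioi _ (by positivity)]
  linarith [(Nat.cast_nonneg K : (0 : ℝ) ≤ K)]

/-! ### Expansion of the Gamma ratio near an arbitrary real exponent -/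

/-- The ratio `Γ(n - t) / Γ(n + 1)`, normalized so as to tend to `1`. -/
noncomputable def gammaRatio (n : ℕ) (t : ℂ) : ℂ :=
  Complex.Gamma (n - t) / n.factorial * (n : ℂ) ^ (t + 1)

/-- `gammaRatio n` has an asymptotic expansion in powers of `n⁻¹`, uniformly near `α`. -/
def HasUniformGammaExpansion (α : ℝ) (q : ℕ → ℂ → ℂ) : Prop :=
  (∀ k, DifferentiableOn ℂ (q k) (Metric.ball (α : ℂ) 1)) ∧
    ∀ K : ℕ, ∃ C : ℝ, ∀ᶠ n : ℕ in atTop, ∀ t ∈ Metric.closedBall (α : ℂ) (1 / 2),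
      ‖gammaRatio n t - ∑ k ∈ Finset.range K, q k t * ((n : ℂ)⁻¹) ^ k‖ ≤ C * ((n : ℝ)⁻¹) ^ K

theorem re_gt_of_mem_ball {α δ : ℝ} {t : ℂ} (ht : t ∈ Metric.ball (α : ℂ) δ) : α - δ < t.re := by
  have h1 : |(t - α).re| < δ := (Complex.abs_re_le_norm _).trans_lt (by
    simpa [dist_eq_norm] using ht)
  simp only [Complex.sub_re, Complex.ofReal_re] at h1
  linarith [(abs_lt.1 h1).1]

theorem closedBall_half_subset_ball (α : ℝ) :
    Metric.closedBall (α : ℂ) (1 / 2) ⊆ Metric.ball (α : ℂ) 1 :=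
  Metric.closedBall_subset_ball (by norm_num)

/-- For α ≥ 0 the unit disk about α lies in Re t > -1, where the integral converges and Γ(t + 1) has
no zero, so that Watson's expansion can be divided by Γ(t + 1). -/
theorem exists_uniformGammaExpansion_of_nonneg {α : ℝ} (hα : 0 ≤ α) :
    ∃ q, HasUniformGammaExpansion α q := by
  obtain ⟨p, hp, hb⟩ := exists_gammaRatio_integral_bound
  have hre : ∀ t ∈ Metric.ball (α : ℂ) 1, -1 < t.re := fun t ht => by
    linarith [re_gt_of_mem_ball ht]
  refine ⟨fun k t => p k t * (Complex.Gamma (t + 1 + k) * (Complex.Gamma (t + 1))⁻¹),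
    fun k t ht => ?_, fun K => ?_⟩
  · have h1 := hre t ht
    refine DifferentiableAt.differentiableWithinAt ?_
    refine (hp k t).mul (DifferentiableAt.mul ?_ ?_)
    · refine DifferentiableAt.comp (g := Complex.Gamma) t
        (Complex.differentiableAt_Gamma _ fun m h => ?_) (by fun_prop)
      have := congrArg Complex.re h
      simp at this
      linarith [(Nat.cast_nonneg k : (0 : ℝ) ≤ k), (Nat.cast_nonneg m : (0 : ℝ) ≤ m)]
    · exact DifferentiableAt.comp (g := fun s => (Complex.Gamma s)⁻¹) t
        Complex.differentiable_one_div_Gamma.differentiableAt (by fun_prop)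
  obtain ⟨C, hC0, hC⟩ := hb (‖(α : ℂ)‖ + 1 / 2) K
  obtain ⟨D, hD⟩ : ∃ D, ∀ t ∈ Metric.closedBall (α : ℂ) (1 / 2),
      ‖‖(Complex.Gamma (t + 1))⁻¹‖ * ((2 : ℝ) ^ (t.re + K + 1) * Real.Gamma (t.re + K + 1))‖ ≤ D := by
    refine (isCompact_closedBall _ _).exists_bound_of_continuousOn fun t ht => ?_
    have h1 := hre t (closedBall_half_subset_ball α ht)
    refine ContinuousAt.continuousWithinAt ?_
    refine ContinuousAt.mul ?_ (ContinuousAt.mul ?_ ?_)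
    · refine ContinuousAt.norm ?_
      exact ContinuousAt.comp (g := fun s => (Complex.Gamma s)⁻¹)
        Complex.differentiable_one_div_Gamma.continuous.continuousAt (by fun_prop)
    · exact ContinuousAt.rpow continuousAt_const (by fun_prop) (Or.inl (by norm_num))
    · refine ContinuousAt.comp (g := Real.Gamma) (f := fun t : ℂ => t.re + K + 1) ?_ (by fun_prop)
      refine (Real.differentiableAt_Gamma fun m h => ?_).continuousAt
      linarith [(Nat.cast_nonneg K : (0 : ℝ) ≤ K), (Nat.cast_nonneg m : (0 : ℝ) ≤ m)]
  refine ⟨C * D, ?_⟩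
  filter_upwards [eventually_ge_atTop (⌈2 * (‖(α : ℂ)‖ + 1 / 2 + 1)⌉₊)] with n hn t ht
  have hn' : 2 * (‖(α : ℂ)‖ + 1 / 2 + 1) ≤ n := (Nat.le_ceil _).trans (by exact_mod_cast hn)
  have hnpos : (0 : ℝ) < n := by linarith [norm_nonneg (α : ℂ)]
  have hn0 : (n : ℂ) ≠ 0 := by exact_mod_cast hnpos.ne'
  have h1 := hre t (closedBall_half_subset_ball α ht)
  have htn : ‖t‖ ≤ ‖(α : ℂ)‖ + 1 / 2 := by
    have : ‖t - α‖ ≤ 1 / 2 := by simpa [dist_eq_norm] using ht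
    calc ‖t‖ = ‖(α : ℂ) + (t - α)‖ := by congr 1; ring
      _ ≤ _ := (norm_add_le _ _).trans (by linarith)
  have hG : Complex.Gamma (t + 1) ≠ 0 :=
    Complex.Gamma_ne_zero_of_re_pos (by simp; linarith)
  have key := hC t n htn h1 hn'
  have hpow : ∀ k : ℕ, (n : ℂ) ^ (t + 1) * (1 / (n : ℂ)) ^ (t + 1 + k) = ((n : ℂ)⁻¹) ^ k := by
    intro k
    rw [one_div, Complex.cpow_add _ _ (inv_ne_zero hn0), Complex.cpow_natCast, ← mul_assoc,
      Complex.inv_cpow _ _ (by rw [Complex.natCast_arg]; exact Real.pi_pos.ne),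
      mul_inv_cancel₀ (by simp [Complex.cpow_eq_zero_iff, hn0]), one_mul]
  have e : gammaRatio n t - ∑ k ∈ Finset.range K,
      p k t * (Complex.Gamma (t + 1 + k) * (Complex.Gamma (t + 1))⁻¹) * ((n : ℂ)⁻¹) ^ k =
      (Complex.Gamma (t + 1))⁻¹ * (n : ℂ) ^ (t + 1) *
        (Complex.Gamma (n - t) * Complex.Gamma (t + 1) / n.factorial -
          ∑ k ∈ Finset.range K,
            p k t * ((1 / (n : ℂ)) ^ (t + 1 + k) * Complex.Gamma (t + 1 + k))) := by
    rw [mul_sub, Finset.mul_sum]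
    congr 1
    · rw [gammaRatio]
      field_simp
    · refine Finset.sum_congr rfl fun k _ => ?_
      rw [← hpow]
      ring
  rw [e, norm_mul, norm_mul, Complex.norm_natCast_cpow_of_pos (by exact_mod_cast hnpos)]
  have hrp : (n : ℝ) ^ (t + 1).re * (1 / ((n : ℝ) / 2)) ^ (t.re + K + 1) =
      (2 : ℝ) ^ (t.re + K + 1) * ((n : ℝ)⁻¹) ^ K := by
    have : 1 / ((n : ℝ) / 2) = 2 * (n : ℝ)⁻¹ := by field_simp
    rw [this, Real.mul_rpow (by norm_num) (by positivity), mul_left_comm]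
    congr 1
    rw [show t.re + K + 1 = (t + 1).re + K by simp; ring, Real.rpow_add (by positivity),
      Real.rpow_natCast, ← mul_assoc, ← Real.mul_rpow (by positivity) (by positivity),
      mul_inv_cancel₀ hnpos.ne', Real.one_rpow, one_mul]
  calc _ ≤ ‖(Complex.Gamma (t + 1))⁻¹‖ * (n : ℝ) ^ (t + 1).re *
        (C * ((1 / ((n : ℝ) / 2)) ^ (t.re + K + 1) * Real.Gamma (t.re + K + 1))) := by gcongr
    _ = C * (‖(Complex.Gamma (t + 1))⁻¹‖ * (((n : ℝ) ^ (t + 1).re *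
          (1 / ((n : ℝ) / 2)) ^ (t.re + K + 1)) * Real.Gamma (t.re + K + 1))) := by ring
    _ = C * (‖(Complex.Gamma (t + 1))⁻¹‖ * ((2 : ℝ) ^ (t.re + K + 1) *
          Real.Gamma (t.re + K + 1))) * ((n : ℝ)⁻¹) ^ K := by rw [hrp]; ring
    _ ≤ _ := by
      have := (le_abs_self _).trans (hD t ht)
      gcongr

/-- By Γ(x + 1) = x Γ(x), the ratio at t is (1 - (t + 1)/n) times the ratio at t + 1. Repeated use
reaches negative α, where the integral representation is lost. -/
theorem HasUniformGammaExpansion.sub_one {α : ℝ} {q : ℕ → ℂ → ℂ}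
    (h : HasUniformGammaExpansion α q) : ∃ q', HasUniformGammaExpansion (α - 1) q' := by
  have hball : ∀ (δ : ℝ) (t : ℂ), dist t ((α - 1 : ℝ) : ℂ) = dist (t + 1) (α : ℂ) := fun δ t => by
    rw [dist_eq_norm, dist_eq_norm]
    congr 1
    push_cast
    ring
  set q₁ : ℕ → ℂ → ℂ := fun k T => if k = 0 then 0 else q (k - 1) T with hq₁
  have hq₁d : ∀ k, DifferentiableOn ℂ (q₁ k) (Metric.ball (α : ℂ) 1) := fun k => by
    rcases eq_or_ne k 0 with rfl | hk
    · simp only [hq₁, if_true]; exact differentiableOn_const _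
    · simp only [hq₁, hk, if_false]; exact h.1 _
  -- The last term restores what multiplication by 1 - T y pushes into degree K, beyond the
  -- truncation.
  have hsum : ∀ (K : ℕ) (T y : ℂ), ∑ k ∈ Finset.range K, (q k T - T * q₁ k T) * y ^ k =
      (1 - T * y) * ∑ k ∈ Finset.range K, q k T * y ^ k + T * q₁ K T * y ^ K := by
    intro K T y
    induction K with
    | zero => simp [hq₁]
    | succ K ih =>
      rw [Finset.sum_range_succ, ih, Finset.sum_range_succ]
      have : q₁ (K + 1) T = q K T := by simp [hq₁]
      rw [this]
      ring
  refine ⟨fun k t => q k (t + 1) - (t + 1) * q₁ k (t + 1), fun k => ?_, fun K => ?_⟩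
  · have hm : Set.MapsTo (fun t : ℂ => t + 1) (Metric.ball ((α - 1 : ℝ) : ℂ) 1)
        (Metric.ball (α : ℂ) 1) := fun t ht => by
      rw [Metric.mem_ball, ← hball 1]
      exact ht
    have hd : DifferentiableOn ℂ (fun t : ℂ => t + 1) (Metric.ball ((α - 1 : ℝ) : ℂ) 1) := by
      fun_prop
    exact ((h.1 k).comp hd hm).sub (hd.mul ((hq₁d k).comp hd hm))
  obtain ⟨C, hC⟩ := h.2 K
  obtain ⟨D, hD⟩ : ∃ D, ∀ T ∈ Metric.closedBall (α : ℂ) (1 / 2), ‖T * q₁ K T‖ ≤ D :=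
    (isCompact_closedBall _ _).exists_bound_of_continuousOn
      (continuousOn_id.mul ((hq₁d K).continuousOn.mono (closedBall_half_subset_ball α)))
  refine ⟨2 * C + D, ?_⟩
  filter_upwards [hC, eventually_gt_atTop (⌈‖(α : ℂ)‖ + 1 / 2⌉₊)] with n hn hn1 t ht
  have hn' : ‖(α : ℂ)‖ + 1 / 2 < n := (Nat.le_ceil _).trans_lt (by exact_mod_cast hn1)
  have hnpos : (0 : ℝ) < n := by linarith [norm_nonneg (α : ℂ)]
  have hn0 : (n : ℂ) ≠ 0 := by exact_mod_cast hnpos.ne'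
  set T := t + 1 with hT
  have hTm : T ∈ Metric.closedBall (α : ℂ) (1 / 2) := by
    rw [Metric.mem_closedBall, ← hball 1]; exact ht
  have hTn : ‖T‖ < n := by
    have : ‖T - α‖ ≤ 1 / 2 := by simpa [dist_eq_norm] using hTm
    calc ‖T‖ = ‖(α : ℂ) + (T - α)‖ := by congr 1; ring
      _ ≤ ‖(α : ℂ)‖ + ‖T - α‖ := norm_add_le _ _
      _ < n := by linarith
  have hne : (n : ℂ) - T ≠ 0 := by
    intro h0
    have : T = n := by linear_combination -h0
    rw [this] at hTn
    simp at hTn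
  have e1 : gammaRatio n t = (1 - T * (n : ℂ)⁻¹) * gammaRatio n T := by
    have e3 : (n : ℂ) ^ (T + 1) = (n : ℂ) ^ (t + 1) * n := by
      rw [Complex.cpow_add _ _ hn0, Complex.cpow_one, hT]
    rw [gammaRatio, gammaRatio, e3, show (n : ℂ) - t = (n - T) + 1 by rw [hT]; ring,
      Complex.Gamma_add_one _ hne]
    field_simp
  rw [e1, hsum]
  have e2 : (1 - T * (n : ℂ)⁻¹) * gammaRatio n T -
      ((1 - T * (n : ℂ)⁻¹) * ∑ k ∈ Finset.range K, q k T * (n : ℂ)⁻¹ ^ k +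
        T * q₁ K T * (n : ℂ)⁻¹ ^ K) =
      (1 - T * (n : ℂ)⁻¹) * (gammaRatio n T - ∑ k ∈ Finset.range K, q k T * (n : ℂ)⁻¹ ^ k) -
        T * q₁ K T * (n : ℂ)⁻¹ ^ K := by ring
  rw [e2]
  have h2 : ‖1 - T * (n : ℂ)⁻¹‖ ≤ 2 := by
    refine (norm_sub_le _ _).trans ?_
    rw [norm_mul, norm_inv, Complex.norm_natCast, norm_one]
    have : ‖T‖ * (n : ℝ)⁻¹ ≤ 1 := by
      rw [← div_eq_mul_inv, div_le_one hnpos]; exact hTn.le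
    linarith
  refine (norm_sub_le _ _).trans ?_
  rw [norm_mul, norm_mul _ ((n : ℂ)⁻¹ ^ K), norm_pow, norm_inv, Complex.norm_natCast, add_mul (2 * C) D]
  refine add_le_add ?_ (mul_le_mul_of_nonneg_right (hD T hTm) (by positivity))
  rw [mul_assoc]
  exact mul_le_mul h2 (hn T hTm) (norm_nonneg _) (by norm_num)

theorem exists_uniformGammaExpansion (α : ℝ) : ∃ q, HasUniformGammaExpansion α q := by
  have key : ∀ (j : ℕ) (α : ℝ), 0 ≤ α + j → ∃ q, HasUniformGammaExpansion α q := by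
    intro j
    induction j with
    | zero => exact fun α h => exists_uniformGammaExpansion_of_nonneg (by simpa using h)
    | succ j ih =>
      intro α h
      obtain ⟨q, hq⟩ := ih (α + 1) (by push_cast at h; linarith)
      have := hq.sub_one
      rwa [add_sub_cancel_right] at this
  obtain ⟨j, hj⟩ := exists_nat_ge (-α)
  exact key j α (by linarith)

/-! ### Asymptotics of the derivatives of `binomCoeff` -/

theorem iteratedDeriv_natCast_cpow_neg (j : ℕ) {n : ℕ} (hn : n ≠ 0) :
    iteratedDeriv j (fun t : ℂ => (n : ℂ) ^ (-t - 1)) =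
      fun t => (-(Real.log n : ℂ)) ^ j * (n : ℂ) ^ (-t - 1) := by
  induction j with
  | zero => simp
  | succ j ih =>
    rw [iteratedDeriv_succ, ih]
    funext t
    have hn' : (n : ℂ) ≠ 0 := by exact_mod_cast hn
    have h1 : HasDerivAt (fun t : ℂ => -t - 1) (-1) t := (hasDerivAt_neg t).sub_const 1
    have h := (h1.const_cpow (c := (n : ℂ)) (Or.inl hn')).const_mul ((-(Real.log n : ℂ)) ^ j)
    rw [h.deriv, ← Complex.ofReal_natCast n, ← Complex.ofReal_log (Nat.cast_nonneg n)]
    ring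

/-- Cauchy's estimate on the circle of radius 1/2: the reason why the Gamma expansion was proved
uniformly on a complex disk. -/
theorem isBigO_iteratedDeriv_of_uniform {α : ℂ} {ρ : ℕ → ℂ → ℂ} {C : ℝ} {b : ℕ → ℝ}
    (hd : ∀ᶠ n in atTop, DifferentiableOn ℂ (ρ n) (Metric.ball α 1))
    (hb : ∀ᶠ n in atTop, ∀ t ∈ Metric.closedBall α (1 / 2), ‖ρ n t‖ ≤ C * b n) (j : ℕ) :
    (fun n => iteratedDeriv j (ρ n) α) =O[atTop] b := by
  refine Asymptotics.IsBigO.of_bound (|j.factorial * C / (1 / 2) ^ j|) ?_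
  filter_upwards [hd, hb] with n hd hb
  have h := Complex.norm_iteratedDeriv_le_of_forall_mem_sphere_norm_le (f := ρ n) (c := α)
    (C := C * b n) j (by norm_num : (0 : ℝ) < 1 / 2)
    ((hd.mono (Metric.closedBall_subset_ball (by norm_num))).diffContOnCl_ball
      (le_refl _)) (fun z hz => hb z (Metric.sphere_subset_closedBall hz))
  refine h.trans ?_
  rw [Real.norm_eq_abs, ← abs_mul]
  refine le_trans (le_of_eq ?_) (le_abs_self _)
  ring

/-- Write `binomCoeff n t` as n^(-t-1) times a factor whose expansion in 1/n can be differentiated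
in t, and apply Leibniz. As 1/Γ(-t) is entire, exponents α ∈ ℕ need no separate treatment. -/
theorem exists_expansion_iteratedDeriv_binomCoeff (β : ℕ) (α : ℚ) :
    ∃ e : ℕ → ℕ → ℂ, ∀ K : ℕ,
      (fun n : ℕ => iteratedDeriv β (binomCoeff n) (α : ℂ) -
        ∑ k ∈ Finset.range K, ∑ j ∈ Finset.range (β + 1),
          (nilssonMonomial (α + 1 + k, j) n : ℂ) * e k j) =O[atTop]
      fun n : ℕ => nilssonMonomial (α + 1 + K, β) n := by
  obtain ⟨q, hqd, hq⟩ := exists_uniformGammaExpansion (α : ℝ)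
  have hcast : (((α : ℚ) : ℝ) : ℂ) = (α : ℂ) := by norm_cast
  rw [hcast] at hqd hq
  set c : ℕ → ℂ → ℂ := fun k t => q k t * (Complex.Gamma (-t))⁻¹ with hc
  have hGd : Differentiable ℂ fun t : ℂ => (Complex.Gamma (-t))⁻¹ := 
    Complex.differentiable_one_div_Gamma.comp differentiable_neg
  have hcd : ∀ k, DifferentiableOn ℂ (c k) (Metric.ball (α : ℂ) 1) := fun k =>
    (hqd k).mul hGd.differentiableOn
  set Y : ℕ → ℂ → ℂ := fun n t => (n : ℂ) ^ (t + 1) * binomCoeff n t with hY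
  have hYd : ∀ n : ℕ, n ≠ 0 → Differentiable ℂ (Y n) := fun n hn => by
    have : (n : ℂ) ≠ 0 := by exact_mod_cast hn
    exact (Differentiable.const_cpow (by fun_prop) (Or.inl this)).mul (differentiable_binomCoeff n)
  have hcda : ∀ (k : ℕ) (i : ℕ), ContDiffAt ℂ i (c k) (α : ℂ) := fun k i =>
    ((hcd k).analyticAt (Metric.ball_mem_nhds _ one_pos)).contDiffAt
  have hpoly : ∀ (K : ℕ) (n : ℕ) (i : ℕ),
      iteratedDeriv i (fun t => ∑ k ∈ Finset.range K, c k t * ((n : ℂ)⁻¹) ^ k) (α : ℂ) =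
        ∑ k ∈ Finset.range K, iteratedDeriv i (c k) (α : ℂ) * ((n : ℂ)⁻¹) ^ k := by
    intro K n i
    rw [iteratedDeriv_fun_sum fun k _ => (hcda k i).mul contDiffAt_const]
    refine Finset.sum_congr rfl fun k _ => ?_
    have := iteratedDeriv_const_mul (n := i) ((n : ℂ)⁻¹ ^ k) (hcda k i)
    rw [mul_comm, ← this]
    congr 1
    funext t
    ring
  have hYexp : ∀ (K i : ℕ), (fun n : ℕ => iteratedDeriv i (Y n) (α : ℂ) -
      ∑ k ∈ Finset.range K, iteratedDeriv i (c k) (α : ℂ) * ((n : ℂ)⁻¹) ^ k) =O[atTop]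
      fun n : ℕ => ((n : ℝ)⁻¹) ^ K := by
    intro K i
    obtain ⟨C, hC⟩ := hq K
    obtain ⟨D, hD⟩ : ∃ D, ∀ t ∈ Metric.closedBall (α : ℂ) (1 / 2),
        ‖(Complex.Gamma (-t))⁻¹‖ ≤ D :=
      (isCompact_closedBall _ _).exists_bound_of_continuousOn hGd.continuous.continuousOn
    have h := isBigO_iteratedDeriv_of_uniform (α := (α : ℂ)) (C := C * D)
      (ρ := fun n t => Y n t - ∑ k ∈ Finset.range K, c k t * ((n : ℂ)⁻¹) ^ k)
      (b := fun n : ℕ => ((n : ℝ)⁻¹) ^ K) ?_ ?_ i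
    · refine h.congr' ?_ EventuallyEq.rfl
      filter_upwards [eventually_ne_atTop 0] with n hn
      rw [iteratedDeriv_fun_sub (hYd n hn).contDiff.contDiffAt, hpoly]
      exact ContDiffAt.sum fun k _ => (hcda k i).mul contDiffAt_const
    · filter_upwards [eventually_ne_atTop 0] with n hn
      refine (hYd n hn).differentiableOn.sub ?_
      exact DifferentiableOn.fun_sum fun k _ => (hcd k).mul_const _
    · filter_upwards [hC, eventually_gt_atTop (⌈‖(α : ℂ)‖ + 1 / 2⌉₊)] with n hn hn1 t ht
      have hn' : ‖(α : ℂ)‖ + 1 / 2 < n := (Nat.le_ceil _).trans_lt (by exact_mod_cast hn1)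
      have htn : t.re < n := by
        have : ‖t - α‖ ≤ 1 / 2 := by simpa [dist_eq_norm] using ht
        calc t.re ≤ ‖t‖ := Complex.re_le_norm t
          _ = ‖(α : ℂ) + (t - α)‖ := by congr 1; ring
          _ ≤ ‖(α : ℂ)‖ + ‖t - α‖ := norm_add_le _ _
          _ < n := by linarith
      have e : Y n t - ∑ k ∈ Finset.range K, c k t * ((n : ℂ)⁻¹) ^ k =
          (gammaRatio n t - ∑ k ∈ Finset.range K, q k t * ((n : ℂ)⁻¹) ^ k) *
            (Complex.Gamma (-t))⁻¹ := by
        rw [sub_mul, Finset.sum_mul]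
        congr 1
        · simp only [hY, gammaRatio]
          rw [binomCoeff_eq_Gamma htn]
          ring
        · exact Finset.sum_congr rfl fun k _ => by simp only [hc]; ring
      rw [e, norm_mul]
      have h1 := hn t ht
      have h2 := hD t ht
      calc _ ≤ (C * ((n : ℝ)⁻¹) ^ K) * D := by
            exact mul_le_mul h1 h2 (norm_nonneg _) ((norm_nonneg _).trans h1)
        _ = _ := by ring
  -- Leibniz: j derivatives fall on n^(-t-1) and give (-log n)^j, the other β - j fall on the
  -- coefficient `c k`.
  refine ⟨fun k j => β.choose j * (-1) ^ j * iteratedDeriv (β - j) (c k) (α : ℂ), fun K => ?_⟩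
  have hmon : ∀ (k j n : ℕ), n ≠ 0 → (nilssonMonomial (α + 1 + k, j) n : ℂ) =
      (Real.log n : ℂ) ^ j * ((n : ℂ) ^ (-(α : ℂ) - 1) * ((n : ℂ)⁻¹) ^ k) := by
    intro k j n hn
    have hn' : (n : ℂ) ≠ 0 := by exact_mod_cast hn
    rw [nilssonMonomial, Complex.ofReal_div, Complex.ofReal_pow,
      Complex.ofReal_cpow (Nat.cast_nonneg n), div_eq_mul_inv, ← Complex.cpow_neg]
    congr 1
    push_cast
    rw [show -((α : ℂ) + 1 + k) = (-(α : ℂ) - 1) + -(k : ℂ) by ring, Complex.cpow_add _ _ hn',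
      Complex.cpow_neg, Complex.cpow_natCast, inv_pow]
  have hmain : ∀ j ∈ Finset.range (β + 1), (fun n : ℕ =>
      ((-(Real.log n : ℂ)) ^ j * (n : ℂ) ^ (-(α : ℂ) - 1)) * 
      (iteratedDeriv (β - j) (Y n) (α : ℂ) -
      ∑ k ∈ Finset.range K, iteratedDeriv (β - j) (c k) (α : ℂ) * ((n : ℂ)⁻¹) ^ k)) =O[atTop]
      fun n : ℕ => nilssonMonomial (α + 1 + K, β) n := by
    intro j hj
    have hj : j ≤ β := Nat.lt_succ_iff.1 (Finset.mem_range.1 hj)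
    have h1 : (fun n : ℕ => (-(Real.log n : ℂ)) ^ j * (n : ℂ) ^ (-(α : ℂ) - 1)) =O[atTop]
        fun n : ℕ => Real.log n ^ β * (n : ℝ) ^ (-(α : ℝ) - 1) := by
      refine Asymptotics.IsBigO.of_bound 1 ?_
      filter_upwards [eventually_ge_atTop 3] with n hn
      have hn0 : 0 < n := by omega
      have hlog : 1 ≤ Real.log n := by
        rw [Real.le_log_iff_exp_le (by exact_mod_cast hn0)]
        have : (3 : ℝ) ≤ n := by exact_mod_cast hn
        linarith [Real.exp_one_lt_d9]
      rw [one_mul, norm_mul, norm_mul, norm_pow, norm_pow, norm_neg, Complex.norm_real,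
        Complex.norm_natCast_cpow_of_pos hn0, Real.norm_of_nonneg (zero_le_one.trans hlog),
        Real.norm_of_nonneg (Real.rpow_nonneg (Nat.cast_nonneg n) _)]
      have : (-(α : ℂ) - 1).re = -(α : ℝ) - 1 := by simp
      rw [this]
      gcongr
    refine (h1.mul (hYexp K (β - j))).congr' EventuallyEq.rfl ?_
    filter_upwards [eventually_ne_atTop 0] with n hn
    have := hmon K β n hn
    have hn' : (0 : ℝ) < n := by positivity
    rw [nilssonMonomial, div_eq_mul_inv, ← Real.rpow_neg hn'.le, mul_assoc]
    congr 1
    push_cast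
    rw [show -((α : ℝ) + 1 + K) = (-(α : ℝ) - 1) + -(K : ℝ) by ring, Real.rpow_add hn',
      Real.rpow_neg hn'.le (K : ℝ), Real.rpow_natCast, inv_pow]
  have hfin := Asymptotics.IsBigO.fun_sum (l := atTop) fun j hj => (hmain j hj).const_mul_left (β.choose j : ℂ)
  refine Asymptotics.IsBigO.congr' hfin ?_ EventuallyEq.rfl
  filter_upwards [eventually_ne_atTop 0] with n hn
  have hn' : (n : ℂ) ≠ 0 := by exact_mod_cast hn
  have hprod : binomCoeff n = fun t => (n : ℂ) ^ (-t - 1) * Y n t := by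
    funext t
    simp only [hY]
    rw [← mul_assoc, ← Complex.cpow_add _ _ hn']
    simp
  have hcd1 : Differentiable ℂ fun t : ℂ => (n : ℂ) ^ (-t - 1) :=
    Differentiable.const_cpow (by fun_prop) (Or.inl hn')
  have hL : iteratedDeriv β (binomCoeff n) (α : ℂ) = ∑ j ∈ Finset.range (β + 1),
      (β.choose j : ℂ) * ((-(Real.log n : ℂ)) ^ j * (n : ℂ) ^ (-(α : ℂ) - 1)) *
        iteratedDeriv (β - j) (Y n) (α : ℂ) := by
    conv_lhs => rw [hprod]
    rw [iteratedDeriv_fun_mul hcd1.contDiff.contDiffAt (hYd n hn).contDiff.contDiffAt]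
    refine Finset.sum_congr rfl fun j _ => ?_
    rw [iteratedDeriv_natCast_cpow_neg j hn]
  rw [hL, Finset.sum_comm (s := Finset.range K), ← Finset.sum_sub_distrib]
  refine Finset.sum_congr rfl fun j _ => ?_
  rw [mul_sub, mul_sub, Finset.mul_sum, Finset.mul_sum]
  congr 1
  · ring
  · refine Finset.sum_congr rfl fun k _ => ?_
    rw [hmon k j n hn, neg_pow]
    ring

/-! ### Expansions in the Nilsson scale -/

theorem mem_nilssonSegment {S : Finset ℚ} {d : ℕ} {ω ω' : ℚ × ℕ} :
    ω' ∈ nilssonSegment S d ω ↔ ω' ∈ nilssonIndex S d ∧ nilssonLE ω' ω := by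
  simp [nilssonSegment]

theorem mem_nilssonSegment_nat {S : Finset ℚ} {d J : ℕ} {ω : ℚ × ℕ} :
    ω ∈ nilssonSegment S d ((J : ℚ), 0) ↔ ω ∈ nilssonIndex S d ∧ ω.1 ≤ J := by
  have h : nilssonLE ω ((J : ℚ), 0) ↔ ω.1 ≤ J := by
    simp only [nilssonLE, Nat.zero_le, and_true]
    exact le_iff_lt_or_eq.symm
  rw [mem_nilssonSegment, h]

/-- The order is total, so the hypothesis says that ω' is strictly later: either a positive power of
n beats all logarithms, or the exponents agree and ω' has fewer logarithms. -/
theorem isLittleO_nilssonMonomial {ω ω' : ℚ × ℕ} (h : ¬ nilssonLE ω' ω) :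
    nilssonMonomial ω' =o[atTop] nilssonMonomial ω := by
  have hnat : Tendsto (fun n : ℕ => (n : ℝ)) atTop atTop := tendsto_natCast_atTop_atTop
  have hlog : Tendsto (fun n : ℕ => Real.log n) atTop atTop := Real.tendsto_log_atTop.comp hnat
  simp only [nilssonLE, not_or, not_lt, not_and, not_le] at h
  rcases lt_or_eq_of_le h.1 with hlt | heq
  · have hlt' : 0 < (ω'.1 : ℝ) - ω.1 := by
      have : (ω.1 : ℝ) < ω'.1 := by exact_mod_cast hlt
      linarith
    have h1 : (fun n : ℕ => Real.log n ^ ω'.2) =o[atTop]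
        fun n : ℕ => (n : ℝ) ^ ((ω'.1 : ℝ) - ω.1) := by
      have := (isLittleO_log_rpow_rpow_atTop (ω'.2 : ℝ) hlt').comp_tendsto hnat
      simpa [Function.comp_def] using this
    have h2 := h1.mul_isBigO
      (Asymptotics.isBigO_refl (fun n : ℕ => ((n : ℝ) ^ (ω'.1 : ℝ))⁻¹) atTop)
    have h3 : (fun n : ℕ => (n : ℝ) ^ ((ω'.1 : ℝ) - ω.1) * ((n : ℝ) ^ (ω'.1 : ℝ))⁻¹) =O[atTop]
        nilssonMonomial ω := by
      refine Asymptotics.IsBigO.of_bound 1 ?_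
      filter_upwards [eventually_gt_atTop 0, hlog.eventually_ge_atTop 1] with n hn hl
      have hn' : (0 : ℝ) < n := by exact_mod_cast hn
      have e : (n : ℝ) ^ ((ω'.1 : ℝ) - ω.1) * ((n : ℝ) ^ (ω'.1 : ℝ))⁻¹ =
          1 / (n : ℝ) ^ (ω.1 : ℝ) := by
        rw [Real.rpow_sub hn']
        have : (n : ℝ) ^ (ω'.1 : ℝ) ≠ 0 := (Real.rpow_pos_of_pos hn' _).ne'
        field_simp
      rw [e, one_mul, nilssonMonomial, norm_div, norm_div, norm_one, norm_pow]
      gcongr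
      rw [Real.norm_of_nonneg (zero_le_one.trans hl)]
      exact one_le_pow₀ hl
    refine (h2.congr_left fun n => ?_).trans_isBigO h3
    rw [nilssonMonomial, div_eq_mul_inv]
  · have h1 := (Asymptotics.isLittleO_pow_pow_atTop_of_lt (𝕜 := ℝ) (h.2 heq.symm)).comp_tendsto hlog
    have h2 := h1.mul_isBigO
      (Asymptotics.isBigO_refl (fun n : ℕ => ((n : ℝ) ^ (ω.1 : ℝ))⁻¹) atTop)
    refine h2.congr (fun n => ?_) fun n => ?_
    · rw [nilssonMonomial, div_eq_mul_inv, ← heq]; rfl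
    · rw [nilssonMonomial, div_eq_mul_inv]; rfl

theorem isLittleO_nilssonMonomial_of_lt {ω ω' : ℚ × ℕ} (h : ω.1 < ω'.1) :
    nilssonMonomial ω' =o[atTop] nilssonMonomial ω :=
  isLittleO_nilssonMonomial fun h' => by
    rcases h' with h' | ⟨h', -⟩
    · exact lt_asymm h h'
    · exact h.ne h'.symm

theorem nilssonMonomial_nat_zero (J : ℕ) :
    nilssonMonomial ((J : ℚ), 0) = fun n : ℕ => ((n : ℝ) ^ J)⁻¹ := by
  funext n
  simp [nilssonMonomial]

/-- The coefficients of the expansion of the `n`-th coefficient of `(1 - z) ^ α log (1 - z) ^ β`,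
indexed by the pairs in `ℚ × ℕ`, where `e k j` belongs to `(α + 1 + k, j)`. -/
noncomputable def shiftedCoeff (α : ℚ) (β : ℕ) (e : ℕ → ℕ → ℂ) (ω : ℚ × ℕ) : ℂ :=
  if ((⌊ω.1 - α - 1⌋₊ : ℚ) = ω.1 - α - 1 ∧ ω.2 ≤ β) then e ⌊ω.1 - α - 1⌋₊ ω.2 else 0

theorem shiftedCoeff_apply (α : ℚ) {β : ℕ} (e : ℕ → ℕ → ℂ) (k : ℕ) {j : ℕ} (hj : j ≤ β) :
    shiftedCoeff α β e (α + 1 + k, j) = e k j := by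
  have h : α + 1 + (k : ℚ) - α - 1 = k := by ring
  simp [shiftedCoeff, h, hj]

theorem exists_of_shiftedCoeff_ne_zero {α : ℚ} {β : ℕ} {e : ℕ → ℕ → ℂ} {ω : ℚ × ℕ}
    (h : shiftedCoeff α β e ω ≠ 0) : ∃ k : ℕ, ω.1 = α + 1 + k ∧ ω.2 ≤ β := by
  rw [shiftedCoeff] at h
  split_ifs at h with h1
  · exact ⟨_, by rw [h1.1]; ring, h1.2⟩
  · exact absurd rfl h

/-- Truncation by the number K of terms is traded for truncation at order n^(-J). With α + 1 + K >
J, terms in only one of the two index sets are O(n^(-J)) or have coefficient zero. -/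
theorem isBigO_sub_sum_shiftedCoeff {S : Finset ℚ} {d : ℕ} {α : ℚ} {β : ℕ} {e : ℕ → ℕ → ℂ}
    {u : ℕ → ℂ}
    (he : ∀ K : ℕ, (fun n : ℕ => u n - ∑ k ∈ Finset.range K, ∑ j ∈ Finset.range (β + 1),
          (nilssonMonomial (α + 1 + k, j) n : ℂ) * e k j) =O[atTop]
      fun n : ℕ => nilssonMonomial (α + 1 + K, β) n)
    (hS : ∀ k j : ℕ, j ≤ β → (α + 1 + (k : ℚ), j) ∈ nilssonIndex S d) (J : ℕ) :
    (fun n : ℕ => u n - ∑ ω ∈ nilssonSegment S d ((J : ℚ), 0),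
      (nilssonMonomial ω n : ℂ) * shiftedCoeff α β e ω) =O[atTop] fun n : ℕ => ((n : ℝ) ^ J)⁻¹ := by
  obtain ⟨K, hK⟩ := exists_nat_gt ((J : ℚ) - α - 1)
  have hK' : (J : ℚ) < α + 1 + K := by linarith
  set P : Finset (ℚ × ℕ) := (Finset.range K ×ˢ Finset.range (β + 1)).image
    fun i : ℕ × ℕ => (α + 1 + (i.1 : ℚ), i.2) with hP
  have hinj : Set.InjOn (fun i : ℕ × ℕ => (α + 1 + (i.1 : ℚ), i.2))
      (Finset.range K ×ˢ Finset.range (β + 1) : Finset (ℕ × ℕ)) := by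
    rintro ⟨a, b⟩ _ ⟨c, d⟩ _ h
    simp only [Prod.mk.injEq, add_right_inj, Nat.cast_inj] at h
    exact Prod.ext h.1 h.2
  have hsum : ∀ n : ℕ, ∑ k ∈ Finset.range K, ∑ j ∈ Finset.range (β + 1),
      (nilssonMonomial (α + 1 + k, j) n : ℂ) * e k j =
      ∑ ω ∈ P, (nilssonMonomial ω n : ℂ) * shiftedCoeff α β e ω := by
    intro n
    rw [hP, Finset.sum_image hinj, Finset.sum_product]
    refine Finset.sum_congr rfl fun k _ => Finset.sum_congr rfl fun j hj => ?_
    rw [shiftedCoeff_apply α e k (Nat.lt_succ_iff.1 (Finset.mem_range.1 hj))]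
  have h1 : (fun n : ℕ => u n - ∑ ω ∈ P, (nilssonMonomial ω n : ℂ) * shiftedCoeff α β e ω)
      =O[atTop] fun n : ℕ => ((n : ℝ) ^ J)⁻¹ := by
    have := he K
    simp only [hsum] at this
    refine this.trans ?_
    rw [← nilssonMonomial_nat_zero]
    exact (isLittleO_nilssonMonomial_of_lt hK').isBigO
  have h2 : (fun n : ℕ => ∑ ω ∈ P \ nilssonSegment S d ((J : ℚ), 0),
      (nilssonMonomial ω n : ℂ) * shiftedCoeff α β e ω) =O[atTop]
        fun n : ℕ => ((n : ℝ) ^ J)⁻¹ := by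
    refine Asymptotics.IsBigO.fun_sum fun ω hω => ?_
    rw [Finset.mem_sdiff, hP, Finset.mem_image] at hω
    obtain ⟨⟨⟨k, j⟩, hkj, rfl⟩, hn⟩ := hω
    have hj : j ≤ β := by
      have := (Finset.mem_product.1 hkj).2
      simpa [Nat.lt_succ_iff] using this
    have hlt : (J : ℚ) < α + 1 + k := by
      by_contra hle
      exact hn (mem_nilssonSegment_nat.2 ⟨hS k j hj, not_lt.1 hle⟩)
    rw [← nilssonMonomial_nat_zero]
    have := (isLittleO_nilssonMonomial_of_lt (ω := ((J : ℚ), 0)) (ω' := (α + 1 + (k : ℚ), j)) 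
      hlt).isBigO
    have h3 := (Complex.isBigO_ofReal_left).2 this
    simpa [mul_comm] using h3.const_mul_left (shiftedCoeff α β e (α + 1 + (k : ℚ), j))
  have h3 : ∀ n : ℕ, ∑ ω ∈ nilssonSegment S d ((J : ℚ), 0) \ P,
      (nilssonMonomial ω n : ℂ) * shiftedCoeff α β e ω = 0 := by
    intro n
    refine Finset.sum_eq_zero fun ω hω => ?_
    rw [Finset.mem_sdiff, mem_nilssonSegment_nat] at hω
    by_contra hne
    obtain ⟨k, hk, hj⟩ := exists_of_shiftedCoeff_ne_zero (right_ne_zero_of_mul hne)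
    refine hω.2 (Finset.mem_image.2 ⟨(k, ω.2), ?_, Prod.ext hk.symm rfl⟩)
    have hlt : (k : ℚ) < K := by
      have := hω.1.2
      rw [hk] at this
      linarith
    simp only [Finset.mem_product, Finset.mem_range]
    exact ⟨by exact_mod_cast hlt, by omega⟩
  refine (h1.add h2).congr_left fun n => ?_
  have := Finset.sum_sdiff_sub_sum_sdiff (s₁ := P) (s₂ := nilssonSegment S d ((J : ℚ), 0))
    (f := fun ω => (nilssonMonomial ω n : ℂ) * shiftedCoeff α β e ω)
  rw [h3] at this
  linear_combination -this

/-- Sequences that come from a convergent local expansion with exponents `(k - N) / m` have full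
asymptotic expansions, with coefficients that are locally finite sums. -/
theorem exists_expansion_local_series {m : ℕ} (hm : 0 < m) (N ν : ℕ) (γ : ℕ → ℕ → ℂ) :
    ∃ (S : Finset ℚ) (d : ℕ) (c : ℚ × ℕ → ℂ), (∀ ω, c ω ≠ 0 → ω ∈ nilssonIndex S d) ∧
      ∀ J : ℕ, ∃ K₀ : ℕ, ∀ K ≥ K₀,
        (fun n : ℕ => ∑ k ∈ Finset.range K, ∑ β ∈ Finset.range ν, γ k β *
            iteratedDeriv β (binomCoeff n) (((k - N) / m : ℚ) : ℂ) -
          ∑ ω ∈ nilssonSegment S d ((J : ℚ), 0), (nilssonMonomial ω n : ℂ) * c ω) =O[atTop]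
        fun n : ℕ => ((n : ℝ) ^ J)⁻¹ := by
  have hm0 : (0 : ℚ) < m := by exact_mod_cast hm
  choose e he using fun (k β : ℕ) =>
    exists_expansion_iteratedDeriv_binomCoeff β (((k : ℚ) - N) / m)
  set E : ℕ → ℕ → ℚ × ℕ → ℂ := fun k β => shiftedCoeff (((k : ℚ) - N) / m) β (e k β) with hE
  -- For k ≥ am + N the term of index k has leading exponent (k - N)/m + 1 > a, so it contributes
  -- nothing at a; the coefficient sums are finite.
  set κ : ℚ → ℕ := fun a => ⌈a * m + N⌉₊ with hκ
  -- Modulo integers, the exponents (k - N)/m are represented by k < m.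
  set S : Finset ℚ := (Finset.range m).image fun i : ℕ => ((i : ℚ) - N) / m with hS
  have hmem : ∀ k i β j : ℕ, β < ν → j ≤ β →
      (((k : ℚ) - N) / m + 1 + (i : ℚ), j) ∈ nilssonIndex S ν := by
    intro k i β j hβ hj
    refine ⟨⟨(((k % m : ℕ) : ℚ) - N) / m, ?_, k / m + 1 + i, ?_⟩, by simp only; omega⟩
    · exact Finset.mem_image.2 ⟨k % m, Finset.mem_range.2 (Nat.mod_lt _ hm), rfl⟩
    · have : (k : ℚ) = (k % m : ℕ) + m * (k / m : ℕ) := by exact_mod_cast (Nat.mod_add_div k m).symm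
      rw [this]
      push_cast
      field_simp
      ring
  have hzero : ∀ (k β : ℕ) (ω : ℚ × ℕ), κ ω.1 ≤ k → E k β ω = 0 := by
    intro k β ω hk
    by_contra hne
    obtain ⟨i, hi, -⟩ := exists_of_shiftedCoeff_ne_zero hne
    have h1 : ω.1 * m + N ≤ k := (Nat.le_ceil _).trans (by exact_mod_cast hk)
    have h2 : ω.1 ≤ ((k : ℚ) - N) / m := by rw [le_div_iff₀ hm0]; linarith
    have h3 : (0 : ℚ) ≤ i := Nat.cast_nonneg i
    linarith
  refine ⟨S, ν, fun ω => ∑ k ∈ Finset.range (κ ω.1), ∑ β ∈ Finset.range ν, γ k β * E k β ω,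
    fun ω hω => ?_, fun J => ⟨κ J, fun K hK => ?_⟩⟩
  · obtain ⟨k, -, hk⟩ := Finset.exists_ne_zero_of_sum_ne_zero hω
    obtain ⟨β, hβ, hk⟩ := Finset.exists_ne_zero_of_sum_ne_zero hk
    obtain ⟨i, hi, hj⟩ := exists_of_shiftedCoeff_ne_zero (right_ne_zero_of_mul hk)
    have := hmem k i β ω.2 (Finset.mem_range.1 hβ) hj
    rwa [← hi] at this
  · have hterm : ∀ k ∈ Finset.range K, ∀ β ∈ Finset.range ν, (fun n : ℕ => γ k β *
        (iteratedDeriv β (binomCoeff n) (((k - N) / m : ℚ) : ℂ) -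
          ∑ ω ∈ nilssonSegment S ν ((J : ℚ), 0), (nilssonMonomial ω n : ℂ) * E k β ω)) =O[atTop]
        fun n : ℕ => ((n : ℝ) ^ J)⁻¹ := fun k _ β hβ =>
      (isBigO_sub_sum_shiftedCoeff (he k β)
        (fun i j hj => hmem k i β j (Finset.mem_range.1 hβ) hj) J).const_mul_left _
    have htot := Asymptotics.IsBigO.fun_sum fun k hk =>
      Asymptotics.IsBigO.fun_sum fun β hβ => hterm k hk β hβ
    refine htot.congr_left fun n => ?_
    have hc : ∀ ω ∈ nilssonSegment S ν ((J : ℚ), 0),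
        (nilssonMonomial ω n : ℂ) *
          ∑ k ∈ Finset.range (κ ω.1), ∑ β ∈ Finset.range ν, γ k β * E k β ω =
        ∑ k ∈ Finset.range K, ∑ β ∈ Finset.range ν,
          γ k β * ((nilssonMonomial ω n : ℂ) * E k β ω) := by
      intro ω hω
      have hle : κ ω.1 ≤ K := by
        refine le_trans (Nat.ceil_le_ceil ?_) hK
        have := (mem_nilssonSegment_nat.1 hω).2
        gcongr
      rw [Finset.sum_subset (Finset.range_subset_range.2 hle), Finset.mul_sum]
      · refine Finset.sum_congr rfl fun k _ => ?_
        rw [Finset.mul_sum]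
        exact Finset.sum_congr rfl fun β _ => by ring
      · intro k _ hk
        refine Finset.sum_eq_zero fun β _ => ?_
        rw [hzero k β ω (by simpa using hk), mul_zero]
    rw [Finset.sum_congr rfl hc, Finset.sum_comm (t := Finset.range K), ← Finset.sum_sub_distrib]
    refine Finset.sum_congr rfl fun k _ => ?_
    rw [Finset.sum_comm (t := Finset.range ν), ← Finset.sum_sub_distrib]
    refine Finset.sum_congr rfl fun β _ => ?_
    rw [mul_sub, Finset.mul_sum]

/-- Allows the expansions at the different singularities to share one index set. -/
theorem sum_nilssonSegment_enlarge {S S' : Finset ℚ} {d d' : ℕ} (hS : S ⊆ S') (hd : d ≤ d')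
    {c : ℚ × ℕ → ℂ} (hc : ∀ ω, c ω ≠ 0 → ω ∈ nilssonIndex S d) (ω : ℚ × ℕ) (n : ℕ) :
    ∑ ω' ∈ nilssonSegment S' d' ω, (nilssonMonomial ω' n : ℂ) * c ω' =
      ∑ ω' ∈ nilssonSegment S d ω, (nilssonMonomial ω' n : ℂ) * c ω' := by
  symm
  refine Finset.sum_subset (fun ω' h => ?_) fun ω' h h' => ?_
  · rw [mem_nilssonSegment] at h ⊢
    obtain ⟨⟨⟨s, hs, k, hk⟩, h2⟩, h3⟩ := h
    exact ⟨⟨⟨s, hS hs, k, hk⟩, h2.trans hd⟩, h3⟩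
  · by_contra hne
    rw [mem_nilssonSegment] at h h'
    exact h' ⟨hc ω' (right_ne_zero_of_mul hne), h.2⟩

/-- Expansions up to errors `O(n ^ (-J))` for all `J` yield the expansions up to each `h_ω`. -/
theorem tendsto_of_isBigO_expansion {a : ℕ → ℂ} {S : Finset ℚ} {d : ℕ} {ρ : ℝ} (hρ : 0 < ρ)
    {L : Finset ℂ} (hL : ∀ l ∈ L, ‖l‖ = ρ) {c : ℚ × ℕ → ℂ → ℂ}
    (h : ∀ J : ℕ, (fun n : ℕ => a n / (ρ : ℂ) ^ n - ∑ ω ∈ nilssonSegment S d ((J : ℚ), 0),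
      (nilssonMonomial ω n : ℂ) * ∑ l ∈ L, c ω l * (l / (ρ : ℂ)) ^ n) =O[atTop]
        fun n : ℕ => ((n : ℝ) ^ J)⁻¹) (ω : ℚ × ℕ) :
    Tendsto (fun n : ℕ => (a n / (ρ : ℂ) ^ n - ∑ ω' ∈ nilssonSegment S d ω,
      (nilssonMonomial ω' n : ℂ) * ∑ l ∈ L, c ω' l * (l / (ρ : ℂ)) ^ n) /
        (nilssonMonomial ω n : ℂ)) atTop (𝓝 0) := by
  -- For J > ω.1 the cut-off at n^(-J) keeps the whole segment below ω; both the error and the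
  -- surplus terms are o(h_ω).
  obtain ⟨J, hJ⟩ := exists_nat_gt ω.1
  have hbd : ∀ ω', (fun n : ℕ => ∑ l ∈ L, c ω' l * (l / (ρ : ℂ)) ^ n) =O[atTop]
      fun _ => (1 : ℝ) := by
    intro ω'
    refine Asymptotics.IsBigO.fun_sum fun l hl => ?_
    refine Asymptotics.IsBigO.of_bound ‖c ω' l‖ (Eventually.of_forall fun n => ?_)
    have : ‖l / (ρ : ℂ)‖ = 1 := by
      rw [norm_div, hL l hl, Complex.norm_real, Real.norm_of_nonneg hρ.le, div_self hρ.ne']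
    rw [norm_mul, norm_pow, this]
    simp
  have h1 : (fun n : ℕ => a n / (ρ : ℂ) ^ n - ∑ ω ∈ nilssonSegment S d ((J : ℚ), 0),
      (nilssonMonomial ω n : ℂ) * ∑ l ∈ L, c ω l * (l / (ρ : ℂ)) ^ n) =o[atTop]
        nilssonMonomial ω := by
    refine (h J).trans_isLittleO ?_
    rw [← nilssonMonomial_nat_zero]
    exact isLittleO_nilssonMonomial_of_lt hJ
  have hsub : nilssonSegment S d ω ⊆ nilssonSegment S d ((J : ℚ), 0) := fun ω' h' => by
    rw [mem_nilssonSegment_nat]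
    rw [mem_nilssonSegment] at h'
    refine ⟨h'.1, ?_⟩
    rcases h'.2 with h2 | h2
    · exact (h2.trans hJ).le
    · rw [h2.1]; exact hJ.le
  have h2 : (fun n : ℕ => ∑ ω' ∈ nilssonSegment S d ((J : ℚ), 0) \ nilssonSegment S d ω,
      (nilssonMonomial ω' n : ℂ) * ∑ l ∈ L, c ω' l * (l / (ρ : ℂ)) ^ n) =o[atTop]
        nilssonMonomial ω := by
    refine Asymptotics.IsLittleO.fun_sum fun ω' hω' => ?_
    rw [Finset.mem_sdiff, mem_nilssonSegment_nat, mem_nilssonSegment] at hω'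
    have hnle : ¬ nilssonLE ω' ω := fun hle => hω'.2 ⟨hω'.1.1, hle⟩
    have h3 := (Complex.isLittleO_ofReal_left).2 (isLittleO_nilssonMonomial hnle)
    simpa using h3.mul_isBigO (hbd ω')
  have h3 := (Complex.isLittleO_ofReal_right).2 (h1.add h2)
  refine (h3.tendsto_div_nhds_zero).congr fun n => ?_
  rw [← Finset.sum_sdiff hsub]
  congr 1
  ring

/-! ### From quasi-unipotent monodromy to a difference equation -/

theorem Multiset.prod_map_dvd_pow_card {R ι : Type*} [CommMonoid R] (s : Multiset ι) (f : ι → R)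
    (q : R) (h : ∀ i ∈ s, f i ∣ q) : (s.map f).prod ∣ q ^ s.card := by
  induction s using Multiset.induction with
  | empty => simp
  | cons a s ih =>
    rw [Multiset.map_cons, Multiset.prod_cons, Multiset.card_cons, pow_succ']
    exact mul_dvd_mul (h a (Multiset.mem_cons_self a s))
      (ih fun i hi => h i (Multiset.mem_cons_of_mem hi))

/-- Let m be a common multiple of the orders of the eigenvalues. Each linear factor of the
characteristic polynomial divides X^m - 1, so the polynomial divides a power of X^m - 1, and
Cayley–Hamilton applies. -/
theorem exists_pow_sub_one_pow_eq_zero {V : Type*} [AddCommGroup V] [Module ℂ V]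
    [FiniteDimensional ℂ V] (T : Module.End ℂ V)
    (h : ∀ μ : ℂ, T.HasEigenvalue μ → ∃ m : ℕ, 0 < m ∧ μ ^ m = 1) :
    ∃ m ν : ℕ, 0 < m ∧ (T ^ m - 1) ^ ν = 0 := by
  have hroot : ∀ μ ∈ T.charpoly.roots, ∃ m : ℕ, 0 < m ∧ μ ^ m = 1 := fun μ hμ =>
    h μ ((Module.End.hasEigenvalue_iff_isRoot_charpoly T μ).2 (Polynomial.isRoot_of_mem_roots hμ))
  choose! k hk0 hk using hroot
  set m := ∏ μ ∈ T.charpoly.roots.toFinset, k μ with hm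
  refine ⟨m, T.charpoly.roots.card, ?_, ?_⟩
  · exact Finset.prod_pos fun μ hμ => hk0 μ (Multiset.mem_toFinset.1 hμ)
  have hdvd : T.charpoly ∣ (Polynomial.X ^ m - 1) ^ T.charpoly.roots.card := by
    have h1 : T.charpoly = (T.charpoly.roots.map fun μ => Polynomial.X - Polynomial.C μ).prod :=
      (IsAlgClosed.splits T.charpoly).eq_prod_roots_of_monic T.charpoly_monic
    nth_rewrite 1 [h1]
    refine Multiset.prod_map_dvd_pow_card _ _ _ fun μ hμ => ?_
    rw [Polynomial.dvd_iff_isRoot]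
    have : μ ^ m = 1 := by
      obtain ⟨j, hj⟩ := Finset.dvd_prod_of_mem k (Multiset.mem_toFinset.2 hμ)
      rw [hm, hj, pow_mul, hk μ hμ, one_pow]
    simp [this]
  obtain ⟨q, hq⟩ := hdvd
  have := congrArg (Polynomial.aeval T) hq
  rw [map_mul, LinearMap.aeval_self_charpoly, zero_mul] at this
  simpa using this

theorem monodromy_apply (δ : ℝ) (g : logDisk δ → ℂ) (w : logDisk δ) :
    monodromy δ g w = g (deckShift δ 1 w) := rfl

theorem coe_deckShift (δ : ℝ) (k : ℤ) (w : logDisk δ) :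
    (deckShift δ k w : ℂ) = w + k * (2 * Real.pi * Complex.I) := rfl

theorem monodromy_mem_branchSpace {δ : ℝ} {f : logDisk δ → ℂ} {v : logDisk δ → ℂ}
    (hv : v ∈ branchSpace δ f) : monodromy δ v ∈ branchSpace δ f := by
  have : (branchSpace δ f).map (monodromy δ) ≤ branchSpace δ f := by
    rw [branchSpace, Submodule.map_span_le]
    rintro _ ⟨k, rfl⟩
    refine Submodule.subset_span ⟨k + 1, ?_⟩
    funext w
    rw [monodromy_apply]
    simp only [Function.comp_apply]
    congr 1
    refine Subtype.ext ?_
    simp only [coe_deckShift]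
    push_cast
    ring
  exact this ⟨v, hv, rfl⟩

theorem monodromy_pow_restrict (δ : ℝ) (g : ℂ → ℂ) (m : ℕ) (w : logDisk δ) :
    (monodromy δ ^ m) ((logDisk δ).domRestrict g) w = g (w + m * (2 * Real.pi * Complex.I)) := by
  induction m generalizing w with
  | zero => simp
  | succ m ih =>
    rw [pow_succ', Module.End.mul_apply, monodromy_apply, ih, coe_deckShift]
    congr 1
    push_cast
    ring

theorem monodromy_pow_sub_one_pow_restrict (δ : ℝ) (g : ℂ → ℂ) (m ν : ℕ) :
    ((monodromy δ ^ m - 1) ^ ν) ((logDisk δ).domRestrict g) =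
      (logDisk δ).domRestrict ((fwdDiff (m * (2 * Real.pi * Complex.I) : ℂ))^[ν] g) := by
  induction ν generalizing g with
  | zero => simp
  | succ ν ih =>
    rw [pow_succ, Module.End.mul_apply, Function.iterate_succ_apply, ← ih]
    congr 1
    funext w
    rw [LinearMap.sub_apply, Pi.sub_apply, monodromy_pow_restrict]
    rfl

/-- On restrictions of functions on ℂ, T^m - 1 is the forward difference with step 2πim. The
nilpotency is applied to f, which lies in its own branch space as the branch k = 0. -/
theorem exists_iterate_fwdDiff_eq_zero {δ : ℝ} {f : ℂ → ℂ}
    (hfin : FiniteDimensional ℂ (branchSpace δ ((logDisk δ).domRestrict f)))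
    (heig : ∀ (μ : ℂ) (v : logDisk δ → ℂ), v ∈ branchSpace δ ((logDisk δ).domRestrict f) →
      (monodromy δ).HasEigenvector μ v → ∃ m : ℕ, 0 < m ∧ μ ^ m = 1) :
    ∃ m ν : ℕ, 0 < m ∧
      ∀ w ∈ logDisk δ, (fwdDiff (m * (2 * Real.pi * Complex.I) : ℂ))^[ν] f w = 0 := by
  set V := branchSpace δ ((logDisk δ).domRestrict f) with hV
  set T : Module.End ℂ V := (monodromy δ).restrict fun v hv => monodromy_mem_branchSpace hv with hT
  obtain ⟨m, ν, hm, h0⟩ := exists_pow_sub_one_pow_eq_zero T fun μ hμ => by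
    obtain ⟨v, hv⟩ := hμ.exists_hasEigenvector
    refine heig μ v v.2 ⟨Module.End.mem_eigenspace_iff.2 ?_, fun h => hv.2 (Subtype.ext h)⟩
    exact congrArg Subtype.val hv.apply_eq_smul
  refine ⟨m, ν, hm, fun w hw => ?_⟩
  have hf : (logDisk δ).domRestrict f ∈ V := by
    refine Submodule.subset_span ⟨0, ?_⟩
    funext w
    simp only [Function.comp_apply]
    congr 1
    refine Subtype.ext ?_
    simp [coe_deckShift]
  have hpow : ∀ (k : ℕ) (v : V), (((T ^ k) v : V) : logDisk δ → ℂ) = (monodromy δ ^ k) v := by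
    intro k
    induction k with
    | zero => intro v; rfl
    | succ k ih => intro v; rw [pow_succ, pow_succ, Module.End.mul_apply, Module.End.mul_apply, ih]; rfl
  have hcoe : ∀ (k : ℕ) (v : V), ((((T ^ m - 1) ^ k) v : V) : logDisk δ → ℂ) =
      ((monodromy δ ^ m - 1) ^ k) v := by
    intro k
    induction k with
    | zero => intro v; rfl
    | succ k ih =>
      intro v
      rw [pow_succ, pow_succ, Module.End.mul_apply, Module.End.mul_apply, ih, LinearMap.sub_apply,
        LinearMap.sub_apply, Submodule.coe_sub, hpow]
      rfl
  have h1 := hcoe ν ⟨_, hf⟩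
  rw [h0, monodromy_pow_sub_one_pow_restrict] at h1
  exact (congrFun h1 ⟨w, hw⟩).symm

/-! ### Solving the difference equation: log-Puiseux form -/

theorem exists_abs_im_add_le_pi (w : ℂ) :
    ∃ k : ℤ, |(w + k * (2 * Real.pi * Complex.I)).im| ≤ Real.pi := by
  refine ⟨-round (w.im / (2 * Real.pi)), ?_⟩
  have h := abs_sub_round (w.im / (2 * Real.pi))
  have hpi := Real.pi_pos
  have e : (w + ((-round (w.im / (2 * Real.pi)) : ℤ) : ℂ) * (2 * Real.pi * Complex.I)).im =
      (w.im / (2 * Real.pi) - round (w.im / (2 * Real.pi))) * (2 * Real.pi) := by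
    simp
    field_simp
    ring
  rw [e, abs_mul, abs_of_pos (by positivity : 0 < 2 * Real.pi)]
  nlinarith

/-- The product e^(Nw) F(w) is bounded and periodic, hence a bounded holomorphic function of e^w on
a punctured disk, whose singularity at 0 is removable. By periodicity a bound on one period strip is
enough. -/
theorem exists_analyticAt_of_periodic {F : ℂ → ℂ} {c C : ℝ} {N : ℕ}
    (hF : DifferentiableOn ℂ F {w | w.re < c})
    (hper : ∀ w : ℂ, w.re < c → F (w + 2 * Real.pi * Complex.I) = F w)
    (hbd : ∀ w : ℂ, w.re < c → |w.im| ≤ Real.pi → ‖F w‖ ≤ C * Real.exp (-(N * w.re))) :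
    ∃ h : ℂ → ℂ, AnalyticAt ℂ h 0 ∧
      ∀ w : ℂ, w.re < c → F w = Complex.exp (-(N * w)) * h (Complex.exp w) := by
  classical
  -- With w = 2πiz the left half-plane becomes a neighbourhood of i∞ and the period becomes 1, as
  -- `cuspFunction` requires. The value 0 elsewhere keeps periodicity and the bound global.
  set f : ℂ → ℂ := fun z => if (2 * Real.pi * Complex.I * z).re < c then
    F (2 * Real.pi * Complex.I * z) * Complex.exp (N * (2 * Real.pi * Complex.I * z)) else 0 with hf
  have hre : ∀ z : ℂ, (2 * Real.pi * Complex.I * z).re = -(2 * Real.pi) * z.im := fun z => by simp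
  have hfp : Function.Periodic f ((1 : ℝ) : ℂ) := by
    intro z
    have e1 : (2 * Real.pi * Complex.I * (z + ((1 : ℝ) : ℂ))) =
        2 * Real.pi * Complex.I * z + 2 * Real.pi * Complex.I := by push_cast; ring
    have e2 : (2 * Real.pi * Complex.I * (z + ((1 : ℝ) : ℂ))).re =
        (2 * Real.pi * Complex.I * z).re := by rw [hre, hre]; simp
    simp only [hf, e2]
    split_ifs with h
    · rw [e1, hper _ h, mul_add, Complex.exp_add,
        Complex.exp_nat_mul_two_pi_mul_I N, mul_one]
    · rfl
  have hopen : IsOpen {w : ℂ | w.re < c} := isOpen_lt Complex.continuous_re continuous_const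
  have hev : ∀ᶠ z : ℂ in comap Complex.im atTop, (2 * Real.pi * Complex.I * z).re < c := by
    filter_upwards [(eventually_gt_atTop (-c / (2 * Real.pi))).comap Complex.im] with z hz
    rw [hre]
    rw [div_lt_iff₀ (by positivity)] at hz
    linarith
  have hdiff : ∀ᶠ z in comap Complex.im atTop, DifferentiableAt ℂ f z := by
    filter_upwards [hev] with z hz
    have h1 : f =ᶠ[𝓝 z] fun z => F (2 * Real.pi * Complex.I * z) *
        Complex.exp (N * (2 * Real.pi * Complex.I * z)) := by
      have hc : Continuous fun z : ℂ => (2 * Real.pi * Complex.I * z).re := by fun_prop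
      filter_upwards [hc.continuousAt.eventually_lt continuousAt_const hz] with y hy
      simp only [hf]
      rw [if_pos hy]
    rw [h1.differentiableAt_iff]
    refine DifferentiableAt.mul ?_ (by fun_prop)
    exact DifferentiableAt.comp (g := F) z (hF.differentiableAt (hopen.mem_nhds hz)) (by fun_prop)
  have hbound : ∀ z : ℂ, ‖f z‖ ≤ |C| := by
    intro z
    obtain ⟨k, hk⟩ := exists_abs_im_add_le_pi (2 * Real.pi * Complex.I * z)
    have hfk : f (z + k) = f z := by
      have := hfp.int_mul k z
      simpa using this
    rw [← hfk]
    have e1 : 2 * Real.pi * Complex.I * (z + k) =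
        2 * Real.pi * Complex.I * z + k * (2 * Real.pi * Complex.I) := by ring
    rw [← e1] at hk
    simp only [hf]
    split_ifs with h
    · rw [norm_mul, Complex.norm_exp]
      have h1 := hbd _ h hk
      have e2 : (N * (2 * Real.pi * Complex.I * (z + k)) : ℂ).re =
          N * (2 * Real.pi * Complex.I * (z + k)).re := by
        rw [← Complex.ofReal_natCast, Complex.re_ofReal_mul]
      rw [e2]
      calc _ ≤ C * Real.exp (-(N * (2 * Real.pi * Complex.I * (z + k)).re)) *
            Real.exp (N * (2 * Real.pi * Complex.I * (z + k)).re) := by gcongr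
        _ = C := by rw [mul_assoc, ← Real.exp_add]; simp
        _ ≤ _ := le_abs_self C
    · simp
  have hB : (comap Complex.im atTop).BoundedAtFilter f := by
    refine Asymptotics.IsBigO.of_bound |C| (Eventually.of_forall fun z => ?_)
    simpa using hbound z
  refine ⟨Function.Periodic.cuspFunction 1 f, ?_, fun w hw => ?_⟩
  · rw [Complex.analyticAt_iff_eventually_differentiableAt]
    have h1 := Function.Periodic.eventually_differentiableAt_cuspFunction_nhds_ne_zero one_pos hfp
      hdiff
    have h2 := Function.Periodic.differentiableAt_cuspFunction_zero one_pos hfp hdiff hB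
    rw [eventually_nhdsWithin_iff] at h1
    filter_upwards [h1] with z hz
    rcases eq_or_ne z 0 with rfl | hne
    · exact h2
    · exact hz hne
  · have hpi : (2 * Real.pi * Complex.I : ℂ) ≠ 0 := Complex.two_pi_I_ne_zero
    have h1 := Function.Periodic.eq_cuspFunction (h := 1) one_ne_zero hfp
      (w / (2 * Real.pi * Complex.I))
    have e1 : 2 * Real.pi * Complex.I * (w / (2 * Real.pi * Complex.I)) = w :=
      mul_div_cancel₀ w hpi
    have e2 : Function.Periodic.qParam 1 (w / (2 * Real.pi * Complex.I)) = Complex.exp w := by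
      rw [Function.Periodic.qParam, e1]
      simp
    rw [e2] at h1
    rw [h1]
    simp only [hf]
    rw [e1, if_pos hw, mul_left_comm, ← Complex.exp_add]
    simp

/-- The polynomials are the binomials (w/a choose β); the relation is Pascal's rule. -/
theorem exists_polynomial_fwdDiff {a : ℂ} (ha : a ≠ 0) :
    ∃ Q : ℕ → Polynomial ℂ, Q 0 = 1 ∧
      ∀ β w, (Q (β + 1)).eval (w + a) - (Q (β + 1)).eval w = (Q β).eval w := by
  refine ⟨fun β => Polynomial.C ((β.factorial : ℂ)⁻¹) *
    (descPochhammer ℂ β).comp (Polynomial.C a⁻¹ * Polynomial.X), by simp, fun β w => ?_⟩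
  have h := congrArg (Polynomial.eval (w / a + 1)) (descPochhammer_succ_comp_X_sub_one ℂ β)
  simp only [Polynomial.eval_comp, Polynomial.eval_sub, Polynomial.eval_X, Polynomial.eval_one,
    add_sub_cancel_right, smul_eq_mul, Polynomial.eval_mul, Polynomial.eval_add,
    Polynomial.eval_natCast] at h
  simp only [Polynomial.eval_mul, Polynomial.eval_C, Polynomial.eval_comp, Polynomial.eval_X]
  have e1 : a⁻¹ * (w + a) = w / a + 1 := by field_simp
  have e2 : a⁻¹ * w = w / a := by field_simp
  have h1 : (β.factorial : ℂ) ≠ 0 := by exact_mod_cast β.factorial_ne_zero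
  have h2 : (β : ℂ) + 1 ≠ 0 := Nat.cast_add_one_ne_zero β
  have h3 : (((β + 1).factorial : ℕ) : ℂ)⁻¹ * (β + 1) = (β.factorial : ℂ)⁻¹ := by
    rw [Nat.factorial_succ]
    push_cast
    field_simp
  rw [e1, e2, h, ← h3]
  ring

theorem exists_norm_polynomial_le (Q : Polynomial ℂ) :
    ∃ C : ℝ, 0 ≤ C ∧ ∀ w : ℂ, w.re ≤ 0 → |w.im| ≤ Real.pi →
      ‖Q.eval w‖ ≤ C * Real.exp (-w.re) := by
  refine ⟨∑ i ∈ Finset.range (Q.natDegree + 1), ‖Q.coeff i‖ * (i.factorial * Real.exp Real.pi),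
    by positivity, fun w hre him => ?_⟩
  rw [Polynomial.eval_eq_sum_range, Finset.sum_mul]
  refine (norm_sum_le _ _).trans (Finset.sum_le_sum fun i _ => ?_)
  rw [norm_mul, norm_pow, mul_assoc]
  have h0 : ‖w‖ ≤ -w.re + Real.pi := by
    refine (Complex.norm_le_abs_re_add_abs_im w).trans ?_
    rw [abs_of_nonpos hre]
    linarith
  have h1 : ‖w‖ ^ i ≤ i.factorial * Real.exp Real.pi * Real.exp (-w.re) := by
    have hb := Real.pow_div_factorial_le_exp (-w.re + Real.pi) ((norm_nonneg w).trans h0) i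
    rw [div_le_iff₀ (by positivity), Real.exp_add] at hb
    calc ‖w‖ ^ i ≤ (-w.re + Real.pi) ^ i := by gcongr
      _ ≤ _ := by linarith
  gcongr

theorem norm_exp_lt_of_re_lt_log {η : ℝ} (hη : 0 < η) {w : ℂ} (hw : w.re < Real.log η) :
    ‖Complex.exp w‖ < η := by
  rw [Complex.norm_exp]
  exact (Real.lt_log_iff_exp_lt hη).1 hw

/-- Induction on the order of the difference equation. A discrete antiderivative of the form known
for the difference of F is obtained by raising each index of Q by one; subtracting it from F leaves
a periodic function of moderate growth. -/
theorem exists_binomial_structure {Q : ℕ → Polynomial ℂ} (hQ0 : Q 0 = 1)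
    (hQ : ∀ β w, (Q (β + 1)).eval (w + 2 * Real.pi * Complex.I) - (Q (β + 1)).eval w =
      (Q β).eval w) (ν : ℕ) :
    ∀ (F : ℂ → ℂ) (c : ℝ), DifferentiableOn ℂ F {w | w.re < c} →
      (∀ M : ℝ, ∃ (C : ℝ) (N : ℕ), ∀ w : ℂ, w.re < c → |w.im| ≤ M →
        ‖F w‖ ≤ C * Real.exp (-(N * w.re))) →
      (∀ w : ℂ, w.re < c → (fwdDiff (2 * Real.pi * Complex.I : ℂ))^[ν] F w = 0) →
      ∃ (N : ℕ) (h : ℕ → ℂ → ℂ), (∀ β, AnalyticAt ℂ (h β) 0) ∧ ∃ c' : ℝ, ∀ w : ℂ, w.re < c' →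
        F w = Complex.exp (-(N * w)) *
          ∑ β ∈ Finset.range ν, (Q β).eval w * h β (Complex.exp w) := by
  induction ν with
  | zero =>
    intro F c _ _ h
    exact ⟨0, fun _ _ => 0, fun _ => analyticAt_const, c, fun w hw => by simpa using h w hw⟩
  | succ ν ih =>
    intro F c hF hgr h
    have hre : ∀ w : ℂ, (w + 2 * Real.pi * Complex.I).re = w.re := fun w => by simp
    have hmaps : Set.MapsTo (fun w : ℂ => w + 2 * Real.pi * Complex.I) {w | w.re < c}
        {w | w.re < c} := fun w hw => by
      simp only [Set.mem_ofPred_eq, hre]; exact hw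
    have hgr₁ : ∀ M : ℝ, ∃ (C : ℝ) (N : ℕ), ∀ w : ℂ, w.re < c → |w.im| ≤ M →
        ‖fwdDiff (2 * Real.pi * Complex.I : ℂ) F w‖ ≤ C * Real.exp (-(N * w.re)) := by
      intro M
      obtain ⟨C, N, hCN⟩ := hgr (M + 2 * Real.pi)
      refine ⟨C + C, N, fun w hw him => ?_⟩
      have hpi := Real.pi_pos
      refine (norm_sub_le _ _).trans ?_
      rw [add_mul]
      refine add_le_add ?_ (hCN w hw (by linarith))
      have := hCN (w + 2 * Real.pi * Complex.I) (by rw [hre]; exact hw) ?_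
      · rwa [hre] at this
      · have e : (w + 2 * Real.pi * Complex.I).im = w.im + 2 * Real.pi := by simp
        rw [e]
        refine (abs_add_le _ _).trans ?_
        rw [abs_of_pos (by positivity : 0 < 2 * Real.pi)]
        linarith
    obtain ⟨N₁, h₁, han, c₁, hc₁⟩ := ih (fwdDiff (2 * Real.pi * Complex.I : ℂ) F) c
      ((hF.comp (by fun_prop) hmaps).sub hF) hgr₁ h
    obtain ⟨η, hη, hball⟩ : ∃ η > 0, ∀ x : ℂ, ‖x‖ < η → ∀ β ∈ Finset.range ν,
        DifferentiableAt ℂ (h₁ β) x ∧ ‖h₁ β x‖ ≤ ‖h₁ β 0‖ + 1 := by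
      have hev : ∀ᶠ x in 𝓝 (0 : ℂ), ∀ β ∈ Finset.range ν,
          DifferentiableAt ℂ (h₁ β) x ∧ ‖h₁ β x‖ ≤ ‖h₁ β 0‖ + 1 := by
        rw [Finset.eventually_all]
        intro β _
        refine ((han β).eventually_analyticAt.mono fun x hx => hx.differentiableAt).and ?_
        exact ((han β).continuousAt.norm.eventually_lt continuousAt_const
          (by simp)).mono fun x hx => hx.le
      obtain ⟨η, hη, hb⟩ := Metric.eventually_nhds_iff.1 hev
      exact ⟨η, hη, fun x hx => hb (by simpa using hx)⟩
    set c₂ : ℝ := min (min c c₁) (min 0 (Real.log η)) with hc₂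
    have hlt : ∀ w : ℂ, w.re < c₂ → w.re < c ∧ w.re < c₁ ∧ w.re < 0 ∧ w.re < Real.log η :=
      fun w hw => by simpa [hc₂, and_assoc] using hw
    set E : ℂ → ℂ := fun w => Complex.exp (-(N₁ * w)) *
      ∑ β ∈ Finset.range ν, (Q (β + 1)).eval w * h₁ β (Complex.exp w) with hE
    have hexp : ∀ (n : ℕ) (w : ℂ), Complex.exp (-(n * (w + 2 * Real.pi * Complex.I))) =
        Complex.exp (-(n * w)) := fun n w => by
      rw [mul_add, neg_add, Complex.exp_add, Complex.exp_neg (n * (2 * Real.pi * Complex.I)),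
        Complex.exp_nat_mul_two_pi_mul_I n]
      simp
    have hexp1 : ∀ w : ℂ, Complex.exp (w + 2 * Real.pi * Complex.I) = Complex.exp w :=
      fun w => Complex.exp_periodic w
    have hper : ∀ w : ℂ, w.re < c₂ → (F - E) (w + 2 * Real.pi * Complex.I) = (F - E) w := by
      intro w hw
      have hd : F (w + 2 * Real.pi * Complex.I) - F w = _ := hc₁ w (hlt w hw).2.1
      have hEd : E (w + 2 * Real.pi * Complex.I) - E w = Complex.exp (-(N₁ * w)) *
          ∑ β ∈ Finset.range ν, (Q β).eval w * h₁ β (Complex.exp w) := by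
        simp only [hE, hexp, hexp1]
        rw [← mul_sub, ← Finset.sum_sub_distrib]
        congr 1
        refine Finset.sum_congr rfl fun β _ => ?_
        rw [← hQ β w]
        ring
      simp only [Pi.sub_apply]
      linear_combination hd - hEd
    have hdiff : DifferentiableOn ℂ (F - E) {w | w.re < c₂} := by
      refine (hF.mono fun w hw => (hlt w hw).1).sub fun w hw => ?_
      refine DifferentiableAt.differentiableWithinAt ?_
      refine DifferentiableAt.mul (by fun_prop) (DifferentiableAt.fun_sum fun β hβ => ?_)
      refine DifferentiableAt.mul (Polynomial.differentiable _).differentiableAt ?_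
      have := (hball (Complex.exp w) (norm_exp_lt_of_re_lt_log hη (hlt w hw).2.2.2) β hβ).1
      exact DifferentiableAt.comp (g := h₁ β) w this Complex.differentiable_exp.differentiableAt
    obtain ⟨C, N, hCN⟩ := hgr Real.pi
    choose D hD0 hD using fun β => exists_norm_polynomial_le (Q β)
    -- The extra 1 absorbs the polynomials `Q (β + 1)`, which are O(e^(-Re w)) on the strip.
    set N₂ : ℕ := max N (N₁ + 1) with hN₂
    have hmono : ∀ (k : ℕ) (w : ℂ), k ≤ N₂ → w.re < 0 →
        Real.exp (-(k * w.re)) ≤ Real.exp (-(N₂ * w.re)) := by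
      intro k w hk hw
      refine Real.exp_le_exp.2 ?_
      have : (k : ℝ) ≤ N₂ := by exact_mod_cast hk
      nlinarith
    have hbd : ∀ w : ℂ, w.re < c₂ → |w.im| ≤ Real.pi → ‖(F - E) w‖ ≤
        (|C| + ∑ β ∈ Finset.range ν, D (β + 1) * (‖h₁ β 0‖ + 1)) * Real.exp (-(N₂ * w.re)) := by
      intro w hw him
      obtain ⟨l1, l2, l3, l4⟩ := hlt w hw
      refine (norm_sub_le _ _).trans ?_
      rw [add_mul]
      refine add_le_add ?_ ?_
      · calc ‖F w‖ ≤ C * Real.exp (-(N * w.re)) := hCN w l1 him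
          _ ≤ |C| * Real.exp (-(N₂ * w.re)) := by
            have := hmono N w (le_max_left _ _) l3
            have := le_abs_self C
            gcongr
      · have hterm : ∀ β ∈ Finset.range ν, ‖(Q (β + 1)).eval w * h₁ β (Complex.exp w)‖ ≤
            D (β + 1) * (‖h₁ β 0‖ + 1) * Real.exp (-w.re) := by
          intro β hβ
          rw [norm_mul]
          have h1 := hD (β + 1) w l3.le him
          have h0 := hD0 (β + 1)
          have h2 := (hball (Complex.exp w) (norm_exp_lt_of_re_lt_log hη l4) β hβ).2
          calc _ ≤ (D (β + 1) * Real.exp (-w.re)) * (‖h₁ β 0‖ + 1) := by gcongr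
            _ = _ := by ring
        have hs := (norm_sum_le _ _).trans (Finset.sum_le_sum hterm)
        rw [← Finset.sum_mul] at hs
        simp only [hE]
        rw [norm_mul, Complex.norm_exp]
        have e : (-((N₁ : ℂ) * w)).re = -(N₁ * w.re) := by
          rw [Complex.neg_re, ← Complex.ofReal_natCast, Complex.re_ofReal_mul]
        rw [e]
        have hS : 0 ≤ ∑ β ∈ Finset.range ν, D (β + 1) * (‖h₁ β 0‖ + 1) :=
          Finset.sum_nonneg fun β _ => mul_nonneg (hD0 _) (by positivity)
        calc _ ≤ Real.exp (-(N₁ * w.re)) * ((∑ β ∈ Finset.range ν,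
                D (β + 1) * (‖h₁ β 0‖ + 1)) * Real.exp (-w.re)) := by gcongr
          _ = (∑ β ∈ Finset.range ν, D (β + 1) * (‖h₁ β 0‖ + 1)) *
              Real.exp (-(((N₁ + 1 : ℕ) : ℝ) * w.re)) := by
            rw [mul_left_comm, ← Real.exp_add]
            congr 2
            push_cast
            ring
          _ ≤ _ := by
            have := hmono (N₁ + 1) w (le_max_right _ _) l3
            gcongr
    obtain ⟨g, hg, hgw⟩ := exists_analyticAt_of_periodic hdiff hper hbd
    -- The periodic part has index 0; the antiderivative is shifted by one, and x^(N₂ - N₁) moves it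
    -- to the common prefactor.
    refine ⟨N₂, fun β => if β = 0 then g else fun x => x ^ (N₂ - N₁) * h₁ (β - 1) x, fun β => ?_,
      c₂, fun w hw => ?_⟩
    · beta_reduce
      split_ifs
      · exact hg
      · exact (analyticAt_id.pow _).mul (han _)
    · have h1 := hgw w hw
      have hle : N₁ ≤ N₂ := (Nat.le_succ _).trans (le_max_right _ _)
      have e1 : Complex.exp (-(N₁ * w)) =
          Complex.exp (-(N₂ * w)) * Complex.exp w ^ (N₂ - N₁) := by
        rw [← Complex.exp_nat_mul, ← Complex.exp_add, Nat.cast_sub hle]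
        congr 1
        ring
      rw [Finset.sum_range_succ']
      simp only [if_true, Nat.add_eq_zero_iff, one_ne_zero, and_false, if_false, hQ0,
        Polynomial.eval_one, one_mul, Nat.add_sub_cancel]
      have h2 : F w = (F - E) w + E w := by simp
      rw [h2, h1]
      simp only [hE, e1]
      rw [mul_add, Finset.mul_sum, Finset.mul_sum, add_comm]
      congr 1
      refine Finset.sum_congr rfl fun β _ => ?_
      ring

/-- `f` is given, far to the left, by a finite sum of terms `w ^ β g_β(e ^ {w / m})`, multiplied
by `e ^ {- N w / m}`, with `g_β` analytic at `0`. -/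
def HasLogPuiseuxForm (f : ℂ → ℂ) (m N ν : ℕ) (g : ℕ → ℂ → ℂ) : Prop :=
  (∀ β, AnalyticAt ℂ (g β) 0) ∧ ∃ c : ℝ, ∀ w : ℂ, w.re < c →
    f w = Complex.exp (-(N * (w / m))) *
      ∑ β ∈ Finset.range ν, w ^ β * g β (Complex.exp (w / m))

theorem iterate_fwdDiff_comp_mul (a b : ℂ) (g : ℂ → ℂ) (ν : ℕ) (w : ℂ) :
    (fwdDiff b)^[ν] (fun w => g (a * w)) w = (fwdDiff (a * b))^[ν] g (a * w) := by
  induction ν generalizing g with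
  | zero => rfl
  | succ ν ih =>
    have h : fwdDiff b (fun w => g (a * w)) = fun w => fwdDiff (a * b) g (a * w) := by
      funext w
      simp [fwdDiff, mul_add]
    rw [Function.iterate_succ_apply, Function.iterate_succ_apply, ← ih, h]

/-- Rescaling w by m turns the step 2πim into 2πi; the binomial polynomials are then rewritten in
powers of w. -/
theorem exists_logPuiseuxForm {δ : ℝ} (hδ : 0 < δ) {f : ℂ → ℂ}
    (hf : DifferentiableOn ℂ f (logDisk δ)) (hgr : HasModerateGrowth δ f) {m ν : ℕ} (hm : 0 < m)
    (hT : ∀ w ∈ logDisk δ, (fwdDiff (m * (2 * Real.pi * Complex.I) : ℂ))^[ν] f w = 0) :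
    ∃ (N ν' : ℕ) (g : ℕ → ℂ → ℂ), HasLogPuiseuxForm f m N ν' g := by
  obtain ⟨Q, hQ0, hQ⟩ := exists_polynomial_fwdDiff Complex.two_pi_I_ne_zero
  have hm0 : (0 : ℝ) < m := by exact_mod_cast hm
  have hmC : (m : ℂ) ≠ 0 := by exact_mod_cast hm.ne'
  set c : ℝ := Real.log δ / m with hc
  have hre : ∀ w : ℂ, ((m : ℂ) * w).re = m * w.re := fun w => by
    rw [← Complex.ofReal_natCast, Complex.re_ofReal_mul]
  have him : ∀ w : ℂ, ((m : ℂ) * w).im = m * w.im := fun w => by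
    rw [← Complex.ofReal_natCast, Complex.im_ofReal_mul]
  have hmem : ∀ w : ℂ, w.re < c → (m : ℂ) * w ∈ logDisk δ := by
    intro w hw
    refine norm_exp_lt_of_re_lt_log hδ ?_
    rw [hre]
    rw [hc, lt_div_iff₀ hm0] at hw
    linarith
  obtain ⟨N, h, han, c', hc'⟩ := exists_binomial_structure hQ0 hQ ν (fun w => f (m * w)) c
    (hf.comp (by fun_prop) fun w hw => hmem w hw) (fun M => by
      obtain ⟨C, N, hCN⟩ := hgr (m * M)
      refine ⟨C, m * N, fun w hw hM => ?_⟩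
      refine (hCN _ (hmem w hw) ?_).trans (le_of_eq ?_)
      · rw [him, abs_mul, abs_of_pos hm0]
        gcongr
      · rw [Complex.norm_exp, ← Real.exp_neg, ← Real.exp_nat_mul, hre]
        congr 2
        push_cast
        ring)
    (fun w hw => by rw [iterate_fwdDiff_comp_mul]; exact hT _ (hmem w hw))
  set D : ℕ := (Finset.range ν).sup (fun β => (Q β).natDegree) + 1 with hD
  refine ⟨N, D, fun i x => ((m : ℂ) ^ i)⁻¹ * ∑ β ∈ Finset.range ν, (Q β).coeff i * h β x,
    fun i => ?_, m * c', fun w hw => ?_⟩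
  · exact analyticAt_const.mul
      (Finset.analyticAt_fun_sum _ fun β _ => analyticAt_const.mul (han β))
  · have hw' : (w / m).re < c' := by
      have := hre (w / m)
      rw [mul_div_cancel₀ w hmC] at this
      rw [this] at hw
      exact lt_of_mul_lt_mul_left hw hm0.le
    have h1 := hc' (w / m) hw'
    simp only [mul_div_cancel₀ w hmC] at h1
    rw [h1]
    congr 1
    simp_rw [Finset.mul_sum]
    rw [Finset.sum_comm]
    refine Finset.sum_congr rfl fun β hβ => ?_
    rw [Polynomial.eval_eq_sum_range' (n := D)
      (Nat.lt_succ_of_le (Finset.le_sup (f := fun β => (Q β).natDegree) hβ)), Finset.sum_mul]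
    refine Finset.sum_congr rfl fun i _ => ?_
    rw [div_pow]
    field_simp

theorem exists_re_lt_of_eventually {P : ℂ → Prop} (h : ∀ᶠ x in 𝓝 (0 : ℂ), P x) {m : ℕ}
    (hm : 0 < m) : ∃ c : ℝ, ∀ w : ℂ, w.re < c → P (Complex.exp (w / m)) := by
  obtain ⟨η, hη, hb⟩ := Metric.eventually_nhds_iff.1 h
  have hm0 : (0 : ℝ) < m := by exact_mod_cast hm
  refine ⟨m * Real.log η, fun w hw => hb ?_⟩
  rw [dist_zero_right]
  refine norm_exp_lt_of_re_lt_log hη ?_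
  rw [← Complex.ofReal_natCast, Complex.div_ofReal_re, div_lt_iff₀ hm0]
  linarith

theorem HasLogPuiseuxForm.exists_truncation {f : ℂ → ℂ} {m N ν : ℕ} {g : ℕ → ℂ → ℂ} (hm : 0 < m)
    (h : HasLogPuiseuxForm f m N ν g) :
    ∃ γ : ℕ → ℕ → ℂ, ∀ J : ℕ, ∃ K₀ : ℕ, ∀ K ≥ K₀, ∃ C c : ℝ, ∀ w : ℂ, w.re < c →
      |w.im| ≤ Real.pi →
      ‖f w - ∑ k ∈ Finset.range K, ∑ β ∈ Finset.range ν, γ k β *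
        (Complex.exp ((((k - N) / m : ℚ) : ℂ) * w) * w ^ β)‖ ≤ C * Real.exp (J * w.re) := by
  obtain ⟨han, c₀, hc₀⟩ := h
  have hm0 : (0 : ℝ) < m := by exact_mod_cast hm
  have hmC : (m : ℂ) ≠ 0 := by exact_mod_cast hm.ne'
  choose p hp using han
  -- From this K on the omitted exponents are at least J + 1. The spare factor e^(Re w) absorbs the
  -- powers of w.
  refine ⟨fun k β => (p β).coeff k, fun J => ⟨N + m * (J + 1), fun K hK => ?_⟩⟩
  choose C hC using fun β => (hp β).isBigO_sub_partialSum_pow K |>.bound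
  have hev : ∀ᶠ x in 𝓝 (0 : ℂ), ∀ β ∈ Finset.range ν,
      ‖g β x - ∑ k ∈ Finset.range K, (p β).coeff k * x ^ k‖ ≤ C β * ‖x‖ ^ K := by
    rw [Finset.eventually_all]
    intro β _
    filter_upwards [hC β] with x hx
    simpa [FormalMultilinearSeries.partialSum, mul_comm] using hx
  obtain ⟨c₁, hc₁⟩ := exists_re_lt_of_eventually hev hm
  refine ⟨∑ β ∈ Finset.range ν, β.factorial * Real.exp Real.pi * |C β|, min (min c₀ c₁) 0,
    fun w hw him => ?_⟩
  simp only [lt_min_iff] at hw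
  obtain ⟨⟨hw0, hw1⟩, hw2⟩ := hw
  have hb := hc₁ w hw1
  set x := Complex.exp (w / m) with hx
  have hxn : ‖x‖ = Real.exp (w.re / m) := by
    rw [hx, Complex.norm_exp, ← Complex.ofReal_natCast, Complex.div_ofReal_re]
  have e1 : ∑ k ∈ Finset.range K, ∑ β ∈ Finset.range ν, (p β).coeff k *
      (Complex.exp ((((k - N) / m : ℚ) : ℂ) * w) * w ^ β) =
      Complex.exp (-(N * (w / m))) * ∑ β ∈ Finset.range ν, w ^ β *
        ∑ k ∈ Finset.range K, (p β).coeff k * x ^ k := by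
    rw [Finset.sum_comm, Finset.mul_sum]
    refine Finset.sum_congr rfl fun β _ => ?_
    rw [Finset.mul_sum, Finset.mul_sum]
    refine Finset.sum_congr rfl fun k _ => ?_
    have : Complex.exp ((((k - N) / m : ℚ) : ℂ) * w) = Complex.exp (-(N * (w / m))) * x ^ k := by
      rw [hx, ← Complex.exp_nat_mul, ← Complex.exp_add]
      congr 1
      push_cast
      field_simp
      ring
    rw [this]
    ring
  rw [hc₀ w hw0, e1, ← mul_sub, ← Finset.sum_sub_distrib, norm_mul, Complex.norm_exp]
  have e2 : (-((N : ℂ) * (w / m))).re = -(N * (w.re / m)) := by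
    rw [Complex.neg_re, ← Complex.ofReal_natCast, Complex.re_ofReal_mul, ← Complex.ofReal_natCast,
      Complex.div_ofReal_re]
  rw [e2]
  have hterm : ∀ β ∈ Finset.range ν, ‖w ^ β * g β x -
      w ^ β * ∑ k ∈ Finset.range K, (p β).coeff k * x ^ k‖ ≤
      β.factorial * Real.exp Real.pi * |C β| * Real.exp (-w.re + K * (w.re / m)) := by
    intro β hβ
    rw [← mul_sub, norm_mul, norm_pow]
    have h1 : ‖w‖ ^ β ≤ β.factorial * Real.exp Real.pi * Real.exp (-w.re) := by
      have h0 : ‖w‖ ≤ -w.re + Real.pi := by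
        refine (Complex.norm_le_abs_re_add_abs_im w).trans ?_
        rw [abs_of_neg hw2]
        linarith
      have hb := Real.pow_div_factorial_le_exp (-w.re + Real.pi) ((norm_nonneg w).trans h0) β
      rw [div_le_iff₀ (by positivity), Real.exp_add] at hb
      calc ‖w‖ ^ β ≤ (-w.re + Real.pi) ^ β := by gcongr
        _ ≤ _ := by linarith
    have h2 : ‖g β x - ∑ k ∈ Finset.range K, (p β).coeff k * x ^ k‖ ≤
        |C β| * Real.exp (K * (w.re / m)) := by
      refine (hb β hβ).trans ?_
      rw [hxn, ← Real.exp_nat_mul]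
      gcongr
      exact le_abs_self _
    calc _ ≤ (β.factorial * Real.exp Real.pi * Real.exp (-w.re)) *
          (|C β| * Real.exp (K * (w.re / m))) := by gcongr
      _ = _ := by rw [Real.exp_add]; ring
  have hs := (norm_sum_le _ _).trans (Finset.sum_le_sum hterm)
  rw [← Finset.sum_mul] at hs
  calc _ ≤ Real.exp (-(N * (w.re / m))) *
        ((∑ β ∈ Finset.range ν, β.factorial * Real.exp Real.pi * |C β|) *
          Real.exp (-w.re + K * (w.re / m))) := by gcongr
    _ = (∑ β ∈ Finset.range ν, β.factorial * Real.exp Real.pi * |C β|) *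
          Real.exp (-(N * (w.re / m)) + (-w.re + K * (w.re / m))) := by
        rw [mul_left_comm, ← Real.exp_add]
    _ ≤ _ := by
      have hexp : -(N * (w.re / m)) + (-w.re + K * (w.re / m)) ≤ J * w.re := by
        have hK' : (N : ℝ) + m * (J + 1) ≤ K := by exact_mod_cast hK
        have h3 : w.re / m ≤ 0 := div_nonpos_of_nonpos_of_nonneg hw2.le hm0.le
        have h4 : w.re = m * (w.re / m) := by field_simp
        have h5 : (K : ℝ) * (w.re / m) ≤ (N + m * (J + 1)) * (w.re / m) :=
          mul_le_mul_of_nonpos_right hK' h3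
        have h6 : (N + (m : ℝ) * (J + 1)) * (w.re / m) = N * (w.re / m) + (J + 1) * w.re := by
          field_simp
        linarith
      gcongr

/-! ### Log-Puiseux forms with a Taylor expansion are analytic -/

theorem eq_zero_of_tendsto_sum_pow_atBot {ν : ℕ} {a : ℕ → ℂ}
    (h : Tendsto (fun v : ℝ => ∑ β ∈ Finset.range ν, (v : ℂ) ^ β * a β) atBot (𝓝 0)) :
    ∀ β < ν, a β = 0 := by
  set P : Polynomial ℂ := ∑ β ∈ Finset.range ν, Polynomial.monomial β (a β) with hP
  have heval : ∀ v : ℂ, P.eval v = ∑ β ∈ Finset.range ν, v ^ β * a β := fun v => by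
    simp [hP, Polynomial.eval_finsetSum, mul_comm]
  have hcoeff : ∀ β < ν, P.coeff β = a β := fun β hβ => by
    simp [hP, Polynomial.coeff_monomial, hβ]
  simp_rw [← heval] at h
  have hdeg : P.degree ≤ 0 := by
    by_contra hd
    have hz : Tendsto (fun v : ℝ => ‖(v : ℂ)‖) atBot atTop := by
      simpa using tendsto_abs_atBot_atTop (G := ℝ)
    exact not_tendsto_nhds_of_tendsto_atTop (P.tendsto_norm_atTop (not_le.1 hd) hz) _ h.norm
  have hC := Polynomial.eq_C_of_degree_le_zero hdeg
  rw [hC] at h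
  simp only [Polynomial.eval_C] at h
  have h0 : P.coeff 0 = 0 := tendsto_nhds_unique tendsto_const_nhds h
  intro β hβ
  rw [← hcoeff β hβ, hC, h0]
  simp

theorem tendsto_exp_ofReal_atBot : Tendsto (fun v : ℝ => Complex.exp v) atBot (𝓝 0) := by
  rw [tendsto_zero_iff_norm_tendsto_zero]
  simpa [Complex.norm_exp] using Real.tendsto_exp_atBot

theorem exists_eq_mul_of_analyticAt {k : ℂ → ℂ} (hk : AnalyticAt ℂ k 0) (h0 : k 0 = 0) :
    ∃ k', AnalyticAt ℂ k' 0 ∧ ∀ x, k x = x * k' x := by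
  obtain ⟨p, hp⟩ := hk
  refine ⟨dslope k 0, ⟨_, hp.has_fpower_series_dslope_fslope⟩, fun x => ?_⟩
  have := sub_smul_dslope k 0 x
  simpa [h0] using this.symm

/-- A finite sum `∑ v ^ β g_β(e ^ v)` that is `O(e ^ {J v})` at `-∞` has all `g_β` divisible by
`x ^ J`. -/
theorem exists_eq_pow_mul_of_isBigO {ν : ℕ} {g : ℕ → ℂ → ℂ} (hg : ∀ β < ν, AnalyticAt ℂ (g β) 0)
    {J : ℕ} (h : (fun v : ℝ => ∑ β ∈ Finset.range ν, (v : ℂ) ^ β * g β (Complex.exp v)) =O[atBot]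
      fun v => Real.exp (J * v)) :
    ∀ β < ν, ∃ k, AnalyticAt ℂ k 0 ∧ ∀ᶠ x in 𝓝 0, g β x = x ^ J * k x := by
  induction J with
  | zero => exact fun β hβ => ⟨g β, hg β hβ, by simp⟩
  | succ J ih =>
    have hmono : (fun v : ℝ => Real.exp ((J + 1 : ℕ) * v)) =O[atBot]
        fun v => Real.exp (J * v) := by
      refine Asymptotics.IsBigO.of_bound 1 ?_
      filter_upwards [eventually_le_atBot 0] with v hv
      rw [Real.norm_of_nonneg (Real.exp_pos _).le, Real.norm_of_nonneg (Real.exp_pos _).le, one_mul]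
      refine Real.exp_le_exp.2 ?_
      push_cast
      nlinarith
    have ih' := ih (h.trans hmono)
    choose! k hk hgk using ih'
    have hev : ∀ᶠ v : ℝ in atBot, ∀ β ∈ Finset.range ν,
        g β (Complex.exp v) = Complex.exp v ^ J * k β (Complex.exp v) := by
      rw [Finset.eventually_all]
      intro β hβ
      exact tendsto_exp_ofReal_atBot.eventually (hgk β (Finset.mem_range.1 hβ))
    -- After division by e^(Jv) the sum is still O(e^v). Replacing each k_β(e^v) by k_β(0) leaves a
    -- polynomial in v tending to 0, so every k_β(0) is 0 and one more factor x splits off.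
    have h1 : Tendsto (fun v : ℝ => ∑ β ∈ Finset.range ν, (v : ℂ) ^ β * k β (Complex.exp v))
        atBot (𝓝 0) := by
      have h2 : (fun v : ℝ => ∑ β ∈ Finset.range ν, (v : ℂ) ^ β * k β (Complex.exp v)) =O[atBot]
          fun v => Real.exp v := by
        have hE : (fun v : ℝ => Complex.exp (-(J * v))) =O[atBot]
            fun v : ℝ => Real.exp (-(J * v)) :=
          Asymptotics.IsBigO.of_bound 1 (Eventually.of_forall fun v => by simp [Complex.norm_exp])
        have h3 := h.mul hE
        refine (h3.congr' ?_ EventuallyEq.rfl).trans ?_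
        · filter_upwards [hev] with v hv
          rw [Finset.sum_mul]
          refine Finset.sum_congr rfl fun β hβ => ?_
          rw [hv β hβ, ← Complex.exp_nat_mul]
          have : Complex.exp (J * v) * Complex.exp (-(J * v)) = 1 := by
            rw [← Complex.exp_add]; simp
          linear_combination (v : ℂ) ^ β * k β (Complex.exp v) * this
        · refine Asymptotics.IsBigO.of_bound 1 (Eventually.of_forall fun v => ?_)
          rw [← Real.exp_add, one_mul]
          refine le_of_eq (congrArg (fun x => ‖Real.exp x‖) ?_)
          push_cast
          ring
      exact h2.trans_tendsto Real.tendsto_exp_atBot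
    have h4 : ∀ β ∈ Finset.range ν, Tendsto (fun v : ℝ =>
        (v : ℂ) ^ β * (k β (Complex.exp v) - k β 0)) atBot (𝓝 0) := by
      intro β hβ
      have hd : (fun x => k β x - k β 0) =O[𝓝 0] fun x : ℂ => x := by
        simpa using (hk β (Finset.mem_range.1 hβ)).differentiableAt.isBigO_sub
      have hd' := hd.comp_tendsto tendsto_exp_ofReal_atBot
      have h5 := (Asymptotics.isBigO_refl (fun v : ℝ => (v : ℂ) ^ β) atBot).mul hd'
      refine h5.trans_tendsto ?_
      rw [tendsto_zero_iff_norm_tendsto_zero]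
      have h6 := (Real.tendsto_pow_mul_exp_neg_atTop_nhds_zero β).comp tendsto_neg_atBot_atTop
      refine (h6.norm.congr fun v => ?_).trans (by simp)
      simp [Complex.norm_exp]
    have h7 : Tendsto (fun v : ℝ => ∑ β ∈ Finset.range ν, (v : ℂ) ^ β * k β 0) atBot (𝓝 0) := by
      have h8 := h1.sub (tendsto_finsetSum _ h4)
      simp only [Finset.sum_const_zero, sub_zero] at h8
      refine h8.congr fun v => ?_
      rw [← Finset.sum_sub_distrib]
      exact Finset.sum_congr rfl fun β _ => by ring
    have h9 := eq_zero_of_tendsto_sum_pow_atBot h7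
    intro β hβ
    obtain ⟨k', hk', hkk'⟩ := exists_eq_mul_of_analyticAt (hk β hβ) (h9 β hβ)
    refine ⟨k', hk', ?_⟩
    filter_upwards [hgk β hβ] with x hx
    rw [hx, hkk', pow_succ]
    ring

/-- A nonzero germ has finite order of vanishing. Asking only for arbitrarily large n suits
divisibility by powers such as Jm + N. -/
theorem eventually_eq_zero_of_forall_pow {g : ℂ → ℂ} (hg : AnalyticAt ℂ g 0)
    (h : ∀ J : ℕ, ∃ n ≥ J, ∃ k, AnalyticAt ℂ k 0 ∧ ∀ᶠ x in 𝓝 0, g x = x ^ n * k x) :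
    ∀ᶠ x in 𝓝 0, g x = 0 := by
  by_contra hne
  obtain ⟨n, g₀, hg₀, hg₀0, hgn⟩ := hg.exists_eventuallyEq_pow_smul_nonzero_iff.2 hne
  obtain ⟨n', hn', k, hk, hgk⟩ := h (n + 1)
  have h1 : ∀ᶠ x in 𝓝[≠] (0 : ℂ), g₀ x = x ^ (n' - n) * k x := by
    rw [eventually_nhdsWithin_iff]
    filter_upwards [hgn, hgk] with x h1 h2 hx
    have hx : x ≠ 0 := hx
    rw [h1, sub_zero, smul_eq_mul] at h2
    have h3 : x ^ n' = x ^ n * x ^ (n' - n) := by rw [← pow_add]; congr 1; omega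
    rw [h3, mul_assoc] at h2
    exact mul_left_cancel₀ (pow_ne_zero n hx) h2
  have h2 : Tendsto g₀ (𝓝[≠] 0) (𝓝 (g₀ 0)) := hg₀.continuousAt.tendsto.mono_left nhdsWithin_le_nhds
  have h3 : Tendsto (fun x : ℂ => x ^ (n' - n) * k x) (𝓝[≠] 0) (𝓝 ((0 : ℂ) ^ (n' - n) * k 0)) := by
    have : ContinuousAt (fun x : ℂ => x ^ (n' - n) * k x) 0 :=
      ContinuousAt.mul (by fun_prop) hk.continuousAt
    exact this.tendsto.mono_left nhdsWithin_le_nhds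
  have h4 := tendsto_nhds_unique (h2.congr' h1) h3
  rw [zero_pow (by omega), zero_mul] at h4
  exact hg₀0 h4

/-- If a function in log-Puiseux form has a Taylor expansion in `e ^ w` to all orders along the
negative real axis, then it is an analytic function of `e ^ w`. -/
theorem HasLogPuiseuxForm.exists_analyticAt {f : ℂ → ℂ} {m N ν : ℕ} {g : ℕ → ℂ → ℂ} (hm : 0 < m)
    (h : HasLogPuiseuxForm f m N ν g) {t : ℕ → ℂ}
    (ht : ∀ J : ℕ, (fun v : ℝ => f v - ∑ j ∈ Finset.range J, t j * Complex.exp (j * v)) =O[atBot]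
      fun v => Real.exp (J * v)) :
    ∃ k : ℂ → ℂ, AnalyticAt ℂ k 0 ∧ ∃ c : ℝ, ∀ w : ℂ, w.re < c → f w = k (Complex.exp w) := by
  obtain ⟨han, c₀, hc₀⟩ := h
  have hm0 : (0 : ℝ) < m := by exact_mod_cast hm
  have hmC : (m : ℂ) ≠ 0 := by exact_mod_cast hm.ne'
  -- Put w = mv and x = e^v; the factor m^β comes from w^β.
  set G : ℕ → ℂ → ℂ := fun β x => if β < ν then (m : ℂ) ^ β * g β x else 0 with hG
  have hGan : ∀ β, AnalyticAt ℂ (G β) 0 := fun β => by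
    by_cases hβ : β < ν
    · simp only [hG, hβ, if_true]; exact analyticAt_const.mul (han β)
    · simp only [hG, hβ, if_false]; exact analyticAt_const
  -- After multiplication by x^N the Taylor term e^(jw) reads x^(jm + N); it has no logarithm, so it
  -- belongs to β = 0.
  set H : ℕ → ℕ → ℂ → ℂ := fun J β x =>
    G β x - if β = 0 then ∑ j ∈ Finset.range J, t j * x ^ (j * m + N) else 0 with hH
  have hHan : ∀ J β, AnalyticAt ℂ (H J β) 0 := fun J β => by
    by_cases hβ : β = 0
    · simp only [hH, hβ, if_true]
      exact (hGan 0).sub (Finset.analyticAt_fun_sum _ fun j _ =>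
        analyticAt_const.mul (analyticAt_id.pow _))
    · simp only [hH, hβ, if_false]; exact (hGan β).sub analyticAt_const
  -- The range ν + 1 contains β = 0 even when ν = 0; for ν > 0 the additional summand is zero.
  have hO : ∀ J : ℕ, (fun v : ℝ => ∑ β ∈ Finset.range (ν + 1),
      (v : ℂ) ^ β * H J β (Complex.exp v)) =O[atBot] fun v => Real.exp ((J * m + N : ℕ) * v) := by
    intro J
    have htend : Tendsto (fun v : ℝ => (m : ℝ) * v) atBot atBot :=
      tendsto_id.const_mul_atBot hm0
    have h1 := (ht J).comp_tendsto htend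
    have hE : (fun v : ℝ => Complex.exp (N * v)) =O[atBot] fun v : ℝ => Real.exp (N * v) :=
      Asymptotics.IsBigO.of_bound 1 (Eventually.of_forall fun v => by simp [Complex.norm_exp])
    refine (h1.mul hE).congr' ?_ (Eventually.of_forall fun v => ?_)
    · filter_upwards [htend.eventually_lt_atBot c₀] with v hv
      have hf := hc₀ (((m : ℝ) * v : ℝ) : ℂ) (by simpa using hv)
      have e1 : ((((m : ℝ) * v : ℝ) : ℂ)) / m = v := by push_cast; field_simp
      rw [e1] at hf
      simp only [Function.comp_apply]
      rw [hf, Finset.sum_range_succ, sub_mul]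
      have e2 : H J ν (Complex.exp v) =
          - if ν = 0 then ∑ j ∈ Finset.range J, t j * Complex.exp v ^ (j * m + N) else 0 := by
        simp [hH, hG]
      have e3 : ∑ β ∈ Finset.range ν, (v : ℂ) ^ β * H J β (Complex.exp v) =
          ∑ β ∈ Finset.range ν, ((m : ℂ) * v) ^ β * g β (Complex.exp v) -
          if ν = 0 then 0 else ∑ j ∈ Finset.range J, t j * Complex.exp v ^ (j * m + N) := by
        rcases Nat.eq_zero_or_pos ν with h0 | h0
        · simp [h0]
        · rw [if_neg h0.ne']
          obtain ⟨ν', rfl⟩ := Nat.exists_eq_succ_of_ne_zero h0.ne'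
          rw [Finset.sum_range_succ', Finset.sum_range_succ' _ ν']
          have e4 : ∀ β ∈ Finset.range ν', (v : ℂ) ^ (β + 1) * H J (β + 1) (Complex.exp v) =
              ((m : ℂ) * v) ^ (β + 1) * g (β + 1) (Complex.exp v) := by
            intro β hβ
            have : β < ν' := Finset.mem_range.1 hβ
            simp only [hH, hG, Nat.succ_eq_add_one, add_lt_add_iff_right, this, if_true,
              Nat.add_eq_zero_iff, one_ne_zero, and_false, if_false, sub_zero]
            rw [mul_pow]
            ring
          rw [Finset.sum_congr rfl e4]
          simp only [hH, hG, Nat.succ_eq_add_one, if_true, pow_zero, one_mul, Nat.zero_lt_succ]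
          ring
      have e5 : Complex.exp (-(N * (v : ℂ))) * Complex.exp (N * v) = 1 := by
        rw [← Complex.exp_add]; simp
      have e6 : (∑ j ∈ Finset.range J, t j * Complex.exp (j * (((m : ℝ) * v : ℝ) : ℂ))) *
          Complex.exp (N * v) = ∑ j ∈ Finset.range J, t j * Complex.exp v ^ (j * m + N) := by
        rw [Finset.sum_mul]
        refine Finset.sum_congr rfl fun j _ => ?_
        rw [mul_assoc, ← Complex.exp_add, ← Complex.exp_nat_mul]
        congr 2
        push_cast
        ring
      rw [e6, e3, e2]
      have e7 : ((((m : ℝ) * v : ℝ) : ℂ)) = (m : ℂ) * v := by push_cast; rfl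
      rw [e7]
      split_ifs with h0
      · subst h0
        simp
      · linear_combination (∑ β ∈ Finset.range ν, ((m : ℂ) * v) ^ β * g β (Complex.exp v)) * e5
    · simp only [Function.comp_apply]
      rw [← Real.exp_add]
      congr 1
      push_cast
      ring
  have hdiv : ∀ J, ∀ β < ν + 1, ∃ k, AnalyticAt ℂ k 0 ∧
      ∀ᶠ x in 𝓝 0, H J β x = x ^ (J * m + N) * k x := fun J =>
    exists_eq_pow_mul_of_isBigO (fun β _ => hHan J β) (hO J)
  -- For β ≠ 0 nothing was subtracted, so `G β` itself is divisible by arbitrarily high powers of x: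
  -- the logarithms disappear.
  have hzero : ∀ β ∈ Finset.range ν, β ≠ 0 → ∀ᶠ x in 𝓝 0, g β x = 0 := by
    intro β hβ hβ0
    have hβ := Finset.mem_range.1 hβ
    have hmβ : (m : ℂ) ^ β ≠ 0 := pow_ne_zero _ hmC
    have : ∀ᶠ x in 𝓝 0, G β x = 0 := by
      refine eventually_eq_zero_of_forall_pow (hGan β) fun J => ⟨J * m + N, ?_, ?_⟩
      · nlinarith
      · obtain ⟨k, hk, hkx⟩ := hdiv J β (by omega)
        refine ⟨k, hk, hkx.mono fun x hx => ?_⟩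
        rw [← hx]
        simp [hH, hβ0]
    refine this.mono fun x hx => ?_
    simp only [hG, hβ, if_true] at hx
    exact (mul_eq_zero.1 hx).resolve_left hmβ
  choose k hkan hkx using fun J => hdiv J 0 (Nat.succ_pos ν)
  set u : ℂ := Complex.exp (2 * Real.pi * Complex.I / m) with hu
  have hum : u ^ m = 1 := by
    rw [hu, ← Complex.exp_nat_mul, mul_div_cancel₀ _ hmC, Complex.exp_two_pi_mul_I]
  have hrel : ∀ J : ℕ, ∀ᶠ x in 𝓝 (0 : ℂ), x ≠ 0 →
      k 0 x = ∑ j ∈ Finset.range J, t j * x ^ (j * m) + x ^ (J * m) * k J x := by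
    intro J
    filter_upwards [hkx 0, hkx J] with x h0 hJ hx
    simp only [hH, if_true, Finset.range_zero, Finset.sum_empty, sub_zero, zero_mul,
      zero_add] at h0 hJ
    rw [h0] at hJ
    have hxN : x ^ N ≠ 0 := pow_ne_zero _ hx
    have e : ∑ j ∈ Finset.range J, t j * x ^ (j * m + N) =
        x ^ N * ∑ j ∈ Finset.range J, t j * x ^ (j * m) := by
      rw [Finset.mul_sum]
      exact Finset.sum_congr rfl fun j _ => by rw [pow_add]; ring
    rw [e] at hJ
    apply mul_left_cancel₀ hxN
    rw [pow_add] at hJ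
    linear_combination hJ
  have hmul : Tendsto (fun x : ℂ => u * x) (𝓝 0) (𝓝 0) := by
    have : ContinuousAt (fun x : ℂ => u * x) 0 := by fun_prop
    simpa [ContinuousAt] using this
  have hcomp : ∀ J, AnalyticAt ℂ (fun x => k J (u * x)) 0 := fun J => by
    refine AnalyticAt.fun_comp (g := k J) (f := fun x => u * x) ?_ (analyticAt_const.mul analyticAt_id)
    simpa using hkan J
  -- The Taylor part involves only x^m, which x ↦ ux preserves, so the difference vanishes to all
  -- orders. This invariance is the 2πi-periodicity of f and removes fractional powers.
  have hinv : ∀ᶠ x in 𝓝 (0 : ℂ), k 0 (u * x) - k 0 x = 0 := by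
    refine eventually_eq_zero_of_forall_pow ((hcomp 0).sub (hkan 0)) fun J =>
      ⟨(J + 1) * m, by nlinarith, fun x => k (J + 1) (u * x) - k (J + 1) x,
        (hcomp _).sub (hkan _), ?_⟩
    filter_upwards [hrel (J + 1), hmul.eventually (hrel (J + 1))] with x h1 h2
    rcases eq_or_ne x 0 with rfl | hx
    · rw [zero_pow (Nat.mul_ne_zero (Nat.succ_ne_zero J) hm.ne')]
      simp
    · rw [h1 hx, h2 (mul_ne_zero (Complex.exp_ne_zero _) hx)]
      have e : ∀ j : ℕ, (u * x) ^ (j * m) = x ^ (j * m) := fun j => by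
        rw [mul_pow, mul_comm j m, pow_mul u, hum, one_pow, one_mul]
      simp only [e]
      ring
  have hall : ∀ᶠ x in 𝓝 (0 : ℂ), (∀ β ∈ Finset.range ν, β ≠ 0 → g β x = 0) ∧
      H 0 0 x = x ^ (0 * m + N) * k 0 x ∧ k 0 (u * x) - k 0 x = 0 ∧
      DifferentiableAt ℂ (k 0) x ∧ ‖k 0 x‖ ≤ ‖k 0 0‖ + 1 := by
    refine Eventually.and ?_ ((hkx 0).and (hinv.and (Eventually.and ?_ ?_)))
    · rw [Finset.eventually_all]
      intro β hβ
      by_cases hβ0 : β = 0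
      · exact Eventually.of_forall fun x h => absurd hβ0 h
      · exact (hzero β hβ hβ0).mono fun x hx _ => hx
    · exact (hkan 0).eventually_analyticAt.mono fun x hx => hx.differentiableAt
    · exact ((hkan 0).continuousAt.norm.eventually_lt continuousAt_const (by simp)).mono
        fun x hx => hx.le
  obtain ⟨c₁, hc₁⟩ := exists_re_lt_of_eventually hall hm
  set c := min c₀ c₁ with hc
  have hform : ∀ w : ℂ, w.re < c → f w = k 0 (Complex.exp (w / m)) := by
    intro w hw
    obtain ⟨h1, h2, -⟩ := hc₁ w (hw.trans_le (min_le_right _ _))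
    rw [hc₀ w (hw.trans_le (min_le_left _ _))]
    have e1 : ∑ β ∈ Finset.range ν, w ^ β * g β (Complex.exp (w / m)) =
        H 0 0 (Complex.exp (w / m)) := by
      simp only [hH, hG, if_true, Finset.range_zero, Finset.sum_empty, sub_zero]
      split_ifs with h0
      · rw [Finset.sum_eq_single_of_mem 0 (Finset.mem_range.2 h0)]
        · simp
        · intro β hβ hβ0
          rw [h1 β hβ hβ0, mul_zero]
      · have : ν = 0 := by omega
        simp [this]
    rw [e1, h2, zero_mul, zero_add, ← mul_assoc, ← Complex.exp_nat_mul, ← Complex.exp_add]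
    simp
  have hd : DifferentiableOn ℂ f {w | w.re < c} := by
    have hd' : DifferentiableOn ℂ (fun w => k 0 (Complex.exp (w / m))) {w | w.re < c} := by
      intro w hw
      refine DifferentiableAt.differentiableWithinAt ?_
      exact DifferentiableAt.comp (g := k 0) w
        (hc₁ w (lt_of_lt_of_le hw (min_le_right _ _))).2.2.2.1 (by fun_prop)
    exact hd'.congr fun w hw => hform w hw
  have hper : ∀ w : ℂ, w.re < c → f (w + 2 * Real.pi * Complex.I) = f w := by
    intro w hw
    rw [hform w hw, hform (w + 2 * Real.pi * Complex.I) (by simpa using hw)]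
    have e : Complex.exp ((w + 2 * Real.pi * Complex.I) / m) = u * Complex.exp (w / m) := by
      rw [add_div, Complex.exp_add, hu, mul_comm]
    rw [e]
    exact sub_eq_zero.1 (hc₁ w (hw.trans_le (min_le_right _ _))).2.2.1
  have hbd : ∀ w : ℂ, w.re < c → |w.im| ≤ Real.pi →
      ‖f w‖ ≤ (‖k 0 0‖ + 1) * Real.exp (-((0 : ℕ) * w.re)) := by
    intro w hw _
    rw [hform w hw]
    simpa using (hc₁ w (hw.trans_le (min_le_right _ _))).2.2.2.2
  obtain ⟨k', hk', hk'w⟩ := exists_analyticAt_of_periodic hd hper hbd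
  exact ⟨k', hk', c, fun w hw => by simpa using hk'w w hw⟩

/-! ### The slit disk -/

/-- The slit at l is exactly the branch cut of the principal power and logarithm of 1 - z/l. -/
theorem ne_ofReal_mul_iff {l z : ℂ} (hl : l ≠ 0) :
    (∀ t : ℝ, 1 ≤ t → z ≠ (t : ℂ) * l) ↔ 1 - z / l ∈ Complex.slitPlane := by
  constructor
  · intro h
    by_contra hn
    rw [Complex.mem_slitPlane_iff, not_or, not_lt, not_not] at hn
    have him : (z / l).im = 0 := by simpa using hn.2
    have hre : 1 ≤ (z / l).re := by simpa using hn.1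
    refine h (z / l).re hre ?_
    have : (((z / l).re : ℝ) : ℂ) = z / l := Complex.ext (by simp) (by simp [him])
    rw [this, div_mul_cancel₀ z hl]
  · rintro h t ht rfl
    rw [mul_div_cancel_right₀ _ hl, Complex.mem_slitPlane_iff] at h
    simp at h
    linarith

theorem mem_slitDisk_iff {r ε : ℝ} {L : Finset ℂ} (hL : ∀ l ∈ L, l ≠ 0) {z : ℂ} :
    z ∈ slitDisk r ε L ↔ ‖z‖ < r + ε ∧ ∀ l ∈ L, 1 - z / l ∈ Complex.slitPlane := by
  simp only [slitDisk, Set.mem_ofPred_eq]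
  exact and_congr_right fun _ => forall₂_congr fun l hl => ne_ofReal_mul_iff (hL l hl)

theorem isOpen_slitDisk {r ε : ℝ} {L : Finset ℂ} (hL : ∀ l ∈ L, l ≠ 0) :
    IsOpen (slitDisk r ε L) := by
  have : slitDisk r ε L = {z | ‖z‖ < r + ε} ∩
      ⋂ l ∈ L, (fun z : ℂ => 1 - z / l) ⁻¹' Complex.slitPlane := by
    ext z
    rw [mem_slitDisk_iff hL]
    simp
  rw [this]
  exact (isOpen_lt continuous_norm continuous_const).inter
    (isOpen_biInter_finset fun l _ => Complex.isOpen_slitPlane.preimage (by fun_prop))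

theorem one_sub_div_mem_slitPlane {r : ℝ} {p z : ℂ} (hr : 0 < r) (hp : ‖p‖ = r)
    (hz : ‖z‖ < r) : 1 - z / p ∈ Complex.slitPlane := by
  rw [sub_eq_add_neg]
  refine Complex.mem_slitPlane_of_norm_lt_one ?_
  rw [norm_neg, norm_div, hp, div_lt_one hr]
  exact hz

theorem ball_subset_slitDisk {r ε : ℝ} {L : Finset ℂ} (hr : 0 < r) (hε : 0 < ε)
    (hLr : ∀ p ∈ L, ‖p‖ = r) : Metric.ball 0 r ⊆ slitDisk r ε L := by
  intro z hz
  have hz' : ‖z‖ < r := by simpa using hz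
  rw [mem_slitDisk_iff fun l hl => by rw [← norm_pos_iff, hLr l hl]; exact hr]
  exact ⟨by linarith, fun l hl => one_sub_div_mem_slitPlane hr (hLr l hl) hz'⟩

theorem one_sub_div_mem_slitPlane_of_ne {r : ℝ} {p q : ℂ} (hr : 0 < r) (hp : ‖p‖ = r)
    (hq : ‖q‖ ≤ r) (hpq : q ≠ p) : 1 - q / p ∈ Complex.slitPlane := by
  have hp0 : p ≠ 0 := by rw [← norm_pos_iff, hp]; exact hr
  have h1 : ‖q / p‖ ≤ 1 := by rw [norm_div, hp, div_le_one hr]; exact hq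
  rw [Complex.mem_slitPlane_iff]
  by_contra hn
  rw [not_or, not_lt, not_not] at hn
  have him : (q / p).im = 0 := by simpa using hn.2
  have hre : 1 ≤ (q / p).re := by simpa using hn.1
  have hre' : (q / p).re = 1 := le_antisymm ((Complex.re_le_norm _).trans h1) hre
  have : q / p = 1 := Complex.ext (by simp [hre']) (by simp [him])
  exact hpq ((div_eq_one_iff_eq hp0).1 this)

theorem eventually_mem_slitDisk {r ε : ℝ} {L : Finset ℂ} (hr : 0 < r) (hε : 0 < ε)
    (hLr : ∀ p ∈ L, ‖p‖ = r) {p : ℂ} (hp : p ∈ L) :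
    ∀ᶠ z in 𝓝 p, 1 - z / p ∈ Complex.slitPlane → z ∈ slitDisk r ε L := by
  have hL0 : ∀ l ∈ L, l ≠ 0 := fun l hl => by rw [← norm_pos_iff, hLr l hl]; exact hr
  have h1 : ∀ᶠ z in 𝓝 p, ‖z‖ < r + ε :=
    continuous_norm.continuousAt.eventually_lt continuousAt_const (by rw [hLr p hp]; linarith)
  have h2 : ∀ᶠ z in 𝓝 p, ∀ l ∈ L, l ≠ p → 1 - z / l ∈ Complex.slitPlane := by
    rw [Finset.eventually_all]
    intro l hl
    by_cases hlp : l = p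
    · exact Eventually.of_forall fun z h => absurd hlp h
    · have hc : ContinuousAt (fun z : ℂ => 1 - z / l) p := by fun_prop
      exact (hc.eventually_mem (Complex.isOpen_slitPlane.mem_nhds
        (one_sub_div_mem_slitPlane_of_ne hr (hLr l hl) (hLr p hp).le (Ne.symm hlp)))).mono
        fun z hz _ => hz
  filter_upwards [h1, h2] with z hz1 hz2 hz3
  rw [mem_slitDisk_iff hL0]
  refine ⟨hz1, fun l hl => ?_⟩
  by_cases hlp : l = p
  · rw [hlp]; exact hz3
  · exact hz2 l hl hlp

/-! ### Darboux's method -/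

theorem iteratedDeriv_eq_of_hasSum {a : ℕ → ℂ} {G : ℂ → ℂ}
    (h : ∀ᶠ z in 𝓝 (0 : ℂ), HasSum (fun n : ℕ => a n * z ^ n) (G z)) (n : ℕ) :
    iteratedDeriv n G 0 = n.factorial * a n := by
  have h1 : HasFPowerSeriesAt G (FormalMultilinearSeries.ofScalars ℂ a) 0 := by
    rw [hasFPowerSeriesAt_iff]
    filter_upwards [h] with z hz
    simpa [FormalMultilinearSeries.coeff_ofScalars, mul_comm] using hz
  have h2 := h1.eq_formalMultilinearSeries h1.analyticAt.hasFPowerSeriesAt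
  have h3 := congrArg (fun p => FormalMultilinearSeries.coeff p n) h2
  simp only [FormalMultilinearSeries.coeff_ofScalars] at h3
  rw [h3]
  have : (n.factorial : ℂ) ≠ 0 := by exact_mod_cast n.factorial_ne_zero
  field_simp

/-- Cauchy's estimate for the J-th derivative, whose coefficients carry the falling factorial of n
of length J, comparable to n^J. -/
theorem isBigO_coeff_of_iteratedDeriv_bounded {b : ℕ → ℂ} {R : ℂ → ℂ} {r C : ℝ} (hr : 0 < r)
    (hb : ∀ᶠ z in 𝓝 (0 : ℂ), HasSum (fun n : ℕ => b n * z ^ n) (R z))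
    (hR : DifferentiableOn ℂ R (Metric.ball 0 r)) {J : ℕ}
    (hC : ∀ z ∈ Metric.ball (0 : ℂ) r, ‖iteratedDeriv J R z‖ ≤ C) :
    (fun n : ℕ => b n * (r : ℂ) ^ n) =O[atTop] fun n : ℕ => ((n : ℝ) ^ J)⁻¹ := by
  have hC0 : 0 ≤ C := (norm_nonneg _).trans (hC 0 (by simpa using hr))
  have hd : DifferentiableOn ℂ (iteratedDeriv J R) (Metric.ball 0 r) := by
    rw [iteratedDeriv_eq_iterate]
    intro z hz
    exact ((hR.analyticAt (Metric.isOpen_ball.mem_nhds hz)).iterated_deriv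
      J).differentiableAt.differentiableWithinAt
  have hcauchy : ∀ n : ℕ, J ≤ n →
      ‖iteratedDeriv n R 0‖ ≤ (n - J).factorial * C / r ^ (n - J) := by
    intro n hn
    -- The derivative is controlled only on the open disk, so Cauchy's estimate is used on circles ρ
    -- < r and ρ tends to r.
    have hlim : Tendsto (fun ρ : ℝ => (n - J).factorial * C / ρ ^ (n - J)) (𝓝[<] r)
        (𝓝 ((n - J).factorial * C / r ^ (n - J))) := by
      have : ContinuousAt (fun ρ : ℝ => (n - J).factorial * C / ρ ^ (n - J)) r :=
        continuousAt_const.div (by fun_prop) (pow_ne_zero _ hr.ne')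
      exact this.tendsto.mono_left nhdsWithin_le_nhds
    refine ge_of_tendsto hlim ?_
    filter_upwards [Ioo_mem_nhdsLT hr] with ρ hρ
    have hsub : Metric.closedBall (0 : ℂ) ρ ⊆ Metric.ball 0 r :=
      Metric.closedBall_subset_ball hρ.2
    have h1 := Complex.norm_iteratedDeriv_le_of_forall_mem_sphere_norm_le (n - J) hρ.1
      ((hd.mono hsub).diffContOnCl_ball (le_refl _))
      (fun z hz => hC z (hsub (Metric.sphere_subset_closedBall hz)))
    have h2 : iteratedDeriv (n - J) (iteratedDeriv J R) = iteratedDeriv n R := by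
      rw [iteratedDeriv_eq_iterate, iteratedDeriv_eq_iterate, iteratedDeriv_eq_iterate,
        ← Function.iterate_add_apply, Nat.sub_add_cancel hn]
    rwa [h2] at h1
  refine Asymptotics.IsBigO.of_bound (C * r ^ J * 2 ^ J) ?_
  filter_upwards [eventually_ge_atTop (2 * J + 1)] with n hn
  have hJn : J ≤ n := by omega
  have hn0 : (0 : ℝ) < n := by exact_mod_cast (by omega : 0 < n)
  have h1 := hcauchy n hJn
  rw [iteratedDeriv_eq_of_hasSum hb, norm_mul, Complex.norm_natCast] at h1
  have h2 : ((n - J).factorial : ℝ) * (n.descFactorial J : ℝ) = n.factorial := by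
    exact_mod_cast Nat.factorial_mul_descFactorial hJn
  have h3 : ((n : ℝ) / 2) ^ J ≤ n.descFactorial J := by
    have h4 : (((n + 1 - J : ℕ) : ℝ)) ^ J ≤ n.descFactorial J := by
      exact_mod_cast Nat.pow_sub_le_descFactorial n J
    refine le_trans (pow_le_pow_left₀ (by positivity) ?_ J) h4
    rw [div_le_iff₀ (by norm_num)]
    exact_mod_cast (by omega : n ≤ (n + 1 - J) * 2)
  have hf : (0 : ℝ) < (n - J).factorial := by exact_mod_cast (n - J).factorial_pos
  rw [← h2, mul_assoc, mul_div_assoc, mul_le_mul_iff_right₀ hf, le_div_iff₀ (by positivity)] at h1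
  have hrn : r ^ n = r ^ (n - J) * r ^ J := by rw [← pow_add, Nat.sub_add_cancel hJn]
  rw [norm_mul, norm_pow, Complex.norm_real, Real.norm_of_nonneg hr.le, norm_inv, norm_pow,
    Real.norm_of_nonneg hn0.le, ← div_eq_mul_inv, le_div_iff₀ (by positivity), hrn]
  have h5 : (n : ℝ) ^ J = 2 ^ J * ((n : ℝ) / 2) ^ J := by rw [← mul_pow]; congr 1; ring
  rw [h5]
  have h6 : ((n : ℝ) / 2) ^ J * ‖b n‖ * r ^ (n - J) ≤ C := by
    refine le_trans ?_ h1
    gcongr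
  calc ‖b n‖ * (r ^ (n - J) * r ^ J) * (2 ^ J * ((n : ℝ) / 2) ^ J)
      = (((n : ℝ) / 2) ^ J * ‖b n‖ * r ^ (n - J)) * (r ^ J * 2 ^ J) := by ring
    _ ≤ C * (r ^ J * 2 ^ J) := by gcongr
    _ = _ := by ring

theorem add_mem_slitPlane_of_norm_le {X Y : ℂ} (hX : 0 < X.re) (hY : ‖Y‖ ≤ ‖X‖ / 2) :
    X + Y ∈ Complex.slitPlane := by
  by_contra hn
  rw [Complex.mem_slitPlane_iff, not_or, not_lt, not_not, Complex.add_re, Complex.add_im] at hn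
  have h1 : ‖X‖ ^ 2 ≤ ‖Y‖ ^ 2 := by
    have him : Y.im = -X.im := by linarith [hn.2]
    have hre : X.re * X.re ≤ Y.re * Y.re := by nlinarith [hn.1]
    rw [Complex.sq_norm, Complex.sq_norm, Complex.normSq_apply, Complex.normSq_apply, him]
    linarith
  have h2 : 0 < ‖X‖ := norm_pos_iff.2 fun h => by simp [h] at hX
  nlinarith [norm_nonneg Y]

/-- Cauchy's estimate on the disk of radius |z - p|/2 about z. It may leave |z| < r but avoids the
slit, and F is O(|z - p|^J) on it, so the powers of |z - p| cancel. -/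
theorem iteratedDeriv_bounded_near_singularity {r : ℝ} (hr : 0 < r) {p : ℂ} (hp : ‖p‖ = r)
    {F : ℂ → ℂ} {J : ℕ} {C η : ℝ}
    (hd : ∀ z, ‖1 - z / p‖ < η → 1 - z / p ∈ Complex.slitPlane → DifferentiableAt ℂ F z)
    (hF : ∀ z, ‖1 - z / p‖ < η → 1 - z / p ∈ Complex.slitPlane → ‖F z‖ ≤ C * ‖1 - z / p‖ ^ J)
    {z : ℂ} (hz : ‖z‖ < r) (hzη : ‖1 - z / p‖ < η / 2) :
    ‖iteratedDeriv J F z‖ ≤ J.factorial * |C| * 3 ^ J / r ^ J := by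
  have hp0 : p ≠ 0 := by rw [← norm_pos_iff, hp]; exact hr
  set X := 1 - z / p with hX
  have hXre : 0 < X.re := by
    have h1 : ‖z / p‖ < 1 := by rw [norm_div, hp, div_lt_one hr]; exact hz
    have h2 := (Complex.re_le_norm (z / p)).trans_lt h1
    rw [hX, Complex.sub_re, Complex.one_re]
    linarith
  have hXpos : 0 < ‖X‖ := norm_pos_iff.2 fun h => by simp [h] at hXre
  set ρ := r * (‖X‖ / 2) with hρ
  have hρ0 : 0 < ρ := by positivity
  have hball : ∀ y ∈ Metric.closedBall z ρ, ‖1 - y / p‖ ≤ 3 / 2 * ‖X‖ ∧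
      1 - y / p ∈ Complex.slitPlane := by
    intro y hy
    have h1 : ‖-(y - z) / p‖ ≤ ‖X‖ / 2 := by
      rw [norm_div, norm_neg, hp, div_le_iff₀ hr, mul_comm]
      simpa [dist_eq_norm] using hy
    have h2 : 1 - y / p = X + -(y - z) / p := by rw [hX]; field_simp; ring
    rw [h2]
    refine ⟨(norm_add_le _ _).trans (by linarith), add_mem_slitPlane_of_norm_le hXre h1⟩
  have hdiff : DifferentiableOn ℂ F (Metric.closedBall z ρ) := fun y hy =>
    (hd y ((hball y hy).1.trans_lt (by linarith)) (hball y hy).2).differentiableWithinAt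
  have h := Complex.norm_iteratedDeriv_le_of_forall_mem_sphere_norm_le (c := z)
    (C := |C| * (3 / 2 * ‖X‖) ^ J) J hρ0
    (hdiff.diffContOnCl_ball (le_refl _)) (fun y hy => by
      obtain ⟨h1, h2⟩ := hball y (Metric.sphere_subset_closedBall hy)
      refine (hF y (h1.trans_lt (by linarith)) h2).trans ?_
      gcongr
      exact le_abs_self C)
  refine h.trans (le_of_eq ?_)
  rw [hρ, mul_pow, mul_pow, div_pow, div_pow]
  field_simp

/-- **Darboux's method**: if near each `p ∈ L` the function `R` is the sum of an analytic function
and of a function that is `O(|z - p| ^ J)` off the slit, then its Taylor coefficients are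
`O(n ^ (-J) r ^ (-n))`. -/
theorem isBigO_coeff_of_local_bounds {b : ℕ → ℂ} {R : ℂ → ℂ} {r ε : ℝ} (hr : 0 < r) (hε : 0 < ε)
    {L : Finset ℂ} (hLr : ∀ p ∈ L, ‖p‖ = r)
    (hb : ∀ᶠ z in 𝓝 (0 : ℂ), HasSum (fun n : ℕ => b n * z ^ n) (R z))
    (hR : DifferentiableOn ℂ R (slitDisk r ε L)) {J : ℕ}
    (hloc : ∀ p ∈ L, ∃ A : ℂ → ℂ, AnalyticAt ℂ A p ∧ ∃ C η : ℝ, 0 < η ∧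
      ∀ z, ‖1 - z / p‖ < η → 1 - z / p ∈ Complex.slitPlane →
        ‖R z - A z‖ ≤ C * ‖1 - z / p‖ ^ J) :
    (fun n : ℕ => b n * (r : ℂ) ^ n) =O[atTop] fun n : ℕ => ((n : ℝ) ^ J)⁻¹ := by
  have hL0 : ∀ l ∈ L, l ≠ 0 := fun l hl => by rw [← norm_pos_iff, hLr l hl]; exact hr
  have hopen := isOpen_slitDisk (r := r) (ε := ε) hL0
  have hRan : ∀ z ∈ slitDisk r ε L, AnalyticAt ℂ R z := fun z hz =>
    hR.analyticAt (hopen.mem_nhds hz)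
  have hcontOf : ∀ {F : ℂ → ℂ} {z : ℂ}, AnalyticAt ℂ F z →
      ContinuousAt (iteratedDeriv J F) z := fun {F z} hF => by
    rw [iteratedDeriv_eq_iterate]; exact (hF.iterated_deriv J).continuousAt
  have hbddOf : ∀ {F : ℂ → ℂ} {z : ℂ}, AnalyticAt ℂ F z →
      ∀ᶠ y in 𝓝 z, ‖iteratedDeriv J F y‖ ≤ ‖iteratedDeriv J F z‖ + 1 := fun {F z} hF =>
    ((hcontOf hF).norm.eventually_lt continuousAt_const (by simp)).mono fun y hy => hy.le
  obtain ⟨C, hC⟩ : ∃ C : ℝ, ∀ z ∈ Metric.closedBall (0 : ℂ) r ∩ Metric.ball 0 r,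
      ‖iteratedDeriv J R z‖ ≤ C := by
    -- By compactness of the closed disk, the J-th derivative need only be bounded locally: near
    -- points of L from the local hypothesis, near all others by analyticity.
    refine (isCompact_closedBall (0 : ℂ) r).induction_on
      (p := fun s => ∃ C : ℝ, ∀ z ∈ s ∩ Metric.ball 0 r, ‖iteratedDeriv J R z‖ ≤ C)
      ⟨0, by simp⟩ ?_ ?_ ?_
    · rintro s t hst ⟨C, hC⟩
      exact ⟨C, fun z hz => hC z ⟨hst hz.1, hz.2⟩⟩
    · rintro s t ⟨C, hC⟩ ⟨D, hD⟩
      refine ⟨max C D, fun z hz => ?_⟩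
      rcases hz.1 with h | h
      · exact (hC z ⟨h, hz.2⟩).trans (le_max_left _ _)
      · exact (hD z ⟨h, hz.2⟩).trans (le_max_right _ _)
    · intro p hpr
      have hpr : ‖p‖ ≤ r := by simpa using hpr
      by_cases hp : p ∈ L
      · obtain ⟨A, hA, C, η, hη, hCη⟩ := hloc p hp
        have hp0 := hL0 p hp
        have hev : ∀ᶠ z in 𝓝 p, AnalyticAt ℂ A z ∧
            (1 - z / p ∈ Complex.slitPlane → z ∈ slitDisk r ε L) :=
          hA.eventually_analyticAt.and (eventually_mem_slitDisk hr hε hLr hp)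
        obtain ⟨σ, hσ, hball⟩ := Metric.eventually_nhds_iff.1 hev
        have hdist : ∀ z : ℂ, dist z p = r * ‖1 - z / p‖ := fun z => by
          rw [dist_comm, dist_eq_norm, ← hLr p hp, ← norm_mul]
          congr 1
          field_simp
        set η' := min η (σ / r) with hη'
        have hη'0 : 0 < η' := lt_min hη (by positivity)
        have hnear : ∀ z, ‖1 - z / p‖ < η' → dist z p < σ := fun z hz => by
          rw [hdist]
          have := hz.trans_le (min_le_right _ _)
          rw [lt_div_iff₀ hr] at this
          linarith
        have hmain : ∀ z : ℂ, ‖z‖ < r → ‖1 - z / p‖ < η' / 2 →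
            ‖iteratedDeriv J (R - A) z‖ ≤ J.factorial * |C| * 3 ^ J / r ^ J := fun z hz hzη =>
          iteratedDeriv_bounded_near_singularity hr (hLr p hp)
            (fun y hy hys => ((hRan y ((hball (hnear y hy)).2 hys)).sub
              (hball (hnear y hy)).1).differentiableAt)
            (fun y hy hys => hCη y (hy.trans_le (min_le_left _ _)) hys) hz hzη
        have hAb := hbddOf hA
        have hevη : ∀ᶠ z in 𝓝 p, ‖1 - z / p‖ < η' / 2 := by
          have hc : ContinuousAt (fun z : ℂ => ‖1 - z / p‖) p := by fun_prop
          refine hc.eventually_lt continuousAt_const ?_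
          simpa [div_self hp0] using hη'0
        refine ⟨_, mem_nhdsWithin_of_mem_nhds (hAb.and hevη),
          J.factorial * |C| * 3 ^ J / r ^ J + (‖iteratedDeriv J A p‖ + 1), fun z hz => ?_⟩
        obtain ⟨⟨h1, h2⟩, h3⟩ := hz
        have h3 : ‖z‖ < r := by simpa using h3
        have hzs := ball_subset_slitDisk hr hε hLr (by simpa using h3 : z ∈ Metric.ball 0 r)
        have hAz : AnalyticAt ℂ A z := (hball (hnear z (h2.trans (by linarith)))).1
        have e : iteratedDeriv J R z = iteratedDeriv J (R - A) z + iteratedDeriv J A z := by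
          rw [iteratedDeriv_sub (hRan z hzs).contDiffAt hAz.contDiffAt]
          ring
        rw [e]
        exact (norm_add_le _ _).trans (add_le_add (hmain z h3 h2) h1)
      · have hps : p ∈ slitDisk r ε L := by
          rw [mem_slitDisk_iff hL0]
          refine ⟨by linarith, fun l hl => ?_⟩
          exact one_sub_div_mem_slitPlane_of_ne hr (hLr l hl) hpr fun h => hp (h ▸ hl)
        exact ⟨_, mem_nhdsWithin_of_mem_nhds (hbddOf (hRan p hps)), _, fun z hz => hz.1⟩
  exact isBigO_coeff_of_iteratedDeriv_bounded hr hb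
    (hR.mono (ball_subset_slitDisk hr hε hLr))
    fun z hz => hC z ⟨Metric.ball_subset_closedBall hz, hz⟩

/-! ### Rapidly decreasing coefficients -/

/-- Pascal's rule writes the remainder for (n + 1, J + 1) as that for (n, J + 1) minus X times that
for (n, J), and the bounds add up in the same way. -/
theorem abs_one_sub_pow_sub_sum_le {X : ℝ} (h0 : 0 ≤ X) (h1 : X ≤ 1) (n J : ℕ) :
    |(1 - X) ^ n - ∑ j ∈ Finset.range J, (n.choose j : ℝ) * (-X) ^ j| ≤ n.choose J * X ^ J := by
  induction n generalizing J with
  | zero =>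
    cases J with
    | zero => simp
    | succ J => simp [Finset.sum_range_succ']
  | succ n ih =>
    cases J with
    | zero =>
      simp only [Finset.range_zero, Finset.sum_empty, sub_zero, Nat.choose_zero_right, pow_zero,
        Nat.cast_one, mul_one]
      rw [abs_of_nonneg (pow_nonneg (by linarith) _)]
      exact pow_le_one₀ (by linarith) (by linarith)
    | succ J =>
      have e : (1 - X) ^ (n + 1) -
          ∑ j ∈ Finset.range (J + 1), ((n + 1).choose j : ℝ) * (-X) ^ j =
          ((1 - X) ^ n - ∑ j ∈ Finset.range (J + 1), (n.choose j : ℝ) * (-X) ^ j) -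
          X * ((1 - X) ^ n - ∑ j ∈ Finset.range J, (n.choose j : ℝ) * (-X) ^ j) := by
        rw [Finset.sum_range_succ' (fun j => ((n + 1).choose j : ℝ) * (-X) ^ j),
          Finset.sum_range_succ' (fun j => (n.choose j : ℝ) * (-X) ^ j)]
        simp only [Nat.choose_succ_succ, Nat.cast_add, add_mul, Finset.sum_add_distrib, mul_sub,
          Finset.mul_sum]
        have : ∀ j, X * ((n.choose j : ℝ) * (-X) ^ j) = -((n.choose j : ℝ) * (-X) ^ (j + 1)) :=
          fun j => by ring
        simp only [this, Finset.sum_neg_distrib, Nat.choose_zero_right, pow_succ (1 - X)]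
        ring
      rw [e]
      refine (abs_sub _ _).trans ?_
      rw [abs_mul, abs_of_nonneg h0, Nat.choose_succ_succ, Nat.cast_add, add_mul, pow_succ]
      have h2 := ih (J + 1)
      have h3 := mul_le_mul_of_nonneg_left (ih J) h0
      rw [pow_succ] at h2
      linarith

/-- If the coefficients of `G`, rescaled to radius of convergence `1`, decrease rapidly, then `G`
has a Taylor expansion at each boundary point `p`, along the radius through `p`. -/
theorem exists_radial_expansion {a : ℕ → ℂ} {G : ℂ → ℂ} {r : ℝ} (hr : 0 < r) {p : ℂ}
    (hp : ‖p‖ = r) (hGa : ∀ᶠ z in 𝓝 (0 : ℂ), HasSum (fun n : ℕ => a n * z ^ n) (G z))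
    (hG : DifferentiableOn ℂ G (Metric.ball 0 r))
    (ha : ∀ J : ℕ, (fun n : ℕ => a n * (r : ℂ) ^ n) =O[atTop] fun n : ℕ => ((n : ℝ) ^ J)⁻¹) :
    ∃ t : ℕ → ℂ, ∀ J : ℕ, (fun v : ℝ => G (p * (1 - Complex.exp v)) -
      ∑ j ∈ Finset.range J, t j * Complex.exp (j * v)) =O[atBot] fun v => Real.exp (J * v) := by
  -- The decay of order J + 2 beats (n choose J) ≤ n^J and leaves the summable n^(-2).
  have hsum : ∀ J : ℕ, Summable fun n : ℕ => ‖a n * p ^ n‖ * (n.choose J : ℝ) := by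
    intro J
    have h1 : Summable fun n : ℕ => ((n : ℝ) ^ 2)⁻¹ :=
      Real.summable_nat_pow_inv.2 (by norm_num)
    refine summable_of_isBigO_nat h1 ?_
    obtain ⟨C, hC⟩ := (ha (J + 2)).bound
    refine Asymptotics.IsBigO.of_bound C ?_
    filter_upwards [hC, eventually_gt_atTop 0] with n hn hn0
    have hn0 : (0 : ℝ) < n := by exact_mod_cast hn0
    have e : ‖a n * p ^ n‖ = ‖a n * (r : ℂ) ^ n‖ := by
      rw [norm_mul, norm_mul, norm_pow, norm_pow, hp, Complex.norm_real, Real.norm_of_nonneg hr.le]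
    rw [norm_mul, norm_norm, e, Real.norm_of_nonneg (by positivity),
      Real.norm_of_nonneg (by positivity)]
    rw [Real.norm_of_nonneg (by positivity)] at hn
    have hch : (n.choose J : ℝ) ≤ (n : ℝ) ^ J := by exact_mod_cast Nat.choose_le_pow n J
    calc ‖a n * (r : ℂ) ^ n‖ * (n.choose J : ℝ)
        ≤ (C * ((n : ℝ) ^ (J + 2))⁻¹) * (n : ℝ) ^ J :=
          mul_le_mul hn hch (by positivity) ((norm_nonneg _).trans hn)
      _ = C * ((n : ℝ) ^ 2)⁻¹ := by rw [pow_add]; field_simp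
  have hsumC : ∀ j : ℕ, Summable fun n : ℕ => a n * p ^ n * ((n.choose j : ℂ) * (-1) ^ j) := by
    intro j
    refine Summable.of_norm ?_
    have e : (fun n : ℕ => ‖a n * p ^ n * ((n.choose j : ℂ) * (-1) ^ j)‖) =
        fun n : ℕ => ‖a n * p ^ n‖ * (n.choose j : ℝ) := by
      funext n
      simp
    rw [e]
    exact hsum j
  -- Obtained by expanding (1 - X)^n in z = p(1 - X) and exchanging the sums.
  refine ⟨fun j => ∑' n : ℕ, a n * p ^ n * ((n.choose j : ℂ) * (-1) ^ j), fun J => ?_⟩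
  refine Asymptotics.IsBigO.of_bound (∑' n : ℕ, ‖a n * p ^ n‖ * (n.choose J : ℝ)) ?_
  filter_upwards [eventually_le_atBot 0] with v hv
  set X : ℝ := Real.exp v with hX
  have hX0 : 0 < X := Real.exp_pos v
  have hX1 : X ≤ 1 := Real.exp_le_one_iff.2 hv
  have hexp : Complex.exp v = (X : ℂ) := by rw [hX, Complex.ofReal_exp]
  have hexpj : ∀ j : ℕ, Complex.exp (j * v) = (X : ℂ) ^ j := fun j => by
    rw [Complex.exp_nat_mul, hexp]
  have hG1 : HasSum (fun n : ℕ => a n * p ^ n * (((1 - X) ^ n : ℝ) : ℂ))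
      (G (p * (1 - Complex.exp v))) := by
    have hz : p * (1 - Complex.exp v) ∈ Metric.ball (0 : ℂ) r := by
      have : (1 : ℂ) - X = ((1 - X : ℝ) : ℂ) := by push_cast; ring
      rw [mem_ball_zero_iff, norm_mul, hp, hexp, this, Complex.norm_real,
        Real.norm_of_nonneg (by linarith)]
      nlinarith
    have h := Complex.hasSum_taylorSeries_on_ball hG hz
    have e : (fun n : ℕ => a n * p ^ n * (((1 - X) ^ n : ℝ) : ℂ)) = fun n : ℕ =>
        ((n.factorial : ℂ)⁻¹ • (p * (1 - Complex.exp v) - 0) ^ n • iteratedDeriv n G 0) := by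
      funext n
      have hf : (n.factorial : ℂ) ≠ 0 := by exact_mod_cast n.factorial_ne_zero
      rw [iteratedDeriv_eq_of_hasSum hGa, hexp, sub_zero, mul_pow, smul_eq_mul, smul_eq_mul]
      push_cast
      field_simp
    rw [e]
    exact h
  have hG2 := hG1.sub (hasSum_sum fun j (_ : j ∈ Finset.range J) =>
    (hsumC j).hasSum.mul_right ((X : ℂ) ^ j))
  simp only [hexpj]
  rw [← hG2.tsum_eq]
  rw [Real.norm_of_nonneg (Real.exp_pos _).le, Real.exp_nat_mul, ← hX]
  refine tsum_of_norm_bounded ((hsum J).hasSum.mul_right (X ^ J)) fun n => ?_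
  have e : a n * p ^ n * (((1 - X) ^ n : ℝ) : ℂ) -
      ∑ j ∈ Finset.range J, a n * p ^ n * ((n.choose j : ℂ) * (-1) ^ j) * (X : ℂ) ^ j =
      a n * p ^ n *
        (((1 - X) ^ n - ∑ j ∈ Finset.range J, (n.choose j : ℝ) * (-X) ^ j : ℝ) : ℂ) := by
    push_cast
    rw [mul_sub, Finset.mul_sum]
    congr 1
    refine Finset.sum_congr rfl fun j _ => ?_
    rw [neg_pow (X : ℂ)]
    ring
  rw [e, norm_mul, Complex.norm_real, mul_assoc]
  exact mul_le_mul_of_nonneg_left (abs_one_sub_pow_sub_sum_le hX0.le hX1 n J) (norm_nonneg _)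

/-! ### Local expansions at the singularities -/

theorem HasQuasiUnipotentMonodromyAt.exists_logPuiseuxForm {G : ℂ → ℂ} {p : ℂ}
    (h : HasQuasiUnipotentMonodromyAt G p) :
    ∃ (c : ℝ) (f : ℂ → ℂ) (m N ν : ℕ) (g : ℕ → ℂ → ℂ), 0 < m ∧ HasLogPuiseuxForm f m N ν g ∧
      ∀ w : ℂ, w.re < c → |w.im| < Real.pi → f w = G (p * (1 - Complex.exp w)) := by
  obtain ⟨δ, hδ, f, hf, hfG, hgr, hfin, heig⟩ := h
  obtain ⟨m, ν, hm, hT⟩ := exists_iterate_fwdDiff_eq_zero hfin heig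
  obtain ⟨N, ν', g, hg⟩ := _root_.exists_logPuiseuxForm hδ hf hgr hm hT
  exact ⟨Real.log δ, f, m, N, ν', g, hm, hg,
    fun w hw hw' => hfG w (norm_exp_lt_of_re_lt_log hδ hw) hw'⟩

/-- Evaluates the truncation at the principal value w = log (1 - z/p), whose imaginary part is in
(-π, π) off the slit, where f agrees with G. -/
theorem HasQuasiUnipotentMonodromyAt.exists_local_series {G : ℂ → ℂ} {p : ℂ} (hp : p ≠ 0)
    (h : HasQuasiUnipotentMonodromyAt G p) :
    ∃ (m N ν : ℕ) (γ : ℕ → ℕ → ℂ), 0 < m ∧ ∀ J : ℕ, ∃ K₀ : ℕ, ∀ K ≥ K₀, ∃ C η : ℝ, 0 < η ∧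
      ∀ z, ‖1 - z / p‖ < η → 1 - z / p ∈ Complex.slitPlane →
        ‖G z - ∑ k ∈ Finset.range K, ∑ β ∈ Finset.range ν, γ k β *
          ((1 - z / p) ^ (((k - N) / m : ℚ) : ℂ) * Complex.log (1 - z / p) ^ β)‖ ≤
          C * ‖1 - z / p‖ ^ J := by
  obtain ⟨c₀, f, m, N, ν, g, hm, hg, hfG⟩ := h.exists_logPuiseuxForm
  obtain ⟨γ, hγ⟩ := hg.exists_truncation hm
  refine ⟨m, N, ν, γ, hm, fun J => ?_⟩
  obtain ⟨K₀, hK₀⟩ := hγ J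
  refine ⟨K₀, fun K hK => ?_⟩
  obtain ⟨C, c, hC⟩ := hK₀ K hK
  refine ⟨C, Real.exp (min c c₀), Real.exp_pos _, fun z hz hzs => ?_⟩
  set x := 1 - z / p with hx
  have hx0 : x ≠ 0 := Complex.slitPlane_ne_zero hzs
  have hxn : 0 < ‖x‖ := norm_pos_iff.2 hx0
  have hre : (Complex.log x).re < min c c₀ := by
    rw [Complex.log_re, Real.log_lt_iff_lt_exp hxn]
    exact hz
  have him : |(Complex.log x).im| < Real.pi := by
    rw [Complex.log_im, abs_lt]
    exact ⟨Complex.neg_pi_lt_arg x, lt_of_le_of_ne (Complex.arg_le_pi x)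
      (Complex.mem_slitPlane_iff_arg.1 hzs).1⟩
  have h1 := hC (Complex.log x) (hre.trans_le (min_le_left _ _)) him.le
  have h2 := hfG (Complex.log x) (hre.trans_le (min_le_right _ _)) him
  have h3 : p * (1 - x) = z := by rw [hx]; field_simp; ring
  rw [Complex.exp_log hx0, h3] at h2
  rw [h2, Complex.log_re, Real.exp_nat_mul, Real.exp_log hxn] at h1
  simp only [Complex.cpow_def_of_ne_zero hx0]
  simpa only [mul_comm (Complex.log x)] using h1

/-- Gives the nonvanishing of the expansion: rapid decay yields a Taylor expansion along the radius
to p, and then the log-Puiseux form is an analytic function of e^w = 1 - z/p. -/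
theorem HasQuasiUnipotentMonodromyAt.not_isSingularBoundaryPoint {a : ℕ → ℂ} {G : ℂ → ℂ} {r : ℝ}
    (hr : 0 < r) {p : ℂ} (hp : ‖p‖ = r) (h : HasQuasiUnipotentMonodromyAt G p)
    (hGa : ∀ᶠ z in 𝓝 (0 : ℂ), HasSum (fun n : ℕ => a n * z ^ n) (G z))
    (hG : DifferentiableOn ℂ G (Metric.ball 0 r))
    (ha : ∀ J : ℕ, (fun n : ℕ => a n * (r : ℂ) ^ n) =O[atTop] fun n : ℕ => ((n : ℝ) ^ J)⁻¹) :
    ¬ IsSingularBoundaryPoint G r p := by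
  have hp0 : p ≠ 0 := by rw [← norm_pos_iff, hp]; exact hr
  obtain ⟨c₀, f, m, N, ν, g, hm, hg, hfG⟩ := h.exists_logPuiseuxForm
  obtain ⟨t, ht⟩ := exists_radial_expansion hr hp hGa hG ha
  have ht' : ∀ J : ℕ, (fun v : ℝ => f v - ∑ j ∈ Finset.range J, t j * Complex.exp (j * v))
      =O[atBot] fun v => Real.exp (J * v) := fun J => by
    refine (ht J).congr' ?_ EventuallyEq.rfl
    filter_upwards [eventually_lt_atBot c₀] with v hv
    rw [hfG v (by simpa using hv) (by simpa using Real.pi_pos)]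
  obtain ⟨k, hk, c, hkc⟩ := hg.exists_analyticAt hm ht'
  rw [IsSingularBoundaryPoint, not_not]
  refine ⟨fun z => k (1 - z / p), ?_, ?_⟩
  · refine AnalyticAt.fun_comp ?_ (by fun_prop)
    simpa [div_self hp0] using hk
  · have hev : ∀ᶠ z in 𝓝 p, ‖1 - z / p‖ < Real.exp (min c c₀) := by
      have hc : ContinuousAt (fun z : ℂ => ‖1 - z / p‖) p := by fun_prop
      refine hc.eventually_lt continuousAt_const ?_
      simpa [div_self hp0] using Real.exp_pos _
    filter_upwards [mem_nhdsWithin_of_mem_nhds hev, self_mem_nhdsWithin] with z hz hzr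
    have hzs := one_sub_div_mem_slitPlane hr hp (by simpa using hzr)
    set x := 1 - z / p with hx
    have hx0 : x ≠ 0 := Complex.slitPlane_ne_zero hzs
    have hre : (Complex.log x).re < min c c₀ := by
      rw [Complex.log_re, Real.log_lt_iff_lt_exp (norm_pos_iff.2 hx0)]
      exact hz
    have him : |(Complex.log x).im| < Real.pi := by
      rw [Complex.log_im, abs_lt]
      exact ⟨Complex.neg_pi_lt_arg x, lt_of_le_of_ne (Complex.arg_le_pi x)
        (Complex.mem_slitPlane_iff_arg.1 hzs).1⟩
    have h1 := hkc (Complex.log x) (hre.trans_le (min_le_left _ _))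
    rw [hfG (Complex.log x) (hre.trans_le (min_le_right _ _)) him, Complex.exp_log hx0] at h1
    have h3 : p * (1 - x) = z := by rw [hx]; field_simp; ring
    rwa [h3] at h1

/-! ### Transfer to coefficients and conclusion -/

theorem hasSum_local_series (m N ν K : ℕ) (γ : ℕ → ℕ → ℂ) {z : ℂ} (hz : ‖z‖ < 1) :
    HasSum (fun n : ℕ => (∑ k ∈ Finset.range K, ∑ β ∈ Finset.range ν, γ k β *
        iteratedDeriv β (binomCoeff n) (((k - N) / m : ℚ) : ℂ)) * z ^ n)
      (∑ k ∈ Finset.range K, ∑ β ∈ Finset.range ν, γ k β *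
        ((1 - z) ^ (((k - N) / m : ℚ) : ℂ) * Complex.log (1 - z) ^ β)) := by
  simp only [Finset.sum_mul, mul_assoc]
  exact hasSum_sum fun k _ => hasSum_sum fun β _ =>
    (hasSum_iteratedDeriv_binomCoeff β hz _).mul_left _

theorem analyticAt_local_series (m N ν K : ℕ) (γ : ℕ → ℕ → ℂ) {p z : ℂ}
    (hz : 1 - z / p ∈ Complex.slitPlane) :
    AnalyticAt ℂ (fun z : ℂ => ∑ k ∈ Finset.range K, ∑ β ∈ Finset.range ν, γ k β *
      ((1 - z / p) ^ (((k - N) / m : ℚ) : ℂ) * Complex.log (1 - z / p) ^ β)) z := by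
  have h : AnalyticAt ℂ (fun z : ℂ => 1 - z / p) z := by fun_prop
  exact Finset.analyticAt_fun_sum _ fun k _ => Finset.analyticAt_fun_sum _ fun β _ =>
    analyticAt_const.mul ((h.cpow analyticAt_const hz).mul ((h.clog hz).pow β))

/-- Transfer of the local expansions at the singularities to the coefficients. -/
theorem isBigO_coeff_sub_local_series {a : ℕ → ℂ} {r ε : ℝ} (hr : 0 < r) (hε : 0 < ε)
    {L : Finset ℂ} (hLr : ∀ p ∈ L, ‖p‖ = r) {G : ℂ → ℂ}
    (hGa : ∀ᶠ z in 𝓝 (0 : ℂ), HasSum (fun n : ℕ => a n * z ^ n) (G z))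
    (hG : DifferentiableOn ℂ G (slitDisk r ε L)) (m N ν K : ℂ → ℕ) (γ : ℂ → ℕ → ℕ → ℂ) {J : ℕ}
    (hloc : ∀ p ∈ L, ∃ C η : ℝ, 0 < η ∧
      ∀ z, ‖1 - z / p‖ < η → 1 - z / p ∈ Complex.slitPlane →
        ‖G z - ∑ k ∈ Finset.range (K p), ∑ β ∈ Finset.range (ν p), γ p k β *
          ((1 - z / p) ^ (((k - N p) / m p : ℚ) : ℂ) * Complex.log (1 - z / p) ^ β)‖ ≤
          C * ‖1 - z / p‖ ^ J) :
    (fun n : ℕ => a n * (r : ℂ) ^ n - ∑ p ∈ L,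
      (∑ k ∈ Finset.range (K p), ∑ β ∈ Finset.range (ν p), γ p k β *
        iteratedDeriv β (binomCoeff n) (((k - N p) / m p : ℚ) : ℂ)) * (r / p) ^ n) =O[atTop]
      fun n : ℕ => ((n : ℝ) ^ J)⁻¹ := by
  have hL0 : ∀ l ∈ L, l ≠ 0 := fun l hl => by rw [← norm_pos_iff, hLr l hl]; exact hr
  set T : ℂ → ℂ → ℂ := fun p z => ∑ k ∈ Finset.range (K p), ∑ β ∈ Finset.range (ν p), γ p k β *
    ((1 - z / p) ^ (((k - N p) / m p : ℚ) : ℂ) * Complex.log (1 - z / p) ^ β) with hT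
  set u : ℂ → ℕ → ℂ := fun p n => ∑ k ∈ Finset.range (K p), ∑ β ∈ Finset.range (ν p), γ p k β *
    iteratedDeriv β (binomCoeff n) (((k - N p) / m p : ℚ) : ℂ) with hu
  have hTan : ∀ p z, 1 - z / p ∈ Complex.slitPlane → AnalyticAt ℂ (T p) z := fun p z hz =>
    analyticAt_local_series (m p) (N p) (ν p) (K p) (γ p) hz
  have hR : DifferentiableOn ℂ (fun z => G z - ∑ p ∈ L, T p z) (slitDisk r ε L) := by
    refine hG.fun_sub (DifferentiableOn.fun_sum fun p hp z hz => ?_)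
    exact (hTan p z (((mem_slitDisk_iff hL0).1 hz).2 p hp)).differentiableAt.differentiableWithinAt
  have hb : ∀ᶠ z in 𝓝 (0 : ℂ), HasSum (fun n : ℕ => (a n - ∑ p ∈ L, u p n * (1 / p) ^ n) * z ^ n)
      (G z - ∑ p ∈ L, T p z) := by
    filter_upwards [hGa, Metric.ball_mem_nhds 0 hr] with z hz hzr
    have h1 : HasSum (fun n : ℕ => a n * z ^ n - ∑ p ∈ L, u p n * (z / p) ^ n)
        (G z - ∑ p ∈ L, T p z) := by
      refine hz.sub (hasSum_sum fun p hp => ?_)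
      refine hasSum_local_series (m p) (N p) (ν p) (K p) (γ p) ?_
      rw [norm_div, hLr p hp, div_lt_one hr]
      simpa using hzr
    have e : (fun n : ℕ => (a n - ∑ p ∈ L, u p n * (1 / p) ^ n) * z ^ n) =
        fun n : ℕ => a n * z ^ n - ∑ p ∈ L, u p n * (z / p) ^ n := by
      funext n
      rw [sub_mul, Finset.sum_mul]
      congr 1
      refine Finset.sum_congr rfl fun p _ => ?_
      rw [mul_assoc, ← mul_pow]
      congr 2
      ring
    rw [e]
    exact h1
  have h := isBigO_coeff_of_local_bounds hr hε hLr hb hR (J := J) fun p hp => by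
    obtain ⟨C, η, hη, hC⟩ := hloc p hp
    -- Near p the local series of the other singularities are analytic; they form the analytic part
    -- in Darboux's method.
    refine ⟨fun z => -∑ q ∈ L.erase p, T q z, ?_, C, η, hη, fun z hz hzs => ?_⟩
    · refine (Finset.analyticAt_fun_sum _ fun q hq => hTan q p ?_).neg
      rw [Finset.mem_erase] at hq
      exact one_sub_div_mem_slitPlane_of_ne hr (hLr q hq.2) (hLr p hp).le (Ne.symm hq.1)
    · have e : G z - ∑ q ∈ L, T q z - -∑ q ∈ L.erase p, T q z = G z - T p z := by
        rw [← Finset.add_sum_erase L (fun q => T q z) hp]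
        ring
      rw [e]
      exact hC z hz hzs
  have e : (fun n : ℕ => (a n - ∑ p ∈ L, u p n * (1 / p) ^ n) * (r : ℂ) ^ n) =
      fun n : ℕ => a n * (r : ℂ) ^ n - ∑ p ∈ L, u p n * (r / p) ^ n := by
    funext n
    rw [sub_mul, Finset.sum_mul]
    congr 1
    refine Finset.sum_congr rfl fun p _ => ?_
    rw [mul_assoc, ← mul_pow]
    congr 2
    ring
  rw [← e]
  exact h

theorem theorem4p1 (a : ℕ → ℂ) (ha : ExponentiallyBounded a)
    (r ε : ℝ) (hr : 0 < r) (hε : 0 < ε)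
    (L : Finset ℂ) (hL : L.Nonempty) (hLr : ∀ p ∈ L, ‖p‖ = r)
    (G : ℂ → ℂ)
    (hGa : ∀ᶠ z in 𝓝 (0 : ℂ), HasSum (fun n : ℕ => a n * z ^ n) (G z))
    (hG : DifferentiableOn ℂ G (slitDisk r ε L))
    (hsing : ∀ p ∈ L, IsSingularBoundaryPoint G r p)
    (hmon : ∀ p ∈ L, HasQuasiUnipotentMonodromyAt G p) :
    IsNilssonType a := by
  have hL0 : ∀ l ∈ L, l ≠ 0 := fun l hl => by rw [← norm_pos_iff, hLr l hl]; exact hr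
  choose! m N ν γ hm hγ using fun p (hp : p ∈ L) => (hmon p hp).exists_local_series (hL0 p hp)
  choose! S d c hc hexp using fun p (hp : p ∈ L) =>
    exists_expansion_local_series (hm p hp) (N p) (ν p) (γ p)
  choose! K₁ hK₁ using hγ
  choose! K₂ hK₂ using hexp
  have hmain : ∀ J : ℕ, (fun n : ℕ => a n * (r : ℂ) ^ n -
      ∑ ω ∈ nilssonSegment (L.biUnion S) (L.sup d) ((J : ℚ), 0),
        (nilssonMonomial ω n : ℂ) * ∑ p ∈ L, c p ω * (r / p) ^ n) =O[atTop]
        fun n : ℕ => ((n : ℝ) ^ J)⁻¹ := by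
    intro J
    -- One truncation length per p serves both the error of the local series and that of its
    -- coefficient expansion.
    have h1 := isBigO_coeff_sub_local_series hr hε hLr hGa hG m N ν
      (fun p => max (K₁ p J) (K₂ p J)) γ (J := J)
      fun p hp => hK₁ p hp J _ (le_max_left _ _)
    have h2 : ∀ p ∈ L, _ := fun p hp =>
      (hK₂ p hp J (max (K₁ p J) (K₂ p J)) (le_max_right _ _)).mul
      (Asymptotics.IsBigO.of_bound (f := fun n : ℕ => (r / p) ^ n) (g := fun _ : ℕ => (1 : ℝ)) 1
        (Eventually.of_forall fun n => by
          rw [norm_pow, norm_div, hLr p hp, Complex.norm_real, Real.norm_of_nonneg hr.le,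
            div_self hr.ne']
          simp) : (fun n : ℕ => (r / p) ^ n) =O[atTop] fun _ => (1 : ℝ))
    have h3 := h1.add ((Asymptotics.IsBigO.fun_sum h2).congr_right fun n => mul_one _)
    refine h3.congr_left fun n => ?_
    rw [sub_add, ← Finset.sum_sub_distrib]
    congr 1
    simp only [Finset.mul_sum]
    rw [Finset.sum_comm]
    refine Finset.sum_congr rfl fun p hp => ?_
    rw [← sum_nilssonSegment_enlarge (Finset.subset_biUnion_of_mem S hp) (Finset.le_sup hp)
      (hc p hp), sub_mul, sub_sub_cancel, Finset.sum_mul]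
    simp only [mul_assoc]
  have hinj : Set.InjOn (fun p : ℂ => p⁻¹) L := fun p _ q _ h => inv_injective h
  -- A singularity at p produces the exponential p^(-n), so Λ consists of inverses and ρ = 1/r.
  refine ⟨L.biUnion S, L.sup d, r⁻¹, L.image fun p => p⁻¹, fun ω l => c l⁻¹ ω, inv_pos.2 hr,
    ?_, fun ω _ => ?_, ?_⟩
  · intro l hl
    obtain ⟨p, hp, rfl⟩ := Finset.mem_image.1 hl
    rw [norm_inv, hLr p hp]
  · refine tendsto_of_isBigO_expansion (inv_pos.2 hr) ?_ (fun J => ?_) ω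
    · intro l hl
      obtain ⟨p, hp, rfl⟩ := Finset.mem_image.1 hl
      rw [norm_inv, hLr p hp]
    · refine (hmain J).congr_left fun n => ?_
      simp only [Finset.sum_image hinj, inv_inv]
      push_cast
      rw [inv_pow, div_inv_eq_mul]
      congr 1
      refine Finset.sum_congr rfl fun ω _ => ?_
      congr 1
      refine Finset.sum_congr rfl fun p _ => ?_
      rw [div_inv_eq_mul, mul_comm p⁻¹, ← div_eq_mul_inv]
  -- If all coefficients vanish, `hmain` is the rapid decay that makes every p ∈ L a regular point;
  -- nonemptiness of L gives the contradiction.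
  · by_contra hne
    push Not at hne
    obtain ⟨p, hp⟩ := hL
    refine (hmon p hp).not_isSingularBoundaryPoint hr (hLr p hp) hGa
      (hG.mono (ball_subset_slitDisk hr hε hLr)) (fun J => ?_) (hsing p hp)
    refine (hmain J).congr_left fun n => ?_
    rw [Finset.sum_eq_zero fun ω hω => ?_, sub_zero]
    rw [Finset.sum_eq_zero fun q hq => ?_, mul_zero]
    have h := hne ω ((mem_nilssonSegment_nat.1 hω).1) q⁻¹ (Finset.mem_image_of_mem _ hq)
    rw [inv_inv] at h
    rw [h, zero_mul]
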